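/- Let $G$ be a connected (finite-dimensional, real) Lie group with Lie algebra $\mathfrak g$, let $N\subset G$ be a closed normal subgroup with Lie algebra $\mathfrak n$, and put $Q=G/N$, with Lie algebra $\mathfrak q=\mathfrak g/\mathfrak n$. A *$G$-operation* is a supercommutative $\mathbb Z$-graded real Fréchet algebra $\mathcal A=\bigoplus_n\mathcal A^n$ with a continuous odd derivation $d$ of degree $1$, $d^2=0$; a smooth action of $G$ by graded algebra automorphisms commuting with $d$, whose infinitesimal action is denoted $\mathcal L_X$ ($X\in\mathfrak g$); and a $G$-equivariant linear map $X\mapsto\mathcal I_X$ from $\mathfrak g$ to the continuous odd derivations of degree $-1$ such that $\mathcal I_X\mathcal I_Y+\mathcal I_Y\mathcal I_X=0$, $[\mathcal L_X,\mathcal I_Y]=\mathcal I_{[X,Y]}$ and $\mathcal I_Xd+d\mathcal I_X=\mathcal L_X$. For a Lie algebra $\mathfrak h$ with basis $(e_i)$ and structure constants $[e_j,e_k]=\sum_i C^i_{jk}e_i$, the *Weil algebra* is $S\mathfrak h^*\otimes\Lambda\mathfrak h^*$, graded by $\deg\Lambda^1=1$, $\deg S^1=2$. With $\theta^i\in\Lambda^1\mathfrak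 h^*$ the dual basis and $\Omega^i$ the corresponding elements of $S^1\mathfrak h^*$, its differential is the odd derivation with $d_W\theta^i=\Omega^i-\tfrac12\sum_{j,k} C^i_{jk}\theta^j\theta^k$ and $d_W\Omega^i=-\sum_{j,k} C^i_{jk}\theta^j\Omega^k$; the contraction $\iota_X$ is the odd derivation with $\iota_X\theta^i=\theta^i(X)$ and $\iota_X\Omega^i=0$; and $\mathbf L_X$ extends the coadjoint action. Write $W_G,W_N,W_Q$ for the Weil algebras of $\mathfrak g,\mathfrak n,\mathfrak q$. Tensor products are graded tensor products, with differential $d_W\otimes 1+\varepsilon\otimes d$, Lie derivatives $\mathbf L_X\otimes1+1\otimes\mathcal L_X$ and contractions $\iota_X\otimes 1+\varepsilon\otimes\mathcal I_X$, where $\varepsilon=(-1)^n$ in degree $n$. An element is *basic* if all Lie derivatives and contractions annihilate it. The Weil-model equivariant cohomology $WH^*_G(\mathcal A)$ is the cohomology of the complex of basic elements of $W_G\otimes\mathcal A$, and similarly for $Q$. Let $\mathcal A$ be a $G$-operation with a $G$-equivariant $N$-connection, that is, a degree-preserving unital algebra morphism $W_N\to\mathcal A$ that commutes with the differentials, with the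 Lie derivatives and contractions along $\mathfrak n$, and with the actions of $G$ (on $W_N$, the coadjoint action). Let $$\mathcal B=\mathcal A_{N,bas}=\{\omega\in\mathcal A:\ \omega\text{ is }N\text{-invariant and }\mathcal I_X\omega=0\ \ \forall X\in\mathfrak n\},$$ with the induced differential and the induced Lie derivatives and contractions along $\mathfrak q$. Let $j:W_Q\otimes\mathcal B\to W_G\otimes\mathcal A$ be the inclusion induced by $\mathfrak q^*\subset\mathfrak g^*$ and $\mathcal B\subset\mathcal A$. **Theorem.** The map $j$ commutes with the differentials, maps $Q$-basic elements to $G$-basic elements, and induces an isomorphism $$WH^n_Q(\mathcal B)\;\cong\;WH^n_G(\mathcal A)\qquad\text{for every } n\in\mathbb Z.$$ -/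

import Mathlib

open scoped TensorProduct Manifold ContDiff

noncomputable section

/-! ### Infinitesimal operations -/

/-- The Lie-algebra part of the structure of an operation: a supercommutative `ℤ`-graded algebra
`A = ⨁ Aⁿ` with a differential `d` of degree `1`, Lie derivatives `L_X` and contractions `I_X` of
degree `-1`, subject to the usual relations.  (That `L` commutes with `d`, acts by derivations of
degree `0` and is a representation of `𝔤` follows from these axioms.) -/
structure LieOperation (𝔤 A : Type*) [LieRing 𝔤] [LieAlgebra ℝ 𝔤] [Ring A] [Algebra ℝ A] where
  deg : ℤ → Submodule ℝ A
  one_mem : (1 : A) ∈ deg 0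
  mul_mem : ∀ {p q : ℤ} {a b : A}, a ∈ deg p → b ∈ deg q → a * b ∈ deg (p + q)
  isInternal : DirectSum.IsInternal deg
  super_comm : ∀ {p q : ℤ} {a b : A}, a ∈ deg p → b ∈ deg q →
    a * b = (-1 : ℝ) ^ (p * q) • (b * a)
  d : A →ₗ[ℝ] A
  d_mem : ∀ {p : ℤ} {a : A}, a ∈ deg p → d a ∈ deg (p + 1)
  d_mul : ∀ {p : ℤ} {a : A}, a ∈ deg p → ∀ b : A, d (a * b) = d a * b + (-1 : ℝ) ^ p • (a * d b)
  d_d : ∀ a : A, d (d a) = 0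
  lie : 𝔤 →ₗ[ℝ] A →ₗ[ℝ] A
  contr : 𝔤 →ₗ[ℝ] A →ₗ[ℝ] A
  contr_mem : ∀ (X : 𝔤) {p : ℤ} {a : A}, a ∈ deg p → contr X a ∈ deg (p - 1)
  contr_mul : ∀ (X : 𝔤) {p : ℤ} {a : A}, a ∈ deg p → ∀ b : A,
    contr X (a * b) = contr X a * b + (-1 : ℝ) ^ p • (a * contr X b)
  contr_contr : ∀ (X Y : 𝔤) (a : A), contr X (contr Y a) + contr Y (contr X a) = 0
  lie_contr : ∀ (X Y : 𝔤) (a : A), lie X (contr Y a) - contr Y (lie X a) = contr ⁅X, Y⁆ a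
  cartan : ∀ (X : 𝔤) (a : A), contr X (d a) + d (contr X a) = lie X a

namespace LieOperation

variable {𝔤 A : Type*} [LieRing 𝔤] [LieAlgebra ℝ 𝔤] [Ring A] [Algebra ℝ A]
  (op : LieOperation 𝔤 A)

theorem lie_d (X : 𝔤) (a : A) : op.lie X (op.d a) = op.d (op.lie X a) := by
  rw [← op.cartan, ← op.cartan, op.d_d, map_add, op.d_d, map_zero, zero_add, add_zero]

theorem lie_mem (X : 𝔤) {p : ℤ} {a : A} (ha : a ∈ op.deg p) : op.lie X a ∈ op.deg p := by
  rw [← op.cartan]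
  refine add_mem ?_ ?_
  · simpa using op.contr_mem X (op.d_mem ha)
  · simpa using op.d_mem (op.contr_mem X ha)

theorem lie_lie (X Y : 𝔤) (a : A) :
    op.lie X (op.lie Y a) - op.lie Y (op.lie X a) = op.lie ⁅X, Y⁆ a := by
  have h1 := op.lie_contr X Y (op.d a)
  have h2 := congrArg op.d (op.lie_contr X Y a)
  rw [map_sub] at h2
  rw [← op.cartan Y a, ← op.cartan Y (op.lie X a), ← op.cartan ⁅X, Y⁆ a, map_add, op.lie_d,
    ← h1, ← h2, op.lie_d]
  abel

theorem bijective_coeLinearMap : Function.Bijective (DirectSum.coeLinearMap op.deg) :=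
  op.isInternal

/-- The projection of `A` onto its component of degree `p`. -/
def proj (p : ℤ) : A →ₗ[ℝ] A :=
  (op.deg p).subtype ∘ₗ DirectSum.component ℝ ℤ (fun q => op.deg q) p ∘ₗ
    ((LinearEquiv.ofBijective (DirectSum.coeLinearMap op.deg) op.bijective_coeLinearMap).symm :
      A →ₗ[ℝ] DirectSum ℤ fun q => op.deg q)

theorem proj_mem (p : ℤ) (a : A) : op.proj p a ∈ op.deg p := Subtype.property _

theorem proj_of_mem {p q : ℤ} {a : A} (ha : a ∈ op.deg p) :
    op.proj q a = if p = q then a else 0 := by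
  have h : (LinearEquiv.ofBijective (DirectSum.coeLinearMap op.deg) op.bijective_coeLinearMap).symm a
      = DirectSum.lof ℝ ℤ (fun q => op.deg q) p ⟨a, ha⟩ := by
    rw [LinearEquiv.symm_apply_eq, LinearEquiv.ofBijective_apply, DirectSum.coeLinearMap_lof]
  simp only [proj, LinearMap.comp_apply, LinearEquiv.coe_coe, h]
  split_ifs with hpq
  · subst hpq
    simp [DirectSum.component.lof_self]
  · rw [DirectSum.component.of]
    simp [hpq]

theorem induction_deg {P : A → Prop} (a : A) (mem : ∀ (p : ℤ) (b : A), b ∈ op.deg p → P b)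
    (zero : P 0) (add : ∀ b c, P b → P c → P (b + c)) : P a := by
  have h : a ∈ ⨆ p, op.deg p := by
    rw [op.isInternal.submodule_iSup_eq_top]; trivial
  exact Submodule.iSup_induction op.deg (motive := P) h mem zero add

theorem proj_comm (T : A →ₗ[ℝ] A) (k : ℤ) (hT : ∀ p a, a ∈ op.deg p → T a ∈ op.deg (p + k))
    (p : ℤ) (a : A) : op.proj (p + k) (T a) = T (op.proj p a) := by
  induction a using op.induction_deg with
  | mem q b hb =>
    rw [op.proj_of_mem hb, op.proj_of_mem (hT q b hb)]
    by_cases h : q = p <;> simp [h]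
  | zero => simp
  | add b c hb hc => simp [hb, hc]

theorem exists_sum_proj (a : A) : ∃ s : Finset ℤ, a = ∑ p ∈ s, op.proj p a := by
  have h : a ∈ ⨆ p, op.deg p := by
    rw [op.isInternal.submodule_iSup_eq_top]; trivial
  obtain ⟨f, hf, hs⟩ := (Submodule.mem_iSup_iff_exists_finsupp op.deg a).1 h
  refine ⟨f.support, ?_⟩
  have key : ∀ p ∈ f.support, op.proj p a = f p := by
    intro p hp
    conv_lhs => rw [← hs]
    rw [Finsupp.sum, map_sum, Finset.sum_eq_single p]
    · rw [op.proj_of_mem (hf p), if_pos rfl]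
    · intro q _ hq
      rw [op.proj_of_mem (hf q), if_neg hq]
    · intro h; exact absurd hp h
  rw [Finset.sum_congr rfl key]
  exact hs.symm

theorem contr_proj (X : 𝔤) {a : A} (ha : op.contr X a = 0) (p : ℤ) :
    op.contr X (op.proj p a) = 0 := by
  rw [← op.proj_comm (op.contr X) (-1) (fun p a h => op.contr_mem X h), ha, map_zero]

theorem contr_one (X : 𝔤) : op.contr X 1 = 0 := by
  simpa using op.contr_mul X op.one_mem 1

theorem contr_mul_eq_zero (X : 𝔤) {a b : A} (ha : op.contr X a = 0) (hb : op.contr X b = 0) :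
    op.contr X (a * b) = 0 := by
  obtain ⟨s, hs⟩ := op.exists_sum_proj a
  rw [hs, Finset.sum_mul, map_sum]
  refine Finset.sum_eq_zero fun p _ => ?_
  rw [op.contr_mul X (op.proj_mem p a), op.contr_proj X ha, hb, zero_mul, mul_zero, smul_zero,
    add_zero]

/-- The operation of `𝔤 ⧸ 𝔫` on a graded subalgebra `B` of `A` that is stable under `d` and all
contractions and is annihilated by the contractions along the ideal `𝔫`. -/
def residual (𝔫 : LieIdeal ℝ 𝔤) (B : Subalgebra ℝ A)
    (hproj : ∀ b ∈ B, ∀ p : ℤ, op.proj p b ∈ B) (hd : ∀ b ∈ B, op.d b ∈ B)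
    (hcontr : ∀ (X : 𝔤), ∀ b ∈ B, op.contr X b ∈ B)
    (hlie : ∀ (X : 𝔤), ∀ b ∈ B, op.lie X b ∈ B)
    (hlie0 : ∀ X ∈ 𝔫, ∀ b ∈ B, op.lie X b = 0)
    (hcontr0 : ∀ X ∈ 𝔫, ∀ b ∈ B, op.contr X b = 0) : LieOperation (𝔤 ⧸ 𝔫) B where
  deg p := (op.deg p).comap B.val.toLinearMap
  one_mem := op.one_mem
  mul_mem ha hb := op.mul_mem ha hb
  isInternal := by
    refine DirectSum.isInternal_submodule_of_iSupIndep_of_iSup_eq_top ?_ ?_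
    · intro p
      rw [Submodule.disjoint_def]
      intro x hx hx'
      have h := op.isInternal.submodule_iSupIndep p
      rw [Submodule.disjoint_def] at h
      refine Subtype.ext (h x hx ?_)
      have : (⨆ (j) (_ : j ≠ p), (op.deg j).comap B.val.toLinearMap) ≤
          (⨆ (j) (_ : j ≠ p), op.deg j).comap B.val.toLinearMap :=
        iSup₂_le fun j hj => Submodule.comap_mono (le_iSup₂_of_le j hj le_rfl)
      exact this hx'
    · rw [eq_top_iff]
      rintro b -
      obtain ⟨s, hs⟩ := op.exists_sum_proj (b : A)
      have : b = ∑ p ∈ s, (⟨op.proj p b, hproj b b.2 p⟩ : B) := by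
        refine Subtype.ext ?_
        rw [AddSubmonoidClass.coe_finsetSum]
        exact hs
      rw [this]
      refine sum_mem fun p _ => Submodule.mem_iSup_of_mem p ?_
      exact op.proj_mem p b
  super_comm ha hb := Subtype.ext (op.super_comm ha hb)
  d := op.d.restrict (p := B.toSubmodule) (q := B.toSubmodule) hd
  d_mem ha := op.d_mem ha
  d_mul ha b := Subtype.ext (op.d_mul ha b)
  d_d a := Subtype.ext (op.d_d a)
  lie := 𝔫.toSubmodule.liftQ
    { toFun := fun X => (op.lie X).restrict (p := B.toSubmodule) (q := B.toSubmodule) (hlie X)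
      map_add' := fun X Y => by ext; simp
      map_smul' := fun c X => by ext; simp }
    (fun X hX => LinearMap.ext fun b => Subtype.ext (hlie0 X hX b b.2))
  contr := 𝔫.toSubmodule.liftQ
    { toFun := fun X => (op.contr X).restrict (p := B.toSubmodule) (q := B.toSubmodule) (hcontr X)
      map_add' := fun X Y => by ext; simp
      map_smul' := fun c X => by ext; simp }
    (fun X hX => LinearMap.ext fun b => Subtype.ext (hcontr0 X hX b b.2))
  contr_mem X := by
    induction X using Submodule.Quotient.induction_on with
    | _ X => exact fun ha => op.contr_mem X ha
  contr_mul X := by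
    induction X using Submodule.Quotient.induction_on with
    | _ X => exact fun ha b => Subtype.ext (op.contr_mul X ha b)
  contr_contr X Y a := by
    induction X using Submodule.Quotient.induction_on with
    | _ X =>
      induction Y using Submodule.Quotient.induction_on with
      | _ Y => exact Subtype.ext (op.contr_contr X Y a)
  lie_contr X Y a := by
    induction X using Submodule.Quotient.induction_on with
    | _ X =>
      induction Y using Submodule.Quotient.induction_on with
      | _ Y => exact Subtype.ext (op.lie_contr X Y a)
  cartan X a := by
    induction X using Submodule.Quotient.induction_on with
    | _ X => exact Subtype.ext (op.cartan X a)

end LieOperation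

/-! ### The Weil algebra -/

section Derivations

variable {V : Type*} [AddCommGroup V] [Module ℝ V]

/-- The derivation of the symmetric algebra that extends `f : V → V`: it is the `ε`-part of the
algebra map `v ↦ v + ε f(v)` into the dual numbers. -/
def symDeriv (f : V →ₗ[ℝ] V) : SymmetricAlgebra ℝ V →ₗ[ℝ] SymmetricAlgebra ℝ V :=
  (TrivSqZeroExt.sndHom (SymmetricAlgebra ℝ V) (SymmetricAlgebra ℝ V)).restrictScalars ℝ ∘ₗ
    (SymmetricAlgebra.lift (A := DualNumber (SymmetricAlgebra ℝ V))
      ((TrivSqZeroExt.inlAlgHom ℝ (SymmetricAlgebra ℝ V)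
          (SymmetricAlgebra ℝ V)).toLinearMap ∘ₗ SymmetricAlgebra.ι ℝ V +
        (TrivSqZeroExt.inrHom (SymmetricAlgebra ℝ V) (SymmetricAlgebra ℝ V)).restrictScalars ℝ ∘ₗ
          SymmetricAlgebra.ι ℝ V ∘ₗ f)).toLinearMap

/-- The (even) derivation of the exterior algebra that extends `f : V → V`: it is the `ε`-part of
the algebra map `v ↦ v + ε f(v)` into the dual numbers. -/
def extEvenDeriv (f : V →ₗ[ℝ] V) : ExteriorAlgebra ℝ V →ₗ[ℝ] ExteriorAlgebra ℝ V :=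
  (TrivSqZeroExt.sndHom (ExteriorAlgebra ℝ V) (ExteriorAlgebra ℝ V)).restrictScalars ℝ ∘ₗ
    (ExteriorAlgebra.lift (A := DualNumber (ExteriorAlgebra ℝ V)) ℝ
      ⟨(TrivSqZeroExt.inlAlgHom ℝ (ExteriorAlgebra ℝ V)
          (ExteriorAlgebra ℝ V)).toLinearMap ∘ₗ ExteriorAlgebra.ι ℝ +
        (TrivSqZeroExt.inrHom (ExteriorAlgebra ℝ V) (ExteriorAlgebra ℝ V)).restrictScalars ℝ ∘ₗ
          ExteriorAlgebra.ι ℝ ∘ₗ f, fun v => by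
        ext
        · simp
        · simp [ExteriorAlgebra.ι_add_mul_swap]⟩).toLinearMap

end Derivations

/-- The Weil algebra `W = S𝔤* ⊗ Λ𝔤*`. -/
def WeilAlgebra (𝔤 : Type*) [AddCommGroup 𝔤] [Module ℝ 𝔤] : Type _ :=
  SymmetricAlgebra ℝ (Module.Dual ℝ 𝔤) ⊗[ℝ] ExteriorAlgebra ℝ (Module.Dual ℝ 𝔤)

instance (𝔤 : Type*) [AddCommGroup 𝔤] [Module ℝ 𝔤] : Ring (WeilAlgebra 𝔤) :=
  inferInstanceAs (Ring
    (SymmetricAlgebra ℝ (Module.Dual ℝ 𝔤) ⊗[ℝ] ExteriorAlgebra ℝ (Module.Dual ℝ 𝔤)))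

instance (𝔤 : Type*) [AddCommGroup 𝔤] [Module ℝ 𝔤] : Algebra ℝ (WeilAlgebra 𝔤) :=
  inferInstanceAs (Algebra ℝ
    (SymmetricAlgebra ℝ (Module.Dual ℝ 𝔤) ⊗[ℝ] ExteriorAlgebra ℝ (Module.Dual ℝ 𝔤)))

namespace WeilAlgebra

section Functorial

variable {𝔤 𝔥 : Type*} [AddCommGroup 𝔤] [Module ℝ 𝔤] [AddCommGroup 𝔥] [Module ℝ 𝔥]

/-- The degree `n` part of the Weil algebra: `SⁱΛʲ` has degree `2i + j`. -/
def deg (𝔤 : Type*) [AddCommGroup 𝔤] [Module ℝ 𝔤] (n : ℤ) : Submodule ℝ (WeilAlgebra 𝔤) :=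
  ⨆ (i : ℕ) (j : ℕ) (_ : 2 * (i : ℤ) + (j : ℤ) = n),
    Submodule.map₂ (TensorProduct.mk ℝ _ _)
      (LinearMap.range (SymmetricAlgebra.ι ℝ (Module.Dual ℝ 𝔤)) ^ i)
      (LinearMap.range (ExteriorAlgebra.ι ℝ (M := Module.Dual ℝ 𝔤)) ^ j)

/-- The grading operator `ε` of the Weil algebra, equal to `(-1)ⁿ` in degree `n`. -/
def parity (𝔤 : Type*) [AddCommGroup 𝔤] [Module ℝ 𝔤] : WeilAlgebra 𝔤 →ₗ[ℝ] WeilAlgebra 𝔤 :=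
  TensorProduct.map LinearMap.id (CliffordAlgebra.involute (Q := 0)).toLinearMap

/-- The algebra morphism `W(𝔤) → W(𝔥)` induced by a linear map `f : 𝔥 → 𝔤`, by pulling back linear
forms. -/
def pullback (f : 𝔥 →ₗ[ℝ] 𝔤) : WeilAlgebra 𝔤 →ₐ[ℝ] WeilAlgebra 𝔥 :=
  Algebra.TensorProduct.map
    (SymmetricAlgebra.lift (SymmetricAlgebra.ι ℝ (Module.Dual ℝ 𝔥) ∘ₗ f.dualMap))
    (ExteriorAlgebra.map f.dualMap)

end Functorial

variable {𝔤 : Type*} [LieRing 𝔤] [LieAlgebra ℝ 𝔤]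

/-- The coadjoint action on `𝔤*`: `(L_X ξ)(Y) = -ξ([X, Y])`. -/
def coad (X : 𝔤) : Module.Dual ℝ 𝔤 →ₗ[ℝ] Module.Dual ℝ 𝔤 := -(LieAlgebra.ad ℝ 𝔤 X).dualMap

/-- The Lie derivative on the Weil algebra: the derivation that extends the coadjoint action. -/
def lie (X : 𝔤) : WeilAlgebra 𝔤 →ₗ[ℝ] WeilAlgebra 𝔤 :=
  TensorProduct.map (symDeriv (coad X)) LinearMap.id +
    TensorProduct.map LinearMap.id (extEvenDeriv (coad X))

/-- The contraction on the Weil algebra: zero on `S𝔤*`, the interior product on `Λ𝔤*`. -/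
def contr (X : 𝔤) : WeilAlgebra 𝔤 →ₗ[ℝ] WeilAlgebra 𝔤 :=
  TensorProduct.map LinearMap.id
    (CliffordAlgebra.contractLeft (Q := 0) (Module.Dual.eval ℝ 𝔤 X))

/-- The differential `d_W = ½ θᵏ L_k + θᵏ L_k + Ωᵏ ι_k` of the Weil algebra, where the first `L_k`
acts on `Λ𝔤*` and the second one on `S𝔤*`, for a basis `(e_k)` of `𝔤` with dual basis `(θᵏ)`, and
`Ωᵏ` is `θᵏ` regarded as an element of `S¹𝔤*`.  On generators,
`d θⁱ = -½ Cⁱⱼₖ θʲ θᵏ + Ωⁱ` and `d Ωⁱ = -Cⁱⱼₖ θʲ Ωᵏ`. -/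
def d (𝔤 : Type*) [LieRing 𝔤] [LieAlgebra ℝ 𝔤] [Module.Finite ℝ 𝔤] :
    WeilAlgebra 𝔤 →ₗ[ℝ] WeilAlgebra 𝔤 :=
  let e := Module.finBasis ℝ 𝔤
  ∑ k, ((1 / 2 : ℝ) • TensorProduct.map LinearMap.id
          (LinearMap.mulLeft ℝ (ExteriorAlgebra.ι ℝ (e.coord k)) ∘ₗ extEvenDeriv (coad (e k))) +
        TensorProduct.map (symDeriv (coad (e k)))
          (LinearMap.mulLeft ℝ (ExteriorAlgebra.ι ℝ (e.coord k))) +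
        TensorProduct.map (LinearMap.mulLeft ℝ (SymmetricAlgebra.ι ℝ _ (e.coord k)))
          (CliffordAlgebra.contractLeft (Q := 0) (Module.Dual.eval ℝ 𝔤 (e k))))

end WeilAlgebra

/-! ### The Weil model of equivariant cohomology -/

namespace LieOperation

variable {𝔤 A : Type*} [LieRing 𝔤] [LieAlgebra ℝ 𝔤] [Ring A] [Algebra ℝ A]
  (op : LieOperation 𝔤 A)

/-- The degree `n` part of `W ⊗ A`. -/
def weilDeg (n : ℤ) : Submodule ℝ (WeilAlgebra 𝔤 ⊗[ℝ] A) :=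
  ⨆ (p : ℤ) (q : ℤ) (_ : p + q = n),
    Submodule.map₂ (TensorProduct.mk ℝ _ _) (WeilAlgebra.deg 𝔤 p) (op.deg q)

/-- The differential `d_W ⊗ 1 + ε ⊗ d` of `W ⊗ A`. -/
def weilD [Module.Finite ℝ 𝔤] : WeilAlgebra 𝔤 ⊗[ℝ] A →ₗ[ℝ] WeilAlgebra 𝔤 ⊗[ℝ] A :=
  TensorProduct.map (WeilAlgebra.d 𝔤) LinearMap.id + TensorProduct.map (WeilAlgebra.parity 𝔤) op.d

/-- The Lie derivative `L_X ⊗ 1 + 1 ⊗ L_X` of `W ⊗ A`. -/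
def weilLie (X : 𝔤) : WeilAlgebra 𝔤 ⊗[ℝ] A →ₗ[ℝ] WeilAlgebra 𝔤 ⊗[ℝ] A :=
  TensorProduct.map (WeilAlgebra.lie X) LinearMap.id + TensorProduct.map LinearMap.id (op.lie X)

/-- The contraction `ι_X ⊗ 1 + ε ⊗ I_X` of `W ⊗ A`. -/
def weilContr (X : 𝔤) : WeilAlgebra 𝔤 ⊗[ℝ] A →ₗ[ℝ] WeilAlgebra 𝔤 ⊗[ℝ] A :=
  TensorProduct.map (WeilAlgebra.contr X) LinearMap.id +
    TensorProduct.map (WeilAlgebra.parity 𝔤) (op.contr X)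

/-- The basic elements of `W ⊗ A`: those annihilated by all Lie derivatives and contractions. -/
def weilBasic : Submodule ℝ (WeilAlgebra 𝔤 ⊗[ℝ] A) :=
  (⨅ X : 𝔤, LinearMap.ker (op.weilLie X)) ⊓ ⨅ X : 𝔤, LinearMap.ker (op.weilContr X)

variable [Module.Finite ℝ 𝔤]

/-- The basic cocycles of degree `n` in `W ⊗ A`. -/
def weilCocycles (n : ℤ) : Submodule ℝ (WeilAlgebra 𝔤 ⊗[ℝ] A) :=
  op.weilBasic ⊓ op.weilDeg n ⊓ LinearMap.ker op.weilD

/-- The basic coboundaries of degree `n` in `W ⊗ A`. -/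
def weilCoboundaries (n : ℤ) : Submodule ℝ (WeilAlgebra 𝔤 ⊗[ℝ] A) :=
  (op.weilBasic ⊓ op.weilDeg (n - 1)).map op.weilD

/-- The equivariant cohomology `WHⁿ(A)` in the Weil model: the degree `n` cohomology of the complex
of basic elements of `W ⊗ A`. -/
abbrev WeilCohomology (n : ℤ) : Type _ :=
  op.weilCocycles n ⧸ (op.weilCoboundaries n).submoduleOf (op.weilCocycles n)

/-- The class of a basic cocycle. -/
def weilClass (n : ℤ) : op.weilCocycles n →ₗ[ℝ] op.WeilCohomology n :=
  ((op.weilCoboundaries n).submoduleOf (op.weilCocycles n)).mkQ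

end LieOperation

/-! ### Lie groups, operations of Lie groups -/

/-- Fréchet algebras: topological algebras whose underlying topological vector space is locally
convex, Hausdorff, metrizable and complete. -/
class FrechetAlgebra (A : Type*) [Ring A] [Algebra ℝ A] [TopologicalSpace A] : Prop extends
    IsTopologicalRing A, ContinuousSMul ℝ A, LocallyConvexSpace ℝ A, T2Space A,
    FirstCountableTopology A where
  complete : @CompleteSpace A (IsTopologicalAddGroup.rightUniformSpace A)

section LieGroup

variable {m : ℕ} {G : Type*} [TopologicalSpace G] [ChartedSpace (EuclideanSpace ℝ (Fin m)) G]
  [Group G]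

instance [LieGroup (𝓡 m) ∞ G] : LieGroup (𝓡 m) (minSmoothness ℝ 3) G := by
  rw [minSmoothness_of_isRCLikeNormedField]
  infer_instance

variable (m G) in
/-- The Lie algebra of `G`. -/
abbrev LieAlg : Type := GroupLieAlgebra (𝓡 m) G

instance : Module.Finite ℝ (LieAlg m G) :=
  inferInstanceAs (Module.Finite ℝ (EuclideanSpace ℝ (Fin m)))

variable (m) in
/-- The adjoint representation: `Ad g` is the derivative at `1` of `h ↦ g h g⁻¹`. -/
def Ad (g : G) : LieAlg m G →ₗ[ℝ] LieAlg m G where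
  toFun X := mfderiv (𝓡 m) (𝓡 m) (fun h : G => g * h * g⁻¹) 1 X
  map_add' X Y := map_add (mfderiv (𝓡 m) (𝓡 m) (fun h : G => g * h * g⁻¹) 1) X Y
  map_smul' c X := map_smul (mfderiv (𝓡 m) (𝓡 m) (fun h : G => g * h * g⁻¹) 1) c X

variable (m) in
/-- The velocity at time `0` of a curve `γ` in `G` with `γ 0 = 1`. -/
def velocity (γ : ℝ → G) : LieAlg m G := mfderiv 𝓘(ℝ, ℝ) (𝓡 m) γ 0 (1 : ℝ)

end LieGroup

/-- A `G`-operation: a Fréchet algebra `A` with the structure of an operation, where the Lie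
derivatives are the infinitesimal action of a smooth action of the Lie group `G` on `A` by
automorphisms.  In a Fréchet space, a map is smooth if and only if its compositions with all
continuous linear functionals are; this is how smoothness of the action is expressed. -/
structure GOperation (m : ℕ) (G A : Type*) [TopologicalSpace G]
    [ChartedSpace (EuclideanSpace ℝ (Fin m)) G] [Group G] [LieGroup (𝓡 m) ∞ G]
    [Ring A] [Algebra ℝ A] [TopologicalSpace A] [FrechetAlgebra A] extends
    LieOperation (LieAlg m G) A where
  d_continuous : Continuous d
  contr_continuous : ∀ X, Continuous (contr X)
  /-- the action of `G` by algebra automorphisms -/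
  act : G →* (A ≃ₐ[ℝ] A)
  act_mem : ∀ (g : G) {p : ℤ} {a : A}, a ∈ deg p → act g a ∈ deg p
  act_d : ∀ (g : G) (a : A), act g (d a) = d (act g a)
  act_continuous : Continuous fun x : G × A => act x.1 x.2
  act_smooth : ∀ (a : A) (φ : A →L[ℝ] ℝ), ContMDiff (𝓡 m) 𝓘(ℝ, ℝ) ∞ fun g : G => φ (act g a)
  /-- `L_X` is the derivative at `1` of the action in the direction `X` -/
  lie_eq : ∀ (X : LieAlg m G) (a : A) (φ : A →L[ℝ] ℝ),
    φ (lie X a) = mfderiv (𝓡 m) 𝓘(ℝ, ℝ) (fun g : G => φ (act g a)) 1 X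
  contr_equivariant : ∀ (g : G) (X : LieAlg m G) (a : A),
    act g (contr X a) = contr (Ad m g X) (act g a)

/-- The Lie algebra of a closed normal subgroup `N`, as an ideal of the Lie algebra of `G`: it
consists of the velocities at `1` of curves in `N` that are smooth at `1` as curves in `G`.  (These
velocities form an ideal, so that taking the ideal spanned by them adds nothing.) -/
def lieIdeal (m : ℕ) {G : Type*} [TopologicalSpace G] [ChartedSpace (EuclideanSpace ℝ (Fin m)) G]
    [Group G] [LieGroup (𝓡 m) ∞ G] (N : Subgroup G) : LieIdeal ℝ (LieAlg m G) :=
  LieSubmodule.lieSpan ℝ (LieAlg m G) {X | ∃ γ : ℝ → G, γ 0 = 1 ∧ (∀ t, γ t ∈ N) ∧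
    ContMDiffAt 𝓘(ℝ, ℝ) (𝓡 m) ∞ γ 0 ∧ velocity m γ = X}

set_option linter.unusedSectionVars false

section Velocity

variable {m : ℕ} {G : Type*} [TopologicalSpace G] [ChartedSpace (EuclideanSpace ℝ (Fin m)) G]
  [Group G] [LieGroup (𝓡 m) ∞ G]

theorem velocity_mul {α β : ℝ → G} (hα : MDifferentiableAt 𝓘(ℝ, ℝ) (𝓡 m) α 0)
    (hβ : MDifferentiableAt 𝓘(ℝ, ℝ) (𝓡 m) β 0) (hα1 : α 0 = 1) (hβ1 : β 0 = 1) :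
    velocity m (fun t => α t * β t) = velocity m α + velocity m β := by
  have hmul : MDifferentiableAt ((𝓡 m).prod (𝓡 m)) (𝓡 m) (fun p : G × G => p.1 * p.2)
      (α 0, β 0) :=
    (contMDiff_mul (𝓡 m) ∞).mdifferentiable (by simp) _
  have h1 : HasMFDerivAt 𝓘(ℝ, ℝ) (𝓡 m) (fun t => α t * β t) 0
      ((mfderiv ((𝓡 m).prod (𝓡 m)) (𝓡 m) (fun p : G × G => p.1 * p.2) (α 0, β 0)) ∘L
        ((mfderiv 𝓘(ℝ, ℝ) (𝓡 m) α 0).prod (mfderiv 𝓘(ℝ, ℝ) (𝓡 m) β 0))) :=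
    HasMFDerivAt.comp 0 hmul.hasMFDerivAt (hα.hasMFDerivAt.prodMk hβ.hasMFDerivAt)
  let w : TangentSpace ((𝓡 m).prod (𝓡 m)) (α 0, β 0) :=
    ((mfderiv 𝓘(ℝ, ℝ) (𝓡 m) α 0).prod (mfderiv 𝓘(ℝ, ℝ) (𝓡 m) β 0)) (1 : ℝ)
  have h2 := mfderiv_prod_eq_add_apply (v := w) hmul
  have h3 : ∀ (a b : G) (_ : b = 1) (v : TangentSpace (𝓡 m) a),
      (mfderiv (𝓡 m) (𝓡 m) (fun z : G => z * b) a v : EuclideanSpace ℝ (Fin m)) = v := by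
    rintro a _ rfl v
    have e : (fun z : G => z * 1) = id := by ext; simp
    exact (congrArg (fun f : G → G => (mfderiv (𝓡 m) (𝓡 m) f a v : EuclideanSpace ℝ (Fin m)))
      e).trans (by rw [mfderiv_id]; rfl)
  have h4 : ∀ (a b : G) (_ : b = 1) (v : TangentSpace (𝓡 m) a),
      (mfderiv (𝓡 m) (𝓡 m) (fun z : G => b * z) a v : EuclideanSpace ℝ (Fin m)) = v := by
    rintro a _ rfl v
    have e : (fun z : G => 1 * z) = id := by ext; simp
    exact (congrArg (fun f : G → G => (mfderiv (𝓡 m) (𝓡 m) f a v : EuclideanSpace ℝ (Fin m)))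
      e).trans (by rw [mfderiv_id]; rfl)
  have h5 : velocity m (fun t => α t * β t) = ((mfderiv ((𝓡 m).prod (𝓡 m)) (𝓡 m)
      (fun p : G × G => p.1 * p.2) (α 0, β 0)) w : EuclideanSpace ℝ (Fin m)) :=
    congrArg (fun f : TangentSpace 𝓘(ℝ, ℝ) (0 : ℝ) →L[ℝ] TangentSpace (𝓡 m) (α 0 * β 0) =>
      (f (1 : ℝ) : EuclideanSpace ℝ (Fin m))) h1.mfderiv
  exact h5.trans (h2.trans (congrArg₂ (fun x y : EuclideanSpace ℝ (Fin m) => x + y)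
    (h3 _ _ hβ1 _) (h4 _ _ hα1 _)))

theorem velocity_comp {M E' H' : Type*} [NormedAddCommGroup E'] [NormedSpace ℝ E']
    [TopologicalSpace H'] {I' : ModelWithCorners ℝ E' H'} [TopologicalSpace M] [ChartedSpace H' M]
    {γ : ℝ → G} (hγ : MDifferentiableAt 𝓘(ℝ, ℝ) (𝓡 m) γ 0) (hγ1 : γ 0 = 1) {f : G → M}
    (hf : MDifferentiableAt (𝓡 m) I' f 1) :
    (mfderiv 𝓘(ℝ, ℝ) I' (f ∘ γ) 0 (1 : ℝ) : E') = mfderiv (𝓡 m) I' f 1 (velocity m γ) := by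
  have h := mfderiv_comp (I' := 𝓡 m) (0 : ℝ) (hγ1.symm ▸ hf) hγ
  rw [h]
  have : ∀ (y : G) (h : 1 = y) (v : LieAlg m G),
      (mfderiv (𝓡 m) I' f y v : E') = (mfderiv (𝓡 m) I' f 1 v : E') := by
    rintro _ rfl _; rfl
  exact this _ hγ1.symm _

theorem contMDiff_conj (g : G) : ContMDiff (𝓡 m) (𝓡 m) ∞ fun h : G => g * h * g⁻¹ :=
  (contMDiff_mul_right (a := g⁻¹)).comp (contMDiff_mul_left (a := g))

theorem velocity_conj (g : G) {γ : ℝ → G} (hγ : MDifferentiableAt 𝓘(ℝ, ℝ) (𝓡 m) γ 0)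
    (hγ1 : γ 0 = 1) : velocity m (fun t => g * γ t * g⁻¹) = Ad m g (velocity m γ) :=
  velocity_comp hγ hγ1 ((contMDiff_conj g).mdifferentiable (by simp) 1)

theorem velocity_inv {γ : ℝ → G} (hγ : MDifferentiableAt 𝓘(ℝ, ℝ) (𝓡 m) γ 0) (hγ1 : γ 0 = 1) :
    velocity m (fun t => (γ t)⁻¹) = -velocity m γ := by
  have hi : MDifferentiableAt 𝓘(ℝ, ℝ) (𝓡 m) (fun t => (γ t)⁻¹) 0 :=
    ((contMDiff_inv (𝓡 m) ∞).mdifferentiable (by simp) (γ 0)).comp 0 hγ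
  have h := velocity_mul hγ hi hγ1 (by simp [hγ1])
  have h0 : velocity m (fun t => γ t * (γ t)⁻¹) = 0 := by
    have e : (fun t => γ t * (γ t)⁻¹) = fun _ => (1 : G) := by ext; simp
    rw [e]
    exact congrArg (fun f : TangentSpace 𝓘(ℝ, ℝ) (0 : ℝ) →L[ℝ] TangentSpace (𝓡 m) (1 : G) =>
      (f (1 : ℝ) : EuclideanSpace ℝ (Fin m))) mfderiv_const
  rw [h0] at h
  exact (neg_eq_of_add_eq_zero_right h.symm).symm

theorem exists_curve (X : LieAlg m G) : ∃ γ : ℝ → G, γ 0 = 1 ∧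
    ContMDiffAt 𝓘(ℝ, ℝ) (𝓡 m) ∞ γ 0 ∧ velocity m γ = X := by
  let φ := extChartAt (𝓡 m) (1 : G)
  have hs : ContMDiffAt 𝓘(ℝ, EuclideanSpace ℝ (Fin m)) (𝓡 m) ∞ φ.symm (φ 1) :=
    (contMDiffOn_extChartAt_symm (1 : G)).contMDiffAt (extChartAt_target_mem_nhds (1 : G))
  have hφ : ContMDiffAt (𝓡 m) 𝓘(ℝ, EuclideanSpace ℝ (Fin m)) ∞ φ (1 : G) := contMDiffAt_extChartAt
  let Y : EuclideanSpace ℝ (Fin m) :=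
    mfderiv (𝓡 m) 𝓘(ℝ, EuclideanSpace ℝ (Fin m)) φ (1 : G) X
  let l : ℝ → EuclideanSpace ℝ (Fin m) := fun t => φ 1 + t • Y
  have hl : ContDiff ℝ ∞ l := by fun_prop
  have hl0 : l 0 = φ 1 := by simp [l]
  have hld : HasFDerivAt l (ContinuousLinearMap.toSpanSingleton ℝ Y) 0 :=
    (ContinuousLinearMap.toSpanSingleton ℝ Y).hasFDerivAt.const_add (φ 1)
  refine ⟨φ.symm ∘ l, ?_, ?_, ?_⟩
  · simp only [Function.comp, hl0]
    exact extChartAt_to_inv (1 : G)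
  · exact ContMDiffAt.comp 0 (hl0 ▸ hs) hl.contMDiff.contMDiffAt
  · have hs' : MDifferentiableAt 𝓘(ℝ, EuclideanSpace ℝ (Fin m)) (𝓡 m) φ.symm (φ 1) :=
      hs.mdifferentiableAt (by simp)
    have h1 : HasMFDerivAt 𝓘(ℝ, ℝ) (𝓡 m) (φ.symm ∘ l) 0
        ((mfderiv 𝓘(ℝ, EuclideanSpace ℝ (Fin m)) (𝓡 m) φ.symm (l 0)) ∘L
          (ContinuousLinearMap.toSpanSingleton ℝ Y)) :=
      HasMFDerivAt.comp 0 (hl0.symm ▸ hs').hasMFDerivAt hld.hasMFDerivAt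
    have h2 : HasMFDerivAt (𝓡 m) (𝓡 m) (φ.symm ∘ φ) 1
        ((mfderiv 𝓘(ℝ, EuclideanSpace ℝ (Fin m)) (𝓡 m) φ.symm (φ 1)) ∘L
          (mfderiv (𝓡 m) 𝓘(ℝ, EuclideanSpace ℝ (Fin m)) φ (1 : G))) :=
      HasMFDerivAt.comp 1 hs'.hasMFDerivAt (hφ.mdifferentiableAt (by simp)).hasMFDerivAt
    have h3 : HasMFDerivAt (𝓡 m) (𝓡 m) (φ.symm ∘ φ) (1 : G)
        (ContinuousLinearMap.id ℝ (TangentSpace (𝓡 m) (1 : G))) := by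
      refine (hasMFDerivAt_id (1 : G)).congr_of_eventuallyEq ?_
      filter_upwards [extChartAt_source_mem_nhds (I := 𝓡 m) (1 : G)] with x hx
      exact φ.left_inv hx
    have h4 : ∀ y (_ : φ 1 = y) (v : EuclideanSpace ℝ (Fin m)),
        (mfderiv 𝓘(ℝ, EuclideanSpace ℝ (Fin m)) (𝓡 m) φ.symm y v : EuclideanSpace ℝ (Fin m)) =
          (mfderiv 𝓘(ℝ, EuclideanSpace ℝ (Fin m)) (𝓡 m) φ.symm (φ 1) v :
            EuclideanSpace ℝ (Fin m)) := by
      rintro _ rfl _; rfl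
    have h5 : velocity m (φ.symm ∘ l) =
        (mfderiv 𝓘(ℝ, EuclideanSpace ℝ (Fin m)) (𝓡 m) φ.symm (l 0) ((1 : ℝ) • Y) :
          EuclideanSpace ℝ (Fin m)) :=
      congrArg (fun f : TangentSpace 𝓘(ℝ, ℝ) (0 : ℝ) →L[ℝ] TangentSpace (𝓡 m)
        ((φ.symm ∘ l) 0) => (f (1 : ℝ) : EuclideanSpace ℝ (Fin m))) h1.mfderiv
    refine h5.trans ?_
    rw [one_smul]
    refine (h4 _ hl0.symm Y).trans ?_
    exact congrArg (fun f : TangentSpace (𝓡 m) (1 : G) →L[ℝ] TangentSpace (𝓡 m)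
        ((φ.symm ∘ φ) 1) => (f X : EuclideanSpace ℝ (Fin m))) (hasMFDerivAt_unique h2 h3)

end Velocity

section Adjoint

variable {m : ℕ} {G : Type*} [TopologicalSpace G] [ChartedSpace (EuclideanSpace ℝ (Fin m)) G]
  [Group G] [LieGroup (𝓡 m) ∞ G]

theorem Ad_lie (g : G) (X Y : LieAlg m G) : Ad m g ⁅X, Y⁆ = ⁅Ad m g X, Ad m g Y⁆ := by
  have hc : ∀ k : G, ContMDiff (𝓡 m) (𝓡 m) ∞ fun h : G => k * h * k⁻¹ := contMDiff_conj
  have hcd : ∀ k h : G, MDifferentiableAt (𝓡 m) (𝓡 m) (fun h : G => k * h * k⁻¹) h :=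
    fun k h => (hc k).mdifferentiable (by simp) h
  have hL : ∀ k h : G, MDifferentiableAt (𝓡 m) (𝓡 m) (fun h : G => k * h) h :=
    fun k h => (contMDiff_mul_left (I := 𝓡 m) (n := ∞)).mdifferentiable (by simp) h
  let E := EuclideanSpace ℝ (Fin m)
  let c : G → G := fun h => g * h * g⁻¹
  have hc1 : c 1 = 1 := by simp [c]
  -- `c` maps the invariant vector field of `Z` to that of `Ad g Z`
  have key : ∀ (Z : LieAlg m G) (h : G),
      (mfderiv (𝓡 m) (𝓡 m) c h (mulInvariantVectorField Z h) : E) =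
        (mulInvariantVectorField (Ad m g Z) (c h) : E) := by
    intro Z h
    have e1 : HasMFDerivAt (𝓡 m) (𝓡 m) (c ∘ fun z => h * z) 1
        ((mfderiv (𝓡 m) (𝓡 m) c (h * 1)) ∘L (mfderiv (𝓡 m) (𝓡 m) (fun z => h * z) (1 : G))) :=
      HasMFDerivAt.comp 1 (hcd g _).hasMFDerivAt (hL h 1).hasMFDerivAt
    have e2 : HasMFDerivAt (𝓡 m) (𝓡 m) ((fun z => c h * z) ∘ c) 1
        ((mfderiv (𝓡 m) (𝓡 m) (fun z => c h * z) (c 1)) ∘L (mfderiv (𝓡 m) (𝓡 m) c (1 : G))) :=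
      HasMFDerivAt.comp 1 (hL _ _).hasMFDerivAt (hcd g 1).hasMFDerivAt
    have e3 : (c ∘ fun z => h * z) = (fun z => c h * z) ∘ c := by
      ext z; simp only [c, Function.comp]; group
    rw [e3] at e1
    have e4 := congrArg (fun f : TangentSpace (𝓡 m) (1 : G) →L[ℝ] TangentSpace (𝓡 m)
      (((fun z => c h * z) ∘ c) 1) => (f Z : E)) (hasMFDerivAt_unique e1 e2)
    have e5 : ∀ y (_ : h = y) (v : E), (mfderiv (𝓡 m) (𝓡 m) c y v : E) =
      (mfderiv (𝓡 m) (𝓡 m) c h v : E) := by rintro _ rfl _; rfl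
    have e6 : ∀ y (_ : 1 = y) (v : E), (mfderiv (𝓡 m) (𝓡 m) (fun z => c h * z) y v : E) =
      (mfderiv (𝓡 m) (𝓡 m) (fun z => c h * z) 1 v : E) := by rintro _ rfl _; rfl
    exact ((e5 _ (mul_one h).symm _).symm.trans e4).trans (e6 _ hc1.symm _)
  -- `mfderiv c` is invertible
  have hinv : ∀ h : G, (mfderiv (𝓡 m) (𝓡 m) c h).IsInvertible := by
    intro h
    let c' : G → G := fun h => g⁻¹ * h * g⁻¹⁻¹
    have e1 : c' ∘ c = id := by ext z; simp only [c, c', Function.comp, id]; group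
    have e2 : c ∘ c' = id := by ext z; simp only [c, c', Function.comp, id]; group
    have hh : c' (c h) = h := congrFun e1 h
    have f1 : HasMFDerivAt (𝓡 m) (𝓡 m) (c' ∘ c) h
        ((mfderiv (𝓡 m) (𝓡 m) c' (c h)) ∘L (mfderiv (𝓡 m) (𝓡 m) c h)) :=
      HasMFDerivAt.comp h (hcd g⁻¹ _).hasMFDerivAt (hcd g _).hasMFDerivAt
    have f2 : HasMFDerivAt (𝓡 m) (𝓡 m) (c ∘ c') (c h)
        ((mfderiv (𝓡 m) (𝓡 m) c (c' (c h))) ∘L (mfderiv (𝓡 m) (𝓡 m) c' (c h))) :=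
      HasMFDerivAt.comp (c h) (hcd g _).hasMFDerivAt (hcd g⁻¹ _).hasMFDerivAt
    rw [e1] at f1
    rw [e2] at f2
    have g1 := hasMFDerivAt_unique f1 (hasMFDerivAt_id h)
    have g2 := hasMFDerivAt_unique f2 (hasMFDerivAt_id (c h))
    have e5 : ∀ y (_ : h = y) (v : E), (mfderiv (𝓡 m) (𝓡 m) c y v : E) =
      (mfderiv (𝓡 m) (𝓡 m) c h v : E) := by rintro _ rfl _; rfl
    have left : ∀ v : E, (mfderiv (𝓡 m) (𝓡 m) c' (c h) (mfderiv (𝓡 m) (𝓡 m) c h v) : E) = v :=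
      fun v => congrArg (fun f : E →L[ℝ] E => f v) g1
    have right : ∀ v : E, (mfderiv (𝓡 m) (𝓡 m) c h (mfderiv (𝓡 m) (𝓡 m) c' (c h) v) : E) = v :=
      fun v => (e5 _ hh.symm _).symm.trans (congrArg (fun f : E →L[ℝ] E => f v) g2)
    exact ⟨ContinuousLinearEquiv.equivOfInverse (mfderiv (𝓡 m) (𝓡 m) c h)
      (mfderiv (𝓡 m) (𝓡 m) c' (c h)) left right, rfl⟩
  have pull : ∀ Z : LieAlg m G, VectorField.mpullback (𝓡 m) (𝓡 m) c
      (mulInvariantVectorField (Ad m g Z)) = mulInvariantVectorField Z := by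
    intro Z
    ext1 h
    rw [VectorField.mpullback_apply]
    exact (hinv h).inverse_apply_eq.2 (key Z h).symm
  have hb := VectorField.mpullback_mlieBracket (I := 𝓡 m) (I' := 𝓡 m) (f := c) (x₀ := (1 : G))
    (n := ∞)
    (mdifferentiableAt_mulInvariantVectorField (I := 𝓡 m) (Ad m g X))
    (mdifferentiableAt_mulInvariantVectorField (I := 𝓡 m) (Ad m g Y)) ((hc g) 1) (by
      rw [minSmoothness_of_isRCLikeNormedField]; exact ENat.LEInfty.out)
  rw [pull, pull, VectorField.mpullback_apply] at hb
  have e7 : ∀ y (_ : 1 = y) , (VectorField.mlieBracket (𝓡 m) (mulInvariantVectorField (Ad m g X))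
      (mulInvariantVectorField (Ad m g Y)) y : E) = (VectorField.mlieBracket (𝓡 m)
        (mulInvariantVectorField (Ad m g X)) (mulInvariantVectorField (Ad m g Y)) (1 : G) : E) := by
    rintro _ rfl; rfl
  exact ((hinv 1).inverse_apply_eq.1 hb).symm.trans (e7 _ hc1.symm)

theorem Ad_mul_inv_sub_mem {N : Subgroup G} [N.Normal] {g : G} (hg : g ∈ N) (X : LieAlg m G) :
    Ad m g X - X ∈ lieIdeal m N := by
  obtain ⟨γ, h1, hs, rfl⟩ := exists_curve X
  have hd : MDifferentiableAt 𝓘(ℝ, ℝ) (𝓡 m) γ 0 := hs.mdifferentiableAt (by simp)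
  have hcs : ContMDiffAt 𝓘(ℝ, ℝ) (𝓡 m) ∞ (fun t => g * γ t * g⁻¹) 0 :=
    ContMDiffAt.comp 0 ((contMDiff_conj g) _) hs
  have his : ContMDiffAt 𝓘(ℝ, ℝ) (𝓡 m) ∞ (fun t => (γ t)⁻¹) 0 :=
    ContMDiffAt.comp 0 ((contMDiff_inv (𝓡 m) ∞) _) hs
  refine LieSubmodule.subset_lieSpan ⟨fun t => (g * γ t * g⁻¹) * (γ t)⁻¹, by simp [h1], fun t => ?_,
    hcs.mul his, ?_⟩
  · have : (g * γ t * g⁻¹) * (γ t)⁻¹ = g * (γ t * g⁻¹ * (γ t)⁻¹) := by group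
    change (g * γ t * g⁻¹) * (γ t)⁻¹ ∈ N
    rw [this]
    exact N.mul_mem hg (Subgroup.Normal.conj_mem ‹_› _ (N.inv_mem hg) _)
  · rw [velocity_mul (hcs.mdifferentiableAt (by simp)) (his.mdifferentiableAt (by simp))
      (by simp [h1]) (by simp [h1]), velocity_conj g hd h1, velocity_inv hd h1, sub_eq_add_neg]

theorem Ad_mem_lieIdeal {N : Subgroup G} [N.Normal] (g : G) {X : LieAlg m G}
    (hX : X ∈ lieIdeal m N) : Ad m g X ∈ lieIdeal m N := by
  induction hX using LieSubmodule.lieSpan_induction with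
  | mem X h =>
    obtain ⟨γ, h1, hN, hs, rfl⟩ := h
    refine LieSubmodule.subset_lieSpan ⟨fun t => g * γ t * g⁻¹, by simp [h1],
      fun t => Subgroup.Normal.conj_mem ‹_› _ (hN t) g,
      ContMDiffAt.comp 0 ((contMDiff_conj g) _) hs,
      velocity_conj g (hs.mdifferentiableAt (by simp)) h1⟩
  | zero => rw [map_zero]; exact zero_mem _
  | add X Y _ _ hX hY => rw [map_add]; exact add_mem hX hY
  | smul c X _ hX => rw [map_smul]; exact Submodule.smul_mem _ c hX
  | lie X Y _ hY => rw [Ad_lie]; exact LieSubmodule.lie_mem _ hY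

end Adjoint

/-! ### The reduction of a `G`-operation modulo a closed normal subgroup -/

namespace GOperation

variable {m : ℕ} {G A : Type*} [TopologicalSpace G] [ChartedSpace (EuclideanSpace ℝ (Fin m)) G]
  [Group G] [LieGroup (𝓡 m) ∞ G] [Ring A] [Algebra ℝ A] [TopologicalSpace A] [FrechetAlgebra A]
  (op : GOperation m G A) (N : Subgroup G)

theorem act_lie (g : G) (X : LieAlg m G) (a : A) :
    op.act g (op.lie X a) = op.lie (Ad m g X) (op.act g a) := by
  rw [← op.cartan, ← op.cartan, map_add, op.contr_equivariant, op.act_d, op.act_d,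
    op.contr_equivariant]

theorem act_proj (g : G) (p : ℤ) (a : A) : op.proj p (op.act g a) = op.act g (op.proj p a) := by
  simpa using op.proj_comm (op.act g).toLinearMap 0
    (fun p a h => by rw [add_zero]; exact op.act_mem g h) p a

/-- The subalgebra `A_{N,bas}` of the elements of `A` that are `N`-invariant and annihilated by the
contractions along the Lie algebra of `N`. -/
def basicSubalgebra : Subalgebra ℝ A where
  carrier := {a | (∀ g ∈ N, op.act g a = a) ∧ ∀ X ∈ lieIdeal m N, op.contr X a = 0}
  mul_mem' ha hb := ⟨fun g hg => by rw [map_mul, ha.1 g hg, hb.1 g hg],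
    fun X hX => op.contr_mul_eq_zero X (ha.2 X hX) (hb.2 X hX)⟩
  add_mem' ha hb := ⟨fun g hg => by rw [map_add, ha.1 g hg, hb.1 g hg],
    fun X hX => by rw [map_add, ha.2 X hX, hb.2 X hX, add_zero]⟩
  algebraMap_mem' r := ⟨fun g _ => (op.act g).commutes r, fun X _ => by
    rw [Algebra.algebraMap_eq_smul_one, map_smul, op.contr_one, smul_zero]⟩

variable {N} {op}

theorem lie_invariant [N.Normal] {a : A} (ha : ∀ g ∈ N, op.act g a = a) (X : LieAlg m G) {g : G}
    (hg : g ∈ N) : op.act g (op.lie X a) = op.lie X a := by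
  refine (SeparatingDual.eq_iff_forall_dual_eq (R := ℝ)).2 fun φ => ?_
  let ψ : A →L[ℝ] ℝ := ⟨φ.toLinearMap ∘ₗ (op.act g).toLinearMap,
    φ.continuous.comp (op.act_continuous.comp (Continuous.prodMk_right g))⟩
  have h1 := op.lie_eq X a ψ
  have h2 := op.lie_eq X a φ
  have h3 : (fun h : G => ψ (op.act h a)) = fun h : G => φ (op.act h a) := by
    ext h
    change φ (op.act g (op.act h a)) = _
    have : op.act g (op.act h a) = op.act h (op.act (h⁻¹ * g * h) a) := by
      rw [← AlgEquiv.mul_apply, ← AlgEquiv.mul_apply, ← map_mul, ← map_mul]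
      congr 2; group
    rw [this, ha]
    simpa using Subgroup.Normal.conj_mem ‹_› g hg h⁻¹
  rw [h3] at h1
  exact h1.trans h2.symm

theorem lie_eq_zero [N.Normal] {X : LieAlg m G} (hX : X ∈ lieIdeal m N) {a : A}
    (ha : ∀ g ∈ N, op.act g a = a) : op.lie X a = 0 := by
  induction hX using LieSubmodule.lieSpan_induction generalizing a with
  | mem X h =>
    obtain ⟨γ, h1, hN, hs, rfl⟩ := h
    refine SeparatingDual.eq_zero_of_forall_dual_eq_zero (R := ℝ) fun φ => ?_
    have h2 := velocity_comp (I' := 𝓘(ℝ, ℝ)) (hs.mdifferentiableAt (by simp)) h1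
      ((op.act_smooth a φ).mdifferentiable (by simp) 1)
    have h3 : ((fun g : G => φ (op.act g a)) ∘ γ) = fun _ => φ a := by
      ext t; simp [ha _ (hN t)]
    rw [op.lie_eq]
    refine h2.symm.trans ?_
    rw [h3]
    exact congrArg (fun f : TangentSpace 𝓘(ℝ, ℝ) (0 : ℝ) →L[ℝ] TangentSpace 𝓘(ℝ, ℝ) (φ a) =>
      (f (1 : ℝ) : ℝ)) mfderiv_const
  | zero => simp
  | add X Y _ _ hX hY => rw [map_add, LinearMap.add_apply, hX ha, hY ha, add_zero]
  | smul c X _ hX => rw [map_smul, LinearMap.smul_apply, hX ha, smul_zero]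
  | lie Y X _ hX =>
    rw [← op.lie_lie, hX ha, hX fun g hg => lie_invariant ha Y hg, map_zero, sub_zero]

variable (op N)

/-- The residual operation of the Lie algebra `𝔤 ⧸ 𝔫` of `Q = G / N` on `A_{N,bas}`. -/
def reduction [N.Normal] : LieOperation (LieAlg m G ⧸ lieIdeal m N) (op.basicSubalgebra N) :=
  have hcontr : ∀ (X : LieAlg m G), ∀ b ∈ op.basicSubalgebra N,
      op.contr X b ∈ op.basicSubalgebra N := fun X b hb => by
    refine ⟨fun g hg => ?_, fun Y hY => ?_⟩
    · have h := hb.2 _ (Ad_mul_inv_sub_mem hg X)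
      rw [map_sub, LinearMap.sub_apply, sub_eq_zero] at h
      rw [op.contr_equivariant, hb.1 g hg, h]
    · have h := op.contr_contr Y X b
      rwa [hb.2 Y hY, map_zero, add_zero] at h
  have hd : ∀ b ∈ op.basicSubalgebra N, op.d b ∈ op.basicSubalgebra N := fun b hb => by
    refine ⟨fun g hg => by rw [op.act_d, hb.1 g hg], fun X hX => ?_⟩
    have h := op.cartan X b
    rwa [hb.2 X hX, map_zero, add_zero, lie_eq_zero hX hb.1] at h
  op.residual (lieIdeal m N) (op.basicSubalgebra N)
    (fun b hb p => ⟨fun g hg => by rw [← op.act_proj, hb.1 g hg],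
      fun X hX => op.contr_proj X (hb.2 X hX) p⟩)
    hd hcontr
    (fun X b hb => by
      rw [← op.cartan]
      exact add_mem (hcontr X _ (hd b hb)) (hd _ (hcontr X b hb)))
    (fun X hX b hb => lie_eq_zero hX hb.1)
    (fun X hX b hb => hb.2 X hX)

/-- The inclusion `j : W_Q ⊗ A_{N,bas} → W_G ⊗ A`, induced by the projection `𝔤 → 𝔤 ⧸ 𝔫` and the
inclusion of `A_{N,bas}` in `A`. -/
def inclusion [N.Normal] : WeilAlgebra (LieAlg m G ⧸ lieIdeal m N) ⊗[ℝ] op.basicSubalgebra N →ₗ[ℝ]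
    WeilAlgebra (LieAlg m G) ⊗[ℝ] A :=
  TensorProduct.map
    (WeilAlgebra.pullback ((lieIdeal m N).toSubmodule.mkQ : LieAlg m G →ₗ[ℝ] _)).toLinearMap
    (op.basicSubalgebra N).val.toLinearMap

end GOperation

/-- The coadjoint action of `g` on the Weil algebra of `N`. -/
def coadjointAction {m : ℕ} {G : Type*} [TopologicalSpace G]
    [ChartedSpace (EuclideanSpace ℝ (Fin m)) G] [Group G] [LieGroup (𝓡 m) ∞ G]
    (N : Subgroup G) [N.Normal] (g : G) :
    WeilAlgebra (lieIdeal m N) →ₐ[ℝ] WeilAlgebra (lieIdeal m N) :=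
  WeilAlgebra.pullback
    ((Ad m g⁻¹).restrict (p := (lieIdeal m N).toSubmodule) (q := (lieIdeal m N).toSubmodule)
      fun _ hX => Ad_mem_lieIdeal g⁻¹ hX)

/-- A `G`-equivariant `N`-connection on a `G`-operation `A`: a `G`-equivariant morphism
`W_N → A` of `N`-operations. -/
structure EquivariantConnection {m : ℕ} {G A : Type*} [TopologicalSpace G]
    [ChartedSpace (EuclideanSpace ℝ (Fin m)) G] [Group G] [LieGroup (𝓡 m) ∞ G] [Ring A]
    [Algebra ℝ A] [TopologicalSpace A] [FrechetAlgebra A] (op : GOperation m G A)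
    (N : Subgroup G) [N.Normal] where
  toAlgHom : WeilAlgebra (lieIdeal m N) →ₐ[ℝ] A
  map_deg : ∀ {p : ℤ} {w}, w ∈ WeilAlgebra.deg (lieIdeal m N) p → toAlgHom w ∈ op.deg p
  map_d : ∀ w, toAlgHom (WeilAlgebra.d _ w) = op.d (toAlgHom w)
  map_lie : ∀ (X : lieIdeal m N) w,
    toAlgHom (WeilAlgebra.lie X w) = op.lie (X : LieAlg m G) (toAlgHom w)
  map_contr : ∀ (X : lieIdeal m N) w,
    toAlgHom (WeilAlgebra.contr X w) = op.contr (X : LieAlg m G) (toAlgHom w)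
  equivariant : ∀ (g : G) w, toAlgHom (coadjointAction N g w) = op.act g (toAlgHom w)

/-!
# Reduction in stages for the Weil model of equivariant cohomology

The proof compares the Weil models of `A` and of `A_{N,bas}` through their Cartan models. The
projection `toCartan : W ⊗ A → S𝔤* ⊗ A` that annihilates the generators `θᵏ` of degree `1` of `W`
is injective on horizontal elements (`IsHorizontal.ext`), and every invariant element of
`S𝔤* ⊗ A` is the image of a basic one (`exists_weilBasic`), obtained by the projector `∏ (1 - θᵏ I_k)`.
It turns the Weil differential into the Cartan differential `d_C = 1 ⊗ d - ∑ Ωᵏ ⊗ I_k`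
(`toCartan_weilD`). Hence the inclusion `j` of Weil models may be replaced by the inclusion
`S(𝔤/𝔫)* ⊗ A_{N,bas} → S𝔤* ⊗ A` of Cartan models, restricted to invariant elements.

Let `θ` be the connection form, `bᵢ` a basis of `𝔫`, and consider the operator
`K = ∑ ∂_{bᵢ} ⊗ θⁱ` on `S𝔤* ⊗ A`. Its anticommutator `D = d_C K + K d_C` is a derivation (`laplacian_mul`), and
it vanishes on the image `M` of `S(𝔤/𝔫)* ⊗ A_hor`, where `A_hor` is the algebra of the elements
that are annihilated by the contractions along `𝔫` (`laplacian_eq_zero`). Moreover, `S𝔤* ⊗ A` is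
the sum of `M` and of the eigenspaces of `D` for the eigenvalues `-1, -2, …`
(`addNegEigenspaces_eq_top`). Indeed, this sum is closed under products since `D` is a
derivation, and it contains a set of generators: the elements of `A_hor`, the components of `θ`
(eigenvalue `-1`), and, by the structure equation that expresses `dθ` by the curvature and a
quadratic term in `θ`, also the generators `Ωᵏ`. Therefore every `x` admits a polynomial `q` with
`x + D q(D) x ∈ M`. On invariant elements `d_C² = 0`, so that `D` commutes with `d_C`, and
`D q(D) x` is a coboundary if `x` is an invariant cocycle; this is `exists_mem_cartanReduced`.

Two facts about Lie groups enter. First, `D` preserves invariant elements because the connection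
is infinitesimally `𝔤`-invariant (`EquivariantConnection.lie_form`), which follows from its
equivariance since the derivative of `Ad` is the Lie bracket (`hasDerivAt_Ad`). Second, an
invariant element of `M` has coefficients not only in `A_hor` but in `A_{N,bas}`, even if `N` is
not connected: since `G` is connected, it is an equivariant polynomial map `𝔤/𝔫 → A_hor`
(`act_cartanEval`), and `N` acts trivially on `𝔤/𝔫`, so that its values are `N`-invariant
(`mem_range_cartanInclusion`).

Together this shows that `j` is surjective (`exists_inclusion_eq_add_weilD`) and injective
(`mem_weilCoboundaries_of_inclusion`) in cohomology.
-/

/-! ### Bases, dual bases and gradings -/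

section Duality

variable {V W M : Type*} [AddCommGroup V] [Module ℝ V] [AddCommGroup W] [Module ℝ W]
  [AddCommGroup M] [Module ℝ M]

theorem map_eq_sum_coord {κ : Type*} [Fintype κ] (b : Module.Basis κ ℝ V) (f : V →ₗ[ℝ] M)
    (v : V) : f v = ∑ k, b.coord k v • f (b k) := by
  conv_lhs => rw [← b.sum_repr v, map_sum]
  simp only [map_smul, Module.Basis.coord_apply]

/-- The canonical tensor `∑ vᵢ ⊗ vⁱ` is natural: `∑ T vᵢ ⊗ vⁱ = ∑ wⱼ ⊗ (wʲ ∘ T)`.  All invariance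
properties of operators that are defined by a sum over a basis come down to this identity. -/
theorem sum_basis_transpose {ι κ : Type*} [Fintype ι] [Fintype κ] (v : Module.Basis ι ℝ V)
    (w : Module.Basis κ ℝ W) (T : V →ₗ[ℝ] W) (B : W →ₗ[ℝ] Module.Dual ℝ V →ₗ[ℝ] M) :
    ∑ i, B (T (v i)) (v.coord i) = ∑ j, B (w j) (w.coord j ∘ₗ T) := by
  have h1 : ∀ i, T (v i) = ∑ j, w.coord j (T (v i)) • w j := fun i => (w.sum_repr _).symm
  have h2 : ∀ j, w.coord j ∘ₗ T = ∑ i, w.coord j (T (v i)) • v.coord i := fun j => by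
    ext x
    rw [map_eq_sum_coord v (w.coord j ∘ₗ T) x, LinearMap.sum_apply]
    exact Finset.sum_congr rfl fun i _ => mul_comm _ _
  calc ∑ i, B (T (v i)) (v.coord i)
      = ∑ i, ∑ j, w.coord j (T (v i)) • B (w j) (v.coord i) := by
        refine Finset.sum_congr rfl fun i _ => ?_
        conv_lhs => rw [h1 i]
        simp only [map_sum, map_smul, LinearMap.sum_apply, LinearMap.smul_apply]
    _ = ∑ j, ∑ i, w.coord j (T (v i)) • B (w j) (v.coord i) := Finset.sum_comm
    _ = ∑ j, B (w j) (w.coord j ∘ₗ T) := by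
        refine Finset.sum_congr rfl fun j _ => ?_
        rw [h2 j]
        simp only [map_sum, map_smul]

/-- A grading is determined by its Euler operator: membership in the component of degree `n` is an
eigenvalue equation. -/
theorem eq_eigenspace_of_iSup_eq_top (E : Module.End ℝ M) (D : ℤ → Submodule ℝ M)
    (hD : ∀ n, ∀ x ∈ D n, E x = (n : ℝ) • x) (htop : ⨆ n, D n = ⊤) {n : ℤ} {x : M} :
    x ∈ D n ↔ E x = (n : ℝ) • x := by
  refine ⟨hD n x, fun hx => ?_⟩
  have hle : ∀ k, D k ≤ E.eigenspace (k : ℝ) := fun k y hy =>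
    Module.End.mem_eigenspace_iff.2 (hD k y hy)
  have hx' : x ∈ D n ⊔ ⨆ (k) (_ : k ≠ n), D k := by
    have : (⨆ k, D k) ≤ D n ⊔ ⨆ (k) (_ : k ≠ n), D k := iSup_le fun k => by
      by_cases h : k = n
      · exact h ▸ le_sup_left
      · exact (le_iSup₂ (f := fun k (_ : k ≠ n) => D k) k h).trans le_sup_right
    exact this (htop ▸ trivial)
  obtain ⟨y, hy, z, hz, rfl⟩ := Submodule.mem_sup.1 hx'
  have hz1 : z ∈ E.eigenspace (n : ℝ) := by
    rw [Module.End.mem_eigenspace_iff]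
    have := hD n y hy
    rw [map_add, smul_add, this] at hx
    exact add_left_cancel hx
  have hz2 : z ∈ ⨆ (μ) (_ : μ ≠ (n : ℝ)), E.eigenspace μ :=
    (iSup₂_le fun k hk => (hle k).trans
      (le_iSup₂ (f := fun μ (_ : μ ≠ (n : ℝ)) => E.eigenspace μ) (k : ℝ)
        (by exact_mod_cast hk)) :
      (⨆ (k) (_ : k ≠ n), D k) ≤ _) hz
  have h0 := Submodule.disjoint_def.1 (E.eigenspaces_iSupIndep (n : ℝ)) z hz1 hz2
  rw [h0, add_zero]
  exact hy

end Duality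

/-! ### Derivations of the symmetric algebra -/

section SymmetricAlgebra

variable {V : Type*} [AddCommGroup V] [Module ℝ V]

namespace SymmetricAlgebra

/-- The derivation of the symmetric algebra that extends a linear map `f : V → S V`: it is the
`ε`-part of the algebra map `v ↦ v + ε f(v)` into the dual numbers. -/
def liftDerivation (f : V →ₗ[ℝ] SymmetricAlgebra ℝ V) :
    SymmetricAlgebra ℝ V →ₗ[ℝ] SymmetricAlgebra ℝ V :=
  (TrivSqZeroExt.sndHom (SymmetricAlgebra ℝ V) (SymmetricAlgebra ℝ V)).restrictScalars ℝ ∘ₗ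
    (SymmetricAlgebra.lift (A := DualNumber (SymmetricAlgebra ℝ V))
      ((TrivSqZeroExt.inlAlgHom ℝ (SymmetricAlgebra ℝ V)
          (SymmetricAlgebra ℝ V)).toLinearMap ∘ₗ SymmetricAlgebra.ι ℝ V +
        (TrivSqZeroExt.inrHom (SymmetricAlgebra ℝ V) (SymmetricAlgebra ℝ V)).restrictScalars ℝ ∘ₗ
          f)).toLinearMap

theorem liftDerivation_ι (f : V →ₗ[ℝ] SymmetricAlgebra ℝ V) (v : V) :
    liftDerivation f (ι ℝ V v) = f v := by
  simp [liftDerivation]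

theorem liftDerivation_mul (f : V →ₗ[ℝ] SymmetricAlgebra ℝ V) (x y : SymmetricAlgebra ℝ V) :
    liftDerivation f (x * y) = liftDerivation f x * y + x * liftDerivation f y := by
  set F := SymmetricAlgebra.lift (A := DualNumber (SymmetricAlgebra ℝ V))
      ((TrivSqZeroExt.inlAlgHom ℝ (SymmetricAlgebra ℝ V)
          (SymmetricAlgebra ℝ V)).toLinearMap ∘ₗ SymmetricAlgebra.ι ℝ V +
        (TrivSqZeroExt.inrHom (SymmetricAlgebra ℝ V) (SymmetricAlgebra ℝ V)).restrictScalars ℝ ∘ₗ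
          f) with hF
  have hfst : ∀ z, (F z).fst = z := fun z => by
    have : (TrivSqZeroExt.fstHom ℝ (SymmetricAlgebra ℝ V) (SymmetricAlgebra ℝ V)).comp F =
        AlgHom.id ℝ _ := by
      ext v; simp [hF]
    exact DFunLike.congr_fun this z
  have hd : ∀ z, liftDerivation f z = (F z).snd := fun z => rfl
  rw [hd, hd, hd, map_mul, TrivSqZeroExt.snd_mul, hfst, hfst]
  simp only [smul_eq_mul, MulOpposite.smul_eq_mul_unop, MulOpposite.unop_op]
  ring

theorem symDeriv_eq (f : V →ₗ[ℝ] V) : symDeriv f = liftDerivation (ι ℝ V ∘ₗ f) := rfl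

theorem symDeriv_ι (f : V →ₗ[ℝ] V) (v : V) : symDeriv f (ι ℝ V v) = ι ℝ V (f v) :=
  liftDerivation_ι _ _

theorem symDeriv_mul (f : V →ₗ[ℝ] V) (x y : SymmetricAlgebra ℝ V) :
    symDeriv f (x * y) = symDeriv f x * y + x * symDeriv f y :=
  liftDerivation_mul _ _ _

theorem derivation_one {D : SymmetricAlgebra ℝ V →ₗ[ℝ] SymmetricAlgebra ℝ V}
    (hD : ∀ x y, D (x * y) = D x * y + x * D y) : D 1 = 0 := by
  simpa using hD 1 1

theorem derivation_ext {D D' : SymmetricAlgebra ℝ V →ₗ[ℝ] SymmetricAlgebra ℝ V}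
    (hD : ∀ x y, D (x * y) = D x * y + x * D y) (hD' : ∀ x y, D' (x * y) = D' x * y + x * D' y)
    (h : ∀ v, D (ι ℝ V v) = D' (ι ℝ V v)) : D = D' := by
  ext x
  induction x using SymmetricAlgebra.induction with
  | algebraMap r =>
    rw [Algebra.algebraMap_eq_smul_one, map_smul, map_smul, derivation_one hD, derivation_one hD']
  | ι v => exact h v
  | mul x y hx hy => rw [hD, hD', hx, hy]
  | add x y hx hy => rw [map_add, map_add, hx, hy]

theorem commutator_mul {D D' : SymmetricAlgebra ℝ V →ₗ[ℝ] SymmetricAlgebra ℝ V}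
    (hD : ∀ x y, D (x * y) = D x * y + x * D y) (hD' : ∀ x y, D' (x * y) = D' x * y + x * D' y)
    (x y : SymmetricAlgebra ℝ V) : (D ∘ₗ D' - D' ∘ₗ D) (x * y) =
      (D ∘ₗ D' - D' ∘ₗ D) x * y + x * (D ∘ₗ D' - D' ∘ₗ D) y := by
  simp only [LinearMap.sub_apply, LinearMap.comp_apply, hD, hD', map_add]
  ring

theorem liftDerivation_add (f g : V →ₗ[ℝ] SymmetricAlgebra ℝ V) :
    liftDerivation (f + g) = liftDerivation f + liftDerivation g :=
  derivation_ext (liftDerivation_mul _) (fun x y => by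
    simp only [LinearMap.add_apply, liftDerivation_mul]; ring) fun v => by
    simp [liftDerivation_ι]

theorem liftDerivation_smul (c : ℝ) (f : V →ₗ[ℝ] SymmetricAlgebra ℝ V) :
    liftDerivation (c • f) = c • liftDerivation f :=
  derivation_ext (liftDerivation_mul _) (fun x y => by
    simp only [LinearMap.smul_apply, liftDerivation_mul, smul_add, smul_mul_assoc,
      mul_smul_comm]) fun v => by
    simp [liftDerivation_ι]

theorem symDeriv_add (f g : V →ₗ[ℝ] V) : symDeriv (f + g) = symDeriv f + symDeriv g := by
  simp only [symDeriv_eq, LinearMap.comp_add, liftDerivation_add]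

theorem symDeriv_smul (c : ℝ) (f : V →ₗ[ℝ] V) : symDeriv (c • f) = c • symDeriv f := by
  simp only [symDeriv_eq, LinearMap.comp_smul, liftDerivation_smul]

/-- The partial derivative of polynomial functions on a vector space in the direction `X`. -/
def partialDeriv (X : V) :
    SymmetricAlgebra ℝ (Module.Dual ℝ V) →ₗ[ℝ] SymmetricAlgebra ℝ (Module.Dual ℝ V) :=
  liftDerivation (Algebra.linearMap ℝ _ ∘ₗ Module.Dual.eval ℝ V X)

theorem partialDeriv_ι (X : V) (ξ : Module.Dual ℝ V) :
    partialDeriv X (ι ℝ _ ξ) = algebraMap ℝ _ (ξ X) :=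
  liftDerivation_ι _ _

theorem partialDeriv_mul (X : V) (x y : SymmetricAlgebra ℝ (Module.Dual ℝ V)) :
    partialDeriv X (x * y) = partialDeriv X x * y + x * partialDeriv X y :=
  liftDerivation_mul _ _ _

/-- `partialDeriv` as a linear map in the direction. -/
def partialDerivₗ : V →ₗ[ℝ]
    SymmetricAlgebra ℝ (Module.Dual ℝ V) →ₗ[ℝ] SymmetricAlgebra ℝ (Module.Dual ℝ V) where
  toFun := partialDeriv
  map_add' X Y := by
    rw [partialDeriv, map_add, LinearMap.comp_add, liftDerivation_add]; rfl
  map_smul' c X := by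
    rw [partialDeriv, map_smul, LinearMap.comp_smul, liftDerivation_smul]; rfl

/-- The commutator of the derivation induced by the transpose of `f` with the derivative along `X`
is minus the derivative along `f X`. -/
theorem symDeriv_partialDeriv (f : V →ₗ[ℝ] V) (X : V)
    (x : SymmetricAlgebra ℝ (Module.Dual ℝ V)) :
    symDeriv f.dualMap (partialDeriv X x) - partialDeriv X (symDeriv f.dualMap x) =
      -partialDeriv (f X) x := by
  have h : symDeriv f.dualMap ∘ₗ partialDeriv X - partialDeriv X ∘ₗ symDeriv f.dualMap =
      -partialDeriv (f X) :=
    derivation_ext (commutator_mul (symDeriv_mul _) (partialDeriv_mul _)) (fun x y => by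
      simp only [LinearMap.neg_apply, partialDeriv_mul]; ring) fun ξ => by
      simp only [LinearMap.sub_apply, LinearMap.comp_apply, partialDeriv_ι, symDeriv_ι,
        LinearMap.neg_apply, LinearMap.dualMap_apply]
      rw [Algebra.algebraMap_eq_smul_one, map_smul, derivation_one (symDeriv_mul _), smul_zero,
        zero_sub]
  exact DFunLike.congr_fun h x

/-- The map of symmetric algebras induced by a linear map. -/
def map {W : Type*} [AddCommGroup W] [Module ℝ W] (f : V →ₗ[ℝ] W) :
    SymmetricAlgebra ℝ V →ₐ[ℝ] SymmetricAlgebra ℝ W :=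
  SymmetricAlgebra.lift (ι ℝ W ∘ₗ f)

theorem map_ι {W : Type*} [AddCommGroup W] [Module ℝ W] (f : V →ₗ[ℝ] W) (v : V) :
    map f (ι ℝ V v) = ι ℝ W (f v) := by
  simp [map]

theorem map_injective {W : Type*} [AddCommGroup W] [Module ℝ W] {f : V →ₗ[ℝ] W}
    (hf : Function.Injective f) : Function.Injective (map f) := by
  obtain ⟨g, hg⟩ := f.exists_leftInverse_of_injective (LinearMap.ker_eq_bot.2 hf)
  have : (map g).comp (map f) = AlgHom.id ℝ _ := by
    ext v
    simpa [map_ι] using congrArg (ι ℝ V) (DFunLike.congr_fun hg v)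
  exact Function.LeftInverse.injective (g := map g) fun x => DFunLike.congr_fun this x

theorem map_symDeriv {W : Type*} [AddCommGroup W] [Module ℝ W] {f : V →ₗ[ℝ] W}
    {s : V →ₗ[ℝ] V} {t : W →ₗ[ℝ] W} (h : f ∘ₗ s = t ∘ₗ f) (x : SymmetricAlgebra ℝ V) :
    map f (symDeriv s x) = symDeriv t (map f x) := by
  induction x using SymmetricAlgebra.induction with
  | algebraMap r =>
    rw [AlgHom.commutes, Algebra.algebraMap_eq_smul_one, Algebra.algebraMap_eq_smul_one, map_smul,
      map_smul (symDeriv t), derivation_one (symDeriv_mul _), derivation_one (symDeriv_mul _)]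
    simp
  | ι v =>
    simpa only [symDeriv_ι, map_ι, LinearMap.comp_apply] using
      congrArg (ι ℝ W) (DFunLike.congr_fun h v)
  | mul x y hx hy => simp only [symDeriv_mul, map_add, map_mul, hx, hy]
  | add x y hx hy => simp only [map_add, hx, hy]

/-- The derivation that extends the identity is the Euler operator of the symmetric algebra. -/
theorem symDeriv_id_of_mem {i : ℕ} {x : SymmetricAlgebra ℝ V}
    (hx : x ∈ LinearMap.range (ι ℝ V) ^ i) : symDeriv LinearMap.id x = (i : ℝ) • x := by
  induction i generalizing x with
  | zero =>
    rw [pow_zero, Submodule.mem_one] at hx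
    obtain ⟨r, rfl⟩ := hx
    rw [Algebra.algebraMap_eq_smul_one, map_smul, derivation_one (symDeriv_mul _)]
    simp
  | succ i ih =>
    rw [pow_succ] at hx
    induction hx using Submodule.mul_induction_on' with
    | mem_mul_mem a ha b hb =>
      obtain ⟨v, rfl⟩ := hb
      rw [symDeriv_mul, ih ha, symDeriv_ι]
      push_cast
      rw [add_smul, one_smul, smul_mul_assoc, id_eq]
    | add a _ b _ ha hb => rw [map_add, ha, hb, smul_add]

theorem iSup_range_ι_pow : ⨆ i : ℕ, LinearMap.range (ι ℝ V) ^ i = ⊤ := by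
  rw [eq_top_iff]
  rintro x -
  induction x using SymmetricAlgebra.induction with
  | algebraMap r =>
    exact Submodule.mem_iSup_of_mem 0 (by rw [pow_zero]; exact Submodule.algebraMap_mem r)
  | ι v => exact Submodule.mem_iSup_of_mem 1 (by rw [pow_one]; exact ⟨v, rfl⟩)
  | mul x y hx hy =>
    have h : (⨆ i : ℕ, LinearMap.range (ι ℝ V) ^ i) * (⨆ i : ℕ, LinearMap.range (ι ℝ V) ^ i) ≤
        ⨆ i : ℕ, LinearMap.range (ι ℝ V) ^ i := by
      rw [Submodule.iSup_mul]
      refine iSup_le fun i => ?_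
      rw [Submodule.mul_iSup]
      exact iSup_le fun j => (pow_add (LinearMap.range (ι ℝ V)) i j) ▸ le_iSup_of_le (i + j) le_rfl
    exact h (Submodule.mul_mem_mul hx hy)
  | add x y hx hy => exact add_mem hx hy

end SymmetricAlgebra

end SymmetricAlgebra

/-! ### Derivations of the exterior algebra -/

section ExteriorAlgebra

variable {V : Type*} [AddCommGroup V] [Module ℝ V]

namespace ExteriorAlgebra

theorem left_induction {P : ExteriorAlgebra ℝ V → Prop} (one : P 1)
    (smul : ∀ (r : ℝ) x, P x → P (r • x)) (add : ∀ x y, P x → P y → P (x + y))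
    (ι_mul : ∀ v x, P x → P (ι ℝ v * x)) (x : ExteriorAlgebra ℝ V) :
    P x :=
  CliffordAlgebra.left_induction (Q := (0 : QuadraticForm ℝ V))
    (fun r => by rw [Algebra.algebraMap_eq_smul_one]; exact smul r _ one) add
    (fun x v hx => ι_mul v x hx) x

theorem hom_ext_left {M : Type*} [AddCommGroup M] [Module ℝ M] {f g : ExteriorAlgebra ℝ V →ₗ[ℝ] M}
    (one : f 1 = g 1) (ι_mul : ∀ v x, f x = g x → f (ι ℝ v * x) = g (ι ℝ v * x)) : f = g := by
  refine LinearMap.ext fun x => ?_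
  induction x using left_induction with
  | one => exact one
  | smul r x hx => rw [map_smul, map_smul, hx]
  | add x y hx hy => rw [map_add, map_add, hx, hy]
  | ι_mul v x hx => exact ι_mul v x hx

variable (V) in
theorem iSup_range_ι_pow : ⨆ i : ℕ, LinearMap.range (ι ℝ (M := V)) ^ i = ⊤ :=
  CliffordAlgebra.iSup_ι_range_eq_top (Q := (0 : QuadraticForm ℝ V))

theorem extEvenDeriv_ι (f : V →ₗ[ℝ] V) (v : V) : extEvenDeriv f (ι ℝ v) = ι ℝ (f v) := by
  simp [extEvenDeriv]

theorem extEvenDeriv_mul (f : V →ₗ[ℝ] V) (x y : ExteriorAlgebra ℝ V) :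
    extEvenDeriv f (x * y) = extEvenDeriv f x * y + x * extEvenDeriv f y := by
  set F := (ExteriorAlgebra.lift (A := DualNumber (ExteriorAlgebra ℝ V)) ℝ
      ⟨(TrivSqZeroExt.inlAlgHom ℝ (ExteriorAlgebra ℝ V)
          (ExteriorAlgebra ℝ V)).toLinearMap ∘ₗ ExteriorAlgebra.ι ℝ +
        (TrivSqZeroExt.inrHom (ExteriorAlgebra ℝ V) (ExteriorAlgebra ℝ V)).restrictScalars ℝ ∘ₗ
          ExteriorAlgebra.ι ℝ ∘ₗ f, fun v => by
        ext
        · simp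
        · simp [ExteriorAlgebra.ι_add_mul_swap]⟩) with hF
  have hfst : ∀ z, (F z).fst = z := fun z => by
    have : (TrivSqZeroExt.fstHom ℝ (ExteriorAlgebra ℝ V) (ExteriorAlgebra ℝ V)).comp F =
        AlgHom.id ℝ _ := by
      ext v; simp [hF]
    exact DFunLike.congr_fun this z
  have hd : ∀ z, extEvenDeriv f z = (F z).snd := fun z => rfl
  rw [hd, hd, hd, map_mul, TrivSqZeroExt.snd_mul, hfst, hfst]
  simp only [smul_eq_mul, MulOpposite.smul_eq_mul_unop, MulOpposite.unop_op]
  rw [add_comm]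

theorem extEvenDeriv_one (f : V →ₗ[ℝ] V) : extEvenDeriv f 1 = 0 := by
  simpa using extEvenDeriv_mul f 1 1

theorem extEvenDeriv_add (f g : V →ₗ[ℝ] V) :
    extEvenDeriv (f + g) = extEvenDeriv f + extEvenDeriv g :=
  hom_ext_left (by simp [extEvenDeriv_one]) fun v x hx => by
    simp only [LinearMap.add_apply] at hx ⊢
    simp only [extEvenDeriv_mul, extEvenDeriv_ι, hx, LinearMap.add_apply, map_add]
    noncomm_ring

theorem extEvenDeriv_smul (c : ℝ) (f : V →ₗ[ℝ] V) :
    extEvenDeriv (c • f) = c • extEvenDeriv f :=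
  hom_ext_left (by simp [extEvenDeriv_one]) fun v x hx => by
    simp only [LinearMap.smul_apply] at hx ⊢
    simp only [extEvenDeriv_mul, extEvenDeriv_ι, hx, LinearMap.smul_apply, map_smul, smul_add,
      smul_mul_assoc, mul_smul_comm]

/-- The interior product on the exterior algebra. -/
abbrev contract (φ : Module.Dual ℝ V) : ExteriorAlgebra ℝ V →ₗ[ℝ] ExteriorAlgebra ℝ V :=
  CliffordAlgebra.contractLeft (Q := (0 : QuadraticForm ℝ V)) φ

/-- The grading involution of the exterior algebra. -/
abbrev parity : ExteriorAlgebra ℝ V →ₐ[ℝ] ExteriorAlgebra ℝ V :=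
  CliffordAlgebra.involute (Q := (0 : QuadraticForm ℝ V))

theorem contract_one (φ : Module.Dual ℝ V) : contract φ (1 : ExteriorAlgebra ℝ V) = 0 :=
  CliffordAlgebra.contractLeft_one _ φ

theorem contract_ι_mul (φ : Module.Dual ℝ V) (v : V) (x : ExteriorAlgebra ℝ V) :
    contract φ (ι ℝ v * x) = φ v • x - ι ℝ v * contract φ x :=
  CliffordAlgebra.contractLeft_ι_mul φ v x

theorem parity_ι (v : V) : parity (ι ℝ v) = -ι ℝ v := CliffordAlgebra.involute_ι v

theorem parity_parity (x : ExteriorAlgebra ℝ V) : parity (parity x) = x :=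
  CliffordAlgebra.involute_involute x

theorem parity_contract (φ : Module.Dual ℝ V) (x : ExteriorAlgebra ℝ V) :
    parity (contract φ x) = -contract φ (parity x) := by
  have : parity.toLinearMap ∘ₗ contract φ = -(contract φ ∘ₗ parity.toLinearMap) :=
    hom_ext_left (by simp) fun v x hx => by
      simp only [LinearMap.comp_apply, AlgHom.toLinearMap_apply, LinearMap.neg_apply] at hx ⊢
      simp only [contract_ι_mul, map_sub, map_smul, map_mul, hx, parity_ι, neg_mul, map_neg]
      noncomm_ring
  exact DFunLike.congr_fun this x

theorem parity_extEvenDeriv (f : V →ₗ[ℝ] V) (x : ExteriorAlgebra ℝ V) :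
    parity (extEvenDeriv f x) = extEvenDeriv f (parity x) := by
  have : parity.toLinearMap ∘ₗ extEvenDeriv f = extEvenDeriv f ∘ₗ parity.toLinearMap :=
    hom_ext_left (by simp [extEvenDeriv_one]) fun v x hx => by
      simp only [LinearMap.comp_apply, AlgHom.toLinearMap_apply] at hx ⊢
      simp only [extEvenDeriv_mul, extEvenDeriv_ι, map_mul, map_add, hx, parity_ι, neg_mul,
        map_neg]
      abel
  exact DFunLike.congr_fun this x

theorem extEvenDeriv_contract (f : V →ₗ[ℝ] V) (φ : Module.Dual ℝ V) (x : ExteriorAlgebra ℝ V) :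
    extEvenDeriv f (contract φ x) - contract φ (extEvenDeriv f x) = -contract (φ ∘ₗ f) x := by
  have : extEvenDeriv f ∘ₗ contract φ - contract φ ∘ₗ extEvenDeriv f = -contract (φ ∘ₗ f) :=
    hom_ext_left (by simp [extEvenDeriv_one]) fun v x hx => by
      simp only [LinearMap.comp_apply, LinearMap.sub_apply, LinearMap.neg_apply] at hx ⊢
      rw [sub_eq_iff_eq_add] at hx
      simp only [extEvenDeriv_mul, extEvenDeriv_ι, contract_ι_mul, map_sub, map_smul, map_add,
        LinearMap.comp_apply, hx]
      noncomm_ring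
  exact DFunLike.congr_fun this x

/-- A derivation of degree `0` is `∑ f(bₖ) ∂ₖ`, with interior products `∂ₖ`. -/
theorem extEvenDeriv_eq_sum {κ : Type*} [Fintype κ] (b : Module.Basis κ ℝ V) (f : V →ₗ[ℝ] V)
    (x : ExteriorAlgebra ℝ V) :
    extEvenDeriv f x = ∑ k, ι ℝ (f (b k)) * contract (b.coord k) x := by
  have : extEvenDeriv f =
      ∑ k, LinearMap.mulLeft ℝ (ι ℝ (f (b k))) ∘ₗ contract (b.coord k) :=
    hom_ext_left (by simp [extEvenDeriv_one, LinearMap.sum_apply]) fun v x hx => by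
      simp only [LinearMap.sum_apply, LinearMap.comp_apply, LinearMap.mulLeft_apply] at hx ⊢
      have hv : f v = ∑ k, b.coord k v • f (b k) := map_eq_sum_coord b f v
      have h1 : ∀ k, ι ℝ (f (b k)) * contract (b.coord k) (ι ℝ v * x) =
          (b.coord k v • ι ℝ (f (b k))) * x + ι ℝ v * (ι ℝ (f (b k)) * contract (b.coord k) x) :=
        fun k => by
          rw [contract_ι_mul, mul_sub, ← mul_assoc, ← mul_assoc,
            eq_neg_of_add_eq_zero_left (ι_add_mul_swap (f (b k)) v), mul_smul_comm, smul_mul_assoc]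
          noncomm_ring
      rw [extEvenDeriv_mul, extEvenDeriv_ι, hx, Finset.sum_congr rfl fun k _ => h1 k,
        Finset.sum_add_distrib, ← Finset.sum_mul, ← Finset.mul_sum, hv, map_sum]
      simp only [map_smul]
  simpa [LinearMap.sum_apply] using DFunLike.congr_fun this x

/-- The derivation that extends the identity is the Euler operator of the exterior algebra. -/
theorem extEvenDeriv_id_of_mem {i : ℕ} {x : ExteriorAlgebra ℝ V}
    (hx : x ∈ LinearMap.range (ι ℝ (M := V)) ^ i) :
    extEvenDeriv LinearMap.id x = (i : ℝ) • x := by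
  induction i generalizing x with
  | zero =>
    rw [pow_zero, Submodule.mem_one] at hx
    obtain ⟨r, rfl⟩ := hx
    rw [Algebra.algebraMap_eq_smul_one, map_smul, extEvenDeriv_one]
    simp
  | succ i ih =>
    rw [pow_succ] at hx
    induction hx using Submodule.mul_induction_on' with
    | mem_mul_mem a ha b hb =>
      obtain ⟨v, rfl⟩ := hb
      rw [extEvenDeriv_mul, ih ha, extEvenDeriv_ι]
      push_cast
      rw [add_smul, one_smul, smul_mul_assoc, id_eq]
    | add a _ b _ ha hb => rw [map_add, ha, hb, smul_add]

/-- Every element is its augmentation modulo the left ideal spanned by a basis. -/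
theorem exists_eq_add_sum {κ : Type*} [Fintype κ] (b : Module.Basis κ ℝ V)
    (x : ExteriorAlgebra ℝ V) :
    ∃ y : κ → ExteriorAlgebra ℝ V, x = algebraMapInv x • 1 + ∑ k, ι ℝ (b k) * y k := by
  induction x using left_induction with
  | one => exact ⟨0, by simp⟩
  | smul r x hx =>
    obtain ⟨y, hy⟩ := hx
    refine ⟨r • y, ?_⟩
    conv_lhs => rw [hy]
    simp [Finset.smul_sum, smul_smul]
  | add x x' hx hx' =>
    obtain ⟨y, hy⟩ := hx
    obtain ⟨y', hy'⟩ := hx'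
    refine ⟨y + y', ?_⟩
    conv_lhs => rw [hy, hy']
    simp only [map_add, add_smul, Pi.add_apply, mul_add, Finset.sum_add_distrib]
    abel
  | ι_mul v x _ =>
    refine ⟨fun k => b.coord k v • x, ?_⟩
    have h : ι ℝ v = ∑ k, b.coord k v • ι ℝ (b k) := map_eq_sum_coord b (ι ℝ) v
    rw [map_mul]
    simp [algebraMapInv, h, Finset.sum_mul]

end ExteriorAlgebra

end ExteriorAlgebra

namespace SymmetricAlgebra

/-- `symDeriv` as a linear map in the linear map that is extended. -/
def symDerivₗ (V : Type*) [AddCommGroup V] [Module ℝ V] :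
    (V →ₗ[ℝ] V) →ₗ[ℝ] SymmetricAlgebra ℝ V →ₗ[ℝ] SymmetricAlgebra ℝ V where
  toFun := symDeriv
  map_add' := symDeriv_add
  map_smul' := symDeriv_smul

end SymmetricAlgebra

namespace ExteriorAlgebra

theorem contract_neg {V : Type*} [AddCommGroup V] [Module ℝ V] (φ : Module.Dual ℝ V)
    (x : ExteriorAlgebra ℝ V) : contract (-φ) x = -contract φ x :=
  LinearMap.map_neg₂ (CliffordAlgebra.contractLeft (Q := (0 : QuadraticForm ℝ V))) φ x

/-- `extEvenDeriv` as a linear map in the linear map that is extended. -/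
def extEvenDerivₗ (V : Type*) [AddCommGroup V] [Module ℝ V] :
    (V →ₗ[ℝ] V) →ₗ[ℝ] ExteriorAlgebra ℝ V →ₗ[ℝ] ExteriorAlgebra ℝ V where
  toFun := extEvenDeriv
  map_add' := extEvenDeriv_add
  map_smul' := extEvenDeriv_smul

theorem map_extEvenDeriv {V W : Type*} [AddCommGroup V] [Module ℝ V] [AddCommGroup W] [Module ℝ W]
    {f : V →ₗ[ℝ] W} {s : V →ₗ[ℝ] V} {t : W →ₗ[ℝ] W} (h : f ∘ₗ s = t ∘ₗ f)
    (x : ExteriorAlgebra ℝ V) : map f (extEvenDeriv s x) = extEvenDeriv t (map f x) := by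
  induction x using left_induction with
  | one => rw [extEvenDeriv_one, map_zero, map_one, extEvenDeriv_one]
  | smul r x hx => simp only [map_smul, hx]
  | add x y hx hy => simp only [map_add, hx, hy]
  | ι_mul v x hx =>
    have := DFunLike.congr_fun h v
    simp only [LinearMap.comp_apply] at this
    simp only [extEvenDeriv_mul, extEvenDeriv_ι, map_mul, map_add, map_apply_ι, hx, this]

theorem map_contract {V W : Type*} [AddCommGroup V] [Module ℝ V] [AddCommGroup W] [Module ℝ W]
    (f : V →ₗ[ℝ] W) (φ : Module.Dual ℝ W) (x : ExteriorAlgebra ℝ V) :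
    map f (contract (φ ∘ₗ f) x) = contract φ (map f x) := by
  induction x using left_induction with
  | one => rw [contract_one, map_zero, map_one, contract_one]
  | smul r x hx => simp only [map_smul, hx]
  | add x y hx hy => simp only [map_add, hx, hy]
  | ι_mul v x hx =>
    simp only [contract_ι_mul, map_mul, map_sub, map_smul, map_apply_ι, hx, LinearMap.comp_apply]

theorem map_parity {V W : Type*} [AddCommGroup V] [Module ℝ V] [AddCommGroup W] [Module ℝ W]
    (f : V →ₗ[ℝ] W) (x : ExteriorAlgebra ℝ V) : map f (parity x) = parity (map f x) := by
  induction x using left_induction with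
  | one => simp
  | smul r x hx => simp only [map_smul, hx]
  | add x y hx hy => simp only [map_add, hx, hy]
  | ι_mul v x hx => simp only [map_mul, parity_ι, map_neg, map_apply_ι, hx]

end ExteriorAlgebra

/-! ### Operators of the Weil algebra -/

namespace WeilAlgebra

section Tensors

variable {𝔤 𝔥 : Type*} [AddCommGroup 𝔤] [Module ℝ 𝔤] [AddCommGroup 𝔥] [Module ℝ 𝔥]

/-- The product of an element of `S𝔤*` and an element of `Λ𝔤*`, as a bilinear map. -/
def tmulₗ (𝔤 : Type*) [AddCommGroup 𝔤] [Module ℝ 𝔤] :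
    SymmetricAlgebra ℝ (Module.Dual ℝ 𝔤) →ₗ[ℝ] ExteriorAlgebra ℝ (Module.Dual ℝ 𝔤) →ₗ[ℝ]
      WeilAlgebra 𝔤 :=
  TensorProduct.mk ℝ (SymmetricAlgebra ℝ (Module.Dual ℝ 𝔤)) (ExteriorAlgebra ℝ (Module.Dual ℝ 𝔤))

/-- The product of an element of `S𝔤*` and an element of `Λ𝔤*` in the Weil algebra. -/
def tmul (s : SymmetricAlgebra ℝ (Module.Dual ℝ 𝔤)) (l : ExteriorAlgebra ℝ (Module.Dual ℝ 𝔤)) :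
    WeilAlgebra 𝔤 := tmulₗ 𝔤 s l

theorem tmul_add (s : SymmetricAlgebra ℝ (Module.Dual ℝ 𝔤))
    (l l' : ExteriorAlgebra ℝ (Module.Dual ℝ 𝔤)) : tmul s (l + l') = tmul s l + tmul s l' :=
  map_add (tmulₗ 𝔤 s) l l'

theorem tmul_sub (s : SymmetricAlgebra ℝ (Module.Dual ℝ 𝔤))
    (l l' : ExteriorAlgebra ℝ (Module.Dual ℝ 𝔤)) : tmul s (l - l') = tmul s l - tmul s l' :=
  map_sub (tmulₗ 𝔤 s) l l'

theorem tmul_neg (s : SymmetricAlgebra ℝ (Module.Dual ℝ 𝔤))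
    (l : ExteriorAlgebra ℝ (Module.Dual ℝ 𝔤)) : tmul s (-l) = -tmul s l :=
  map_neg (tmulₗ 𝔤 s) l

theorem tmul_smul (s : SymmetricAlgebra ℝ (Module.Dual ℝ 𝔤)) (c : ℝ)
    (l : ExteriorAlgebra ℝ (Module.Dual ℝ 𝔤)) : tmul s (c • l) = c • tmul s l :=
  map_smul (tmulₗ 𝔤 s) c l

theorem tmul_sum {κ : Type*} [Fintype κ] (s : SymmetricAlgebra ℝ (Module.Dual ℝ 𝔤))
    (l : κ → ExteriorAlgebra ℝ (Module.Dual ℝ 𝔤)) : tmul s (∑ k, l k) = ∑ k, tmul s (l k) :=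
  map_sum (tmulₗ 𝔤 s) l _

theorem smul_tmul (s : SymmetricAlgebra ℝ (Module.Dual ℝ 𝔤)) (c : ℝ)
    (l : ExteriorAlgebra ℝ (Module.Dual ℝ 𝔤)) : tmul (c • s) l = c • tmul s l :=
  LinearMap.map_smul₂ (tmulₗ 𝔤) c s l

theorem tmul_mul_tmul (s s' : SymmetricAlgebra ℝ (Module.Dual ℝ 𝔤))
    (l l' : ExteriorAlgebra ℝ (Module.Dual ℝ 𝔤)) :
    tmul s l * tmul s' l' = tmul (s * s') (l * l') :=
  Algebra.TensorProduct.tmul_mul_tmul s s' l l'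

theorem one_eq_tmul : (1 : WeilAlgebra 𝔤) = tmul 1 1 := rfl

theorem hom_ext {M : Type*} [AddCommGroup M] [Module ℝ M] {f g : WeilAlgebra 𝔤 →ₗ[ℝ] M}
    (h : ∀ s l, f (tmul s l) = g (tmul s l)) : f = g :=
  TensorProduct.ext' (R := ℝ) (M := SymmetricAlgebra ℝ (Module.Dual ℝ 𝔤))
    (N := ExteriorAlgebra ℝ (Module.Dual ℝ 𝔤)) h

theorem parity_tmul (s : SymmetricAlgebra ℝ (Module.Dual ℝ 𝔤))
    (l : ExteriorAlgebra ℝ (Module.Dual ℝ 𝔤)) :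
    parity 𝔤 (tmul s l) = tmul s (ExteriorAlgebra.parity l) := rfl

theorem pullback_tmul (f : 𝔥 →ₗ[ℝ] 𝔤) (s : SymmetricAlgebra ℝ (Module.Dual ℝ 𝔤))
    (l : ExteriorAlgebra ℝ (Module.Dual ℝ 𝔤)) :
    pullback f (tmul s l) =
      tmul (SymmetricAlgebra.map f.dualMap s) (ExteriorAlgebra.map f.dualMap l) := rfl

theorem parity_parity (w : WeilAlgebra 𝔤) : parity 𝔤 (parity 𝔤 w) = w := by
  have : parity 𝔤 ∘ₗ parity 𝔤 = LinearMap.id := hom_ext fun s l => by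
    simp only [LinearMap.comp_apply, parity_tmul, ExteriorAlgebra.parity_parity,
      LinearMap.id_apply]
  exact DFunLike.congr_fun this w

theorem pullback_parity (f : 𝔥 →ₗ[ℝ] 𝔤) (w : WeilAlgebra 𝔤) :
    pullback f (parity 𝔤 w) = parity 𝔥 (pullback f w) := by
  have : (pullback f).toLinearMap ∘ₗ parity 𝔤 = parity 𝔥 ∘ₗ (pullback f).toLinearMap :=
    hom_ext fun s l => by
      simp only [LinearMap.comp_apply, AlgHom.toLinearMap_apply, parity_tmul, pullback_tmul,
        ExteriorAlgebra.map_parity]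
  exact DFunLike.congr_fun this w

/-- Left multiplication by the generator of degree `1` given by a linear form. -/
def mulTheta (ξ : Module.Dual ℝ 𝔤) : WeilAlgebra 𝔤 →ₗ[ℝ] WeilAlgebra 𝔤 :=
  TensorProduct.map LinearMap.id (LinearMap.mulLeft ℝ (ExteriorAlgebra.ι ℝ ξ))

theorem mulTheta_tmul (ξ : Module.Dual ℝ 𝔤) (s : SymmetricAlgebra ℝ (Module.Dual ℝ 𝔤))
    (l : ExteriorAlgebra ℝ (Module.Dual ℝ 𝔤)) :
    mulTheta ξ (tmul s l) = tmul s (ExteriorAlgebra.ι ℝ ξ * l) := rfl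

theorem mulTheta_mulTheta (ξ η : Module.Dual ℝ 𝔤) (w : WeilAlgebra 𝔤) :
    mulTheta ξ (mulTheta η w) = -mulTheta η (mulTheta ξ w) := by
  have : mulTheta ξ ∘ₗ mulTheta η = -(mulTheta η ∘ₗ mulTheta ξ) := hom_ext fun s l => by
    simp only [LinearMap.comp_apply, LinearMap.neg_apply, mulTheta_tmul]
    rw [← mul_assoc, ← mul_assoc, ← tmul_neg, ← neg_mul,
      eq_neg_of_add_eq_zero_left (ExteriorAlgebra.ι_add_mul_swap ξ η)]
  exact DFunLike.congr_fun this w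

theorem parity_mulTheta (ξ : Module.Dual ℝ 𝔤) (w : WeilAlgebra 𝔤) :
    parity 𝔤 (mulTheta ξ w) = -mulTheta ξ (parity 𝔤 w) := by
  have : parity 𝔤 ∘ₗ mulTheta ξ = -(mulTheta ξ ∘ₗ parity 𝔤) := hom_ext fun s l => by
    simp only [LinearMap.comp_apply, LinearMap.neg_apply, mulTheta_tmul, parity_tmul, map_mul,
      ExteriorAlgebra.parity_ι, neg_mul, tmul_neg]
  exact DFunLike.congr_fun this w

/-- The augmentation `W(𝔤) → S𝔤*` that annihilates the generators of degree `1`. -/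
def augment (𝔤 : Type*) [AddCommGroup 𝔤] [Module ℝ 𝔤] :
    WeilAlgebra 𝔤 →ₗ[ℝ] SymmetricAlgebra ℝ (Module.Dual ℝ 𝔤) :=
  (TensorProduct.rid ℝ (SymmetricAlgebra ℝ (Module.Dual ℝ 𝔤))).toLinearMap ∘ₗ
    TensorProduct.map LinearMap.id ExteriorAlgebra.algebraMapInv.toLinearMap

theorem augment_tmul (s : SymmetricAlgebra ℝ (Module.Dual ℝ 𝔤))
    (l : ExteriorAlgebra ℝ (Module.Dual ℝ 𝔤)) :
    augment 𝔤 (tmul s l) = ExteriorAlgebra.algebraMapInv l • s := rfl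

theorem algebraMapInv_ι_mul (ξ : Module.Dual ℝ 𝔤) (l : ExteriorAlgebra ℝ (Module.Dual ℝ 𝔤)) :
    ExteriorAlgebra.algebraMapInv (ExteriorAlgebra.ι ℝ ξ * l) = 0 := by
  simp [ExteriorAlgebra.algebraMapInv]

theorem augment_mulTheta (ξ : Module.Dual ℝ 𝔤) (w : WeilAlgebra 𝔤) :
    augment 𝔤 (mulTheta ξ w) = 0 := by
  have : augment 𝔤 ∘ₗ mulTheta ξ = 0 := hom_ext fun s l => by
    simp only [LinearMap.comp_apply, mulTheta_tmul, augment_tmul, algebraMapInv_ι_mul, zero_smul,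
      LinearMap.zero_apply]
  exact DFunLike.congr_fun this w

theorem algebraMapInv_parity (l : ExteriorAlgebra ℝ (Module.Dual ℝ 𝔤)) :
    ExteriorAlgebra.algebraMapInv (ExteriorAlgebra.parity l) = ExteriorAlgebra.algebraMapInv l := by
  induction l using ExteriorAlgebra.left_induction with
  | one => simp
  | smul r x hx => simp only [map_smul, hx]
  | add x y hx hy => simp only [map_add, hx, hy]
  | ι_mul v x hx =>
    rw [map_mul ExteriorAlgebra.parity, ExteriorAlgebra.parity_ι, neg_mul, map_neg,
      algebraMapInv_ι_mul, algebraMapInv_ι_mul, neg_zero]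

theorem augment_parity (w : WeilAlgebra 𝔤) : augment 𝔤 (parity 𝔤 w) = augment 𝔤 w := by
  have : augment 𝔤 ∘ₗ parity 𝔤 = augment 𝔤 := hom_ext fun s l => by
    simp only [LinearMap.comp_apply, parity_tmul, augment_tmul, algebraMapInv_parity]
  exact DFunLike.congr_fun this w

theorem algebraMapInv_extEvenDeriv (f : Module.Dual ℝ 𝔤 →ₗ[ℝ] Module.Dual ℝ 𝔤)
    (l : ExteriorAlgebra ℝ (Module.Dual ℝ 𝔤)) :
    ExteriorAlgebra.algebraMapInv (extEvenDeriv f l) = 0 := by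
  induction l using ExteriorAlgebra.left_induction with
  | one => rw [ExteriorAlgebra.extEvenDeriv_one, map_zero]
  | smul r x hx => simp only [map_smul, hx, smul_zero]
  | add x y hx hy => simp only [map_add, hx, hy, add_zero]
  | ι_mul v x hx =>
    rw [ExteriorAlgebra.extEvenDeriv_mul, ExteriorAlgebra.extEvenDeriv_ι, map_add,
      algebraMapInv_ι_mul, algebraMapInv_ι_mul, add_zero]

/-- The Euler operator of the Weil algebra: multiplication by `n` in degree `n`. -/
def euler (𝔤 : Type*) [AddCommGroup 𝔤] [Module ℝ 𝔤] : WeilAlgebra 𝔤 →ₗ[ℝ] WeilAlgebra 𝔤 :=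
  TensorProduct.map ((2 : ℝ) • symDeriv LinearMap.id) LinearMap.id +
    TensorProduct.map LinearMap.id (extEvenDeriv LinearMap.id)

theorem euler_tmul (s : SymmetricAlgebra ℝ (Module.Dual ℝ 𝔤))
    (l : ExteriorAlgebra ℝ (Module.Dual ℝ 𝔤)) : euler 𝔤 (tmul s l) =
      tmul ((2 : ℝ) • symDeriv LinearMap.id s) l + tmul s (extEvenDeriv LinearMap.id l) := rfl

theorem parity_euler (w : WeilAlgebra 𝔤) : parity 𝔤 (euler 𝔤 w) = euler 𝔤 (parity 𝔤 w) := by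
  have : parity 𝔤 ∘ₗ euler 𝔤 = euler 𝔤 ∘ₗ parity 𝔤 := hom_ext fun s l => by
    simp only [LinearMap.comp_apply, parity_tmul, euler_tmul, map_add,
      ExteriorAlgebra.parity_extEvenDeriv]
  exact DFunLike.congr_fun this w

theorem augment_euler (w : WeilAlgebra 𝔤) :
    augment 𝔤 (euler 𝔤 w) = (2 : ℝ) • symDeriv LinearMap.id (augment 𝔤 w) := by
  have : augment 𝔤 ∘ₗ euler 𝔤 = (2 : ℝ) • symDeriv LinearMap.id ∘ₗ augment 𝔤 :=
    hom_ext fun s l => by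
      simp only [LinearMap.comp_apply, LinearMap.smul_apply, augment_tmul, euler_tmul, map_add,
        algebraMapInv_extEvenDeriv, zero_smul, add_zero, map_smul]
      rw [smul_comm]
  exact DFunLike.congr_fun this w

theorem pullback_euler (f : 𝔥 →ₗ[ℝ] 𝔤) (w : WeilAlgebra 𝔤) :
    pullback f (euler 𝔤 w) = euler 𝔥 (pullback f w) := by
  have : (pullback f).toLinearMap ∘ₗ euler 𝔤 = euler 𝔥 ∘ₗ (pullback f).toLinearMap :=
    hom_ext fun s l => by
      simp only [LinearMap.comp_apply, AlgHom.toLinearMap_apply, euler_tmul, pullback_tmul, map_add,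
        map_smul,
        ExteriorAlgebra.map_extEvenDeriv (s := LinearMap.id) (t := LinearMap.id) (f := f.dualMap)
          rfl,
        SymmetricAlgebra.map_symDeriv (s := LinearMap.id) (t := LinearMap.id) (f := f.dualMap) rfl]
  exact DFunLike.congr_fun this w

theorem augment_pullback (f : 𝔥 →ₗ[ℝ] 𝔤) (w : WeilAlgebra 𝔤) :
    augment 𝔥 (pullback f w) = SymmetricAlgebra.map f.dualMap (augment 𝔤 w) := by
  have h : ∀ l : ExteriorAlgebra ℝ (Module.Dual ℝ 𝔤),
      ExteriorAlgebra.algebraMapInv (ExteriorAlgebra.map f.dualMap l) =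
        ExteriorAlgebra.algebraMapInv l := fun l => by
    have : (ExteriorAlgebra.algebraMapInv (R := ℝ)).comp (ExteriorAlgebra.map f.dualMap) =
        ExteriorAlgebra.algebraMapInv := by
      ext; simp [ExteriorAlgebra.algebraMapInv]
    exact DFunLike.congr_fun this l
  have : augment 𝔥 ∘ₗ (pullback f).toLinearMap =
      (SymmetricAlgebra.map f.dualMap).toLinearMap ∘ₗ augment 𝔤 := hom_ext fun s l => by
    simp only [LinearMap.comp_apply, AlgHom.toLinearMap_apply, pullback_tmul, augment_tmul, h,
      map_smul]
  exact DFunLike.congr_fun this w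

theorem euler_of_mem_deg {n : ℤ} {w : WeilAlgebra 𝔤} (hw : w ∈ deg 𝔤 n) :
    euler 𝔤 w = (n : ℝ) • w := by
  have : deg 𝔤 n ≤ LinearMap.ker (euler 𝔤 - (n : ℝ) • LinearMap.id) := by
    refine iSup_le fun i => iSup_le fun j => iSup_le fun h => Submodule.map₂_le.2 ?_
    intro s hs l hl
    rw [LinearMap.mem_ker, LinearMap.sub_apply, sub_eq_zero]
    change euler 𝔤 (tmul s l) = (n : ℝ) • tmul s l
    rw [euler_tmul, SymmetricAlgebra.symDeriv_id_of_mem hs,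
      ExteriorAlgebra.extEvenDeriv_id_of_mem hl, smul_tmul, smul_tmul, tmul_smul, smul_smul,
      ← add_smul, ← h]
    push_cast
    rfl
  have h := this hw
  rwa [LinearMap.mem_ker, LinearMap.sub_apply, sub_eq_zero] at h

theorem iSup_deg : ⨆ n, deg 𝔤 n = ⊤ := by
  rw [eq_top_iff]
  have : (⊤ : Submodule ℝ (WeilAlgebra 𝔤)) = Submodule.map₂ (tmulₗ 𝔤) ⊤ ⊤ :=
    (TensorProduct.map₂_mk_top_top_eq_top ℝ (SymmetricAlgebra ℝ (Module.Dual ℝ 𝔤))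
      (ExteriorAlgebra ℝ (Module.Dual ℝ 𝔤))).symm
  rw [this, ← SymmetricAlgebra.iSup_range_ι_pow, ← ExteriorAlgebra.iSup_range_ι_pow,
    Submodule.map₂_iSup_left]
  refine iSup_le fun i => ?_
  rw [Submodule.map₂_iSup_right]
  refine iSup_le fun j => le_iSup_of_le (2 * (i : ℤ) + j) ?_
  exact le_iSup_of_le i (le_iSup_of_le j (le_iSup_of_le rfl le_rfl))

end Tensors

section Lie

variable {𝔤 : Type*} [LieRing 𝔤] [LieAlgebra ℝ 𝔤]

theorem coad_eq (X : 𝔤) : coad X = (-(LieAlgebra.ad ℝ 𝔤 X)).dualMap := by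
  ext ξ Y
  exact (map_neg ξ ⁅X, Y⁆).symm

theorem coad_apply (X : 𝔤) (ξ : Module.Dual ℝ 𝔤) (Y : 𝔤) : coad X ξ Y = -ξ ⁅X, Y⁆ := rfl

/-- The coadjoint action as a linear map on the Lie algebra. -/
def coadₗ (𝔤 : Type*) [LieRing 𝔤] [LieAlgebra ℝ 𝔤] :
    𝔤 →ₗ[ℝ] Module.Dual ℝ 𝔤 →ₗ[ℝ] Module.Dual ℝ 𝔤 where
  toFun := coad
  map_add' X Y := by ext; simp [coad_apply, add_comm]
  map_smul' c X := by ext; simp [coad_apply]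

theorem eval_comp_coad (X Y : 𝔤) :
    Module.Dual.eval ℝ 𝔤 Y ∘ₗ coad X = -Module.Dual.eval ℝ 𝔤 ⁅X, Y⁆ := by
  ext ξ
  simp [coad_apply]

theorem lie_tmul (X : 𝔤) (s : SymmetricAlgebra ℝ (Module.Dual ℝ 𝔤))
    (l : ExteriorAlgebra ℝ (Module.Dual ℝ 𝔤)) :
    lie X (tmul s l) = tmul (symDeriv (coad X) s) l + tmul s (extEvenDeriv (coad X) l) := rfl

theorem contr_tmul (X : 𝔤) (s : SymmetricAlgebra ℝ (Module.Dual ℝ 𝔤))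
    (l : ExteriorAlgebra ℝ (Module.Dual ℝ 𝔤)) :
    contr X (tmul s l) = tmul s (ExteriorAlgebra.contract (Module.Dual.eval ℝ 𝔤 X) l) := rfl

theorem contr_contr (X Y : 𝔤) (w : WeilAlgebra 𝔤) :
    contr X (contr Y w) = -contr Y (contr X w) := by
  have : contr X ∘ₗ contr Y = -(contr Y ∘ₗ contr X) := hom_ext fun s l => by
    simp only [LinearMap.comp_apply, LinearMap.neg_apply, contr_tmul, ← tmul_neg]
    exact congrArg _ (CliffordAlgebra.contractLeft_comm _ _ _)
  exact DFunLike.congr_fun this w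

theorem parity_contr (X : 𝔤) (w : WeilAlgebra 𝔤) :
    parity 𝔤 (contr X w) = -contr X (parity 𝔤 w) := by
  have : parity 𝔤 ∘ₗ contr X = -(contr X ∘ₗ parity 𝔤) := hom_ext fun s l => by
    simp only [LinearMap.comp_apply, LinearMap.neg_apply, contr_tmul, parity_tmul,
      ExteriorAlgebra.parity_contract, tmul_neg]
  exact DFunLike.congr_fun this w

theorem parity_lie (X : 𝔤) (w : WeilAlgebra 𝔤) :
    parity 𝔤 (lie X w) = lie X (parity 𝔤 w) := by
  have : parity 𝔤 ∘ₗ lie X = lie X ∘ₗ parity 𝔤 := hom_ext fun s l => by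
    simp only [LinearMap.comp_apply, lie_tmul, parity_tmul, map_add,
      ExteriorAlgebra.parity_extEvenDeriv]
  exact DFunLike.congr_fun this w

theorem lie_contr (X Y : 𝔤) (w : WeilAlgebra 𝔤) :
    lie X (contr Y w) - contr Y (lie X w) = contr ⁅X, Y⁆ w := by
  have : lie X ∘ₗ contr Y - contr Y ∘ₗ lie X = contr ⁅X, Y⁆ := hom_ext fun s l => by
    have h := ExteriorAlgebra.extEvenDeriv_contract (coad X) (Module.Dual.eval ℝ 𝔤 Y) l
    rw [eval_comp_coad, ExteriorAlgebra.contract_neg, neg_neg] at h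
    simp only [LinearMap.comp_apply, LinearMap.sub_apply, lie_tmul, contr_tmul, map_add]
    rw [← h, tmul_sub]
    abel
  exact DFunLike.congr_fun this w

theorem euler_contr (Y : 𝔤) (w : WeilAlgebra 𝔤) :
    euler 𝔤 (contr Y w) - contr Y (euler 𝔤 w) = -contr Y w := by
  have : euler 𝔤 ∘ₗ contr Y - contr Y ∘ₗ euler 𝔤 = -contr Y := hom_ext fun s l => by
    have h := ExteriorAlgebra.extEvenDeriv_contract LinearMap.id (Module.Dual.eval ℝ 𝔤 Y) l
    rw [LinearMap.comp_id] at h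
    simp only [LinearMap.comp_apply, LinearMap.sub_apply, LinearMap.neg_apply, euler_tmul,
      contr_tmul, map_add]
    rw [← tmul_neg, ← h, tmul_sub]
    abel
  exact DFunLike.congr_fun this w

theorem contr_mulTheta (X : 𝔤) (ξ : Module.Dual ℝ 𝔤) (w : WeilAlgebra 𝔤) :
    contr X (mulTheta ξ w) = ξ X • w - mulTheta ξ (contr X w) := by
  have : contr X ∘ₗ mulTheta ξ = ξ X • LinearMap.id - mulTheta ξ ∘ₗ contr X :=
    hom_ext fun s l => by
      simp only [LinearMap.comp_apply, LinearMap.sub_apply, LinearMap.smul_apply,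
        LinearMap.id_apply, mulTheta_tmul, contr_tmul, ExteriorAlgebra.contract_ι_mul, tmul_sub,
        tmul_smul, Module.Dual.eval_apply]
  exact DFunLike.congr_fun this w

theorem augment_lie (X : 𝔤) (w : WeilAlgebra 𝔤) :
    augment 𝔤 (lie X w) = symDeriv (coad X) (augment 𝔤 w) := by
  have : augment 𝔤 ∘ₗ lie X = symDeriv (coad X) ∘ₗ augment 𝔤 := hom_ext fun s l => by
    simp only [LinearMap.comp_apply, augment_tmul, lie_tmul, map_add,
        algebraMapInv_extEvenDeriv, zero_smul, add_zero, map_smul]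
  exact DFunLike.congr_fun this w

variable [Module.Finite ℝ 𝔤]

theorem d_tmul (s : SymmetricAlgebra ℝ (Module.Dual ℝ 𝔤))
    (l : ExteriorAlgebra ℝ (Module.Dual ℝ 𝔤)) : d 𝔤 (tmul s l) =
      ∑ k, ((1 / 2 : ℝ) • tmul s (ExteriorAlgebra.ι ℝ ((Module.finBasis ℝ 𝔤).coord k) *
          extEvenDeriv (coad (Module.finBasis ℝ 𝔤 k)) l) +
        tmul (symDeriv (coad (Module.finBasis ℝ 𝔤 k)) s)
          (ExteriorAlgebra.ι ℝ ((Module.finBasis ℝ 𝔤).coord k) * l) +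
        tmul (SymmetricAlgebra.ι ℝ _ ((Module.finBasis ℝ 𝔤).coord k) * s)
          (ExteriorAlgebra.contract (Module.Dual.eval ℝ 𝔤 (Module.finBasis ℝ 𝔤 k)) l)) := by
  simp only [d, LinearMap.sum_apply]
  rfl

theorem parity_d (w : WeilAlgebra 𝔤) : parity 𝔤 (d 𝔤 w) = -d 𝔤 (parity 𝔤 w) := by
  have : parity 𝔤 ∘ₗ d 𝔤 = -(d 𝔤 ∘ₗ parity 𝔤) := hom_ext fun s l => by
    simp only [LinearMap.comp_apply, LinearMap.neg_apply, parity_tmul, d_tmul, map_sum, map_add,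
      map_smul, ← Finset.sum_neg_distrib]
    refine Finset.sum_congr rfl fun k _ => ?_
    simp only [map_mul, ExteriorAlgebra.parity_ι, neg_mul, tmul_neg,
      ExteriorAlgebra.parity_contract, ExteriorAlgebra.parity_extEvenDeriv, smul_neg, neg_add_rev]
    abel
  exact DFunLike.congr_fun this w

/-- Modulo the generators `θᵏ`, the differential of the Weil algebra is `∑ Ωᵏ ιₖ`. -/
theorem augment_d (w : WeilAlgebra 𝔤) : augment 𝔤 (d 𝔤 w) =
    ∑ k, SymmetricAlgebra.ι ℝ _ ((Module.finBasis ℝ 𝔤).coord k) *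
      augment 𝔤 (contr (Module.finBasis ℝ 𝔤 k) w) := by
  have : augment 𝔤 ∘ₗ d 𝔤 = ∑ k, LinearMap.mulLeft ℝ
      (SymmetricAlgebra.ι ℝ _ ((Module.finBasis ℝ 𝔤).coord k)) ∘ₗ augment 𝔤 ∘ₗ
        contr (Module.finBasis ℝ 𝔤 k) := hom_ext fun s l => by
    simp only [LinearMap.comp_apply, LinearMap.sum_apply, d_tmul, map_sum, map_add, map_smul,
      augment_tmul, algebraMapInv_ι_mul, zero_smul, smul_zero, zero_add, contr_tmul,
      LinearMap.mulLeft_apply]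
  simpa [LinearMap.sum_apply] using DFunLike.congr_fun this w

/-- The sum `∑ θᵏ ι_{[eₖ, X]}` is the Lie derivative along `X` on `Λ𝔤*`. -/
theorem extEvenDeriv_coad_eq_sum (X : 𝔤) (l : ExteriorAlgebra ℝ (Module.Dual ℝ 𝔤)) :
    extEvenDeriv (coad X) l = ∑ k, ExteriorAlgebra.ι ℝ ((Module.finBasis ℝ 𝔤).coord k) *
      ExteriorAlgebra.contract
        (Module.Dual.eval ℝ 𝔤 ⁅Module.finBasis ℝ 𝔤 k, X⁆) l := by
  set e := Module.finBasis ℝ 𝔤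
  let B : 𝔤 →ₗ[ℝ] Module.Dual ℝ 𝔤 →ₗ[ℝ] ExteriorAlgebra ℝ (Module.Dual ℝ 𝔤) :=
    LinearMap.mk₂ ℝ (fun Z ξ => ExteriorAlgebra.ι ℝ ξ *
      ExteriorAlgebra.contract (Module.Dual.eval ℝ 𝔤 Z) l)
      (by intros; simp [mul_add]) (by intros; simp) (by intros; simp [add_mul]) (by intros; simp)
  have h := sum_basis_transpose e e (-(LieAlgebra.ad ℝ 𝔤 X)) B
  rw [ExteriorAlgebra.extEvenDeriv_eq_sum e.dualBasis]
  refine Eq.trans ?_ (h.symm.trans ?_)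
  · refine Finset.sum_congr rfl fun k _ => ?_
    have h1 : e.dualBasis.coord k = Module.Dual.eval ℝ 𝔤 (e k) := by
      refine e.dualBasis.ext fun i => ?_
      simp [Finsupp.single_apply]
    have h2 : coad X (e.dualBasis k) = e.coord k ∘ₗ (-(LieAlgebra.ad ℝ 𝔤 X)) := by
      ext Y
      simp [coad_apply]
    rw [h1, h2]
    rfl
  · refine Finset.sum_congr rfl fun k _ => ?_
    have : (-(LieAlgebra.ad ℝ 𝔤 X)) (e k) = ⁅e k, X⁆ := by
      simp
    rw [this]
    rfl

/-- Cartan's formula in the Weil algebra. -/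
theorem contr_d (X : 𝔤) (w : WeilAlgebra 𝔤) : contr X (d 𝔤 w) + d 𝔤 (contr X w) = lie X w := by
  set e := Module.finBasis ℝ 𝔤 with he
  have : contr X ∘ₗ d 𝔤 + d 𝔤 ∘ₗ contr X = lie X := hom_ext fun s l => by
    simp only [LinearMap.comp_apply, LinearMap.add_apply, contr_tmul, d_tmul, map_sum,
      map_add, map_smul, ← Finset.sum_add_distrib, lie_tmul, ← he]
    have h1 : extEvenDeriv (coad X) l = ∑ k, e.coord k X • extEvenDeriv (coad (e k)) l :=
      map_eq_sum_coord e ((LinearMap.applyₗ l ∘ₗ ExteriorAlgebra.extEvenDerivₗ _) ∘ₗ coadₗ 𝔤) X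
    have h2 : symDeriv (coad X) s = ∑ k, e.coord k X • symDeriv (coad (e k)) s :=
      map_eq_sum_coord e ((LinearMap.applyₗ s ∘ₗ SymmetricAlgebra.symDerivₗ _) ∘ₗ coadₗ 𝔤) X
    -- Each of the two ways to write `L_X` on `Λ𝔤*` as a sum accounts for one half of it.
    have h3 : tmul s (extEvenDeriv (coad X) l) =
        ∑ k, ((1 / 2 : ℝ) • tmul s (e.coord k X • extEvenDeriv (coad (e k)) l) +
          (1 / 2 : ℝ) • tmul s (ExteriorAlgebra.ι ℝ (e.coord k) * ExteriorAlgebra.contract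
            (Module.Dual.eval ℝ 𝔤 ⁅e k, X⁆) l)) := by
      rw [Finset.sum_add_distrib, ← Finset.smul_sum, ← Finset.smul_sum, ← tmul_sum, ← tmul_sum,
        ← h1, ← extEvenDeriv_coad_eq_sum, ← add_smul]
      norm_num
    have h4 : tmul (symDeriv (coad X) s) l = ∑ k, e.coord k X • tmul (symDeriv (coad (e k)) s) l :=
      by
        conv_lhs => rw [h2]
        simp only [← smul_tmul]
        exact LinearMap.map_sum₂ (tmulₗ 𝔤) _ _ _
    rw [h3, h4, ← Finset.sum_add_distrib]
    refine Finset.sum_congr rfl fun k _ => ?_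
    have h5 := ExteriorAlgebra.extEvenDeriv_contract (coad (e k)) (Module.Dual.eval ℝ 𝔤 X) l
    rw [eval_comp_coad, ExteriorAlgebra.contract_neg, neg_neg, sub_eq_iff_eq_add] at h5
    have h6 : ExteriorAlgebra.contract (Module.Dual.eval ℝ 𝔤 X)
        (ExteriorAlgebra.contract (Module.Dual.eval ℝ 𝔤 (e k)) l) =
        -ExteriorAlgebra.contract (Module.Dual.eval ℝ 𝔤 (e k))
          (ExteriorAlgebra.contract (Module.Dual.eval ℝ 𝔤 X) l) :=
      CliffordAlgebra.contractLeft_comm _ _ _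
    simp only [ExteriorAlgebra.contract_ι_mul, h5, h6, tmul_sub, tmul_add, tmul_neg,
      tmul_smul, mul_add, Module.Dual.eval_apply]
    module
  exact DFunLike.congr_fun this w

end Lie

section Pullback

variable {𝔤 𝔮 : Type*} [LieRing 𝔤] [LieAlgebra ℝ 𝔤] [LieRing 𝔮] [LieAlgebra ℝ 𝔮]
  {f : 𝔤 →ₗ[ℝ] 𝔮}

theorem dualMap_coad (hf : ∀ X Y, f ⁅X, Y⁆ = ⁅f X, f Y⁆) (X : 𝔤) :
    f.dualMap ∘ₗ coad (f X) = coad X ∘ₗ f.dualMap := by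
  ext ξ Y
  simp [coad_apply, hf]

theorem pullback_lie (hf : ∀ X Y, f ⁅X, Y⁆ = ⁅f X, f Y⁆) (X : 𝔤) (w : WeilAlgebra 𝔮) :
    pullback f (lie (f X) w) = lie X (pullback f w) := by
  have : (pullback f).toLinearMap ∘ₗ lie (f X) = lie X ∘ₗ (pullback f).toLinearMap :=
    hom_ext fun s l => by
      simp only [LinearMap.comp_apply, AlgHom.toLinearMap_apply, lie_tmul, pullback_tmul, map_add,
        SymmetricAlgebra.map_symDeriv (dualMap_coad hf X),
        ExteriorAlgebra.map_extEvenDeriv (dualMap_coad hf X)]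
  exact DFunLike.congr_fun this w

theorem pullback_contr (X : 𝔤) (w : WeilAlgebra 𝔮) :
    pullback f (contr (f X) w) = contr X (pullback f w) := by
  have h : Module.Dual.eval ℝ 𝔮 (f X) = Module.Dual.eval ℝ 𝔤 X ∘ₗ f.dualMap := rfl
  have : (pullback f).toLinearMap ∘ₗ contr (f X) = contr X ∘ₗ (pullback f).toLinearMap :=
    hom_ext fun s l => by
      simp only [LinearMap.comp_apply, AlgHom.toLinearMap_apply, contr_tmul, pullback_tmul, h,
        ExteriorAlgebra.map_contract]
  exact DFunLike.congr_fun this w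

theorem pullback_d [Module.Finite ℝ 𝔤] [Module.Finite ℝ 𝔮] (hf : ∀ X Y, f ⁅X, Y⁆ = ⁅f X, f Y⁆)
    (w : WeilAlgebra 𝔮) : pullback f (d 𝔮 w) = d 𝔤 (pullback f w) := by
  have : (pullback f).toLinearMap ∘ₗ d 𝔮 = d 𝔤 ∘ₗ (pullback f).toLinearMap :=
    hom_ext fun s l => by
      simp only [LinearMap.comp_apply, AlgHom.toLinearMap_apply, d_tmul, pullback_tmul, map_sum,
        map_add, map_smul, map_mul, ExteriorAlgebra.map_apply_ι, SymmetricAlgebra.map_ι]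
      let s' := SymmetricAlgebra.map f.dualMap
      let l' := ExteriorAlgebra.map f.dualMap
      let B : 𝔮 →ₗ[ℝ] Module.Dual ℝ 𝔤 →ₗ[ℝ] WeilAlgebra 𝔤 :=
        (1 / 2 : ℝ) • LinearMap.mk₂ ℝ (fun Z ξ => tmul (s' s) (ExteriorAlgebra.ι ℝ ξ *
            l' (ExteriorAlgebra.extEvenDerivₗ _ (coadₗ 𝔮 Z) l)))
            (by intros; simp [mul_add, tmul_add]) (by intros; simp [tmul_smul])
            (by intros; simp [add_mul, tmul_add]) (by intros; simp [tmul_smul]) +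
          LinearMap.mk₂ ℝ (fun Z ξ => tmulₗ 𝔤 (s' (SymmetricAlgebra.symDerivₗ _ (coadₗ 𝔮 Z) s))
            (ExteriorAlgebra.ι ℝ ξ * l' l))
            (by intros; simp) (by intros; simp)
            (by intros; simp [add_mul]) (by intros; simp) +
          LinearMap.mk₂ ℝ (fun Z ξ => tmulₗ 𝔤 (SymmetricAlgebra.ι ℝ _ ξ * s' s)
            (l' (ExteriorAlgebra.contract (Module.Dual.eval ℝ 𝔮 Z) l)))
            (by intros; simp) (by intros; simp)
            (by intros; simp [add_mul]) (by intros; simp)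
      have h := sum_basis_transpose (Module.finBasis ℝ 𝔤) (Module.finBasis ℝ 𝔮) f B
      refine Eq.trans ?_ (h.symm.trans ?_)
      · exact Finset.sum_congr rfl fun k _ => rfl
      · refine Finset.sum_congr rfl fun k _ => ?_
        rw [← SymmetricAlgebra.map_symDeriv (dualMap_coad hf (Module.finBasis ℝ 𝔤 k)),
          ← ExteriorAlgebra.map_extEvenDeriv (dualMap_coad hf (Module.finBasis ℝ 𝔤 k)),
          ← ExteriorAlgebra.map_contract]
        rfl
  exact DFunLike.congr_fun this w

end Pullback

end WeilAlgebra

/-! ### The horizontal projector -/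

theorem eq_zero_of_eq_neg {M : Type*} [AddCommGroup M] [Module ℝ M] {x : M} (h : x = -x) :
    x = 0 := by
  have h2 : (2 : ℝ) • x = 0 := by
    rw [two_smul]
    exact eq_neg_iff_add_eq_zero.1 h
  exact (smul_eq_zero.1 h2).resolve_left two_ne_zero

section CliffordRelations

variable {R κ : Type*} [Ring R] {θ I : κ → R}

/-- The product of the idempotents `1 - θₖ Iₖ = Iₖ θₖ`, where `k` runs through a list. -/
def horizontalProjector (θ I : κ → R) (l : List κ) : R := (l.map fun k => 1 - θ k * I k).prod

theorem horizontalProjector_cons (k : κ) (l : List κ) :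
    horizontalProjector θ I (k :: l) = (1 - θ k * I k) * horizontalProjector θ I l := by
  simp [horizontalProjector]

/-- The operators `Iₖ` annihilate the image of the horizontal projector: `Iₖ` commutes with the
factors of index `j ≠ k` and annihilates the factor of index `k`. -/
theorem mul_horizontalProjector (hII : ∀ j k, I j * I k = -(I k * I j)) (hI : ∀ k, I k * I k = 0)
    (hIθ : ∀ j k, j ≠ k → I j * θ k = -(θ k * I j)) (hIθ1 : ∀ k, I k * θ k = 1 - θ k * I k)
    {k : κ} {l : List κ} (hk : k ∈ l) : I k * horizontalProjector θ I l = 0 := by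
  induction l with
  | nil => simp at hk
  | cons j l ih =>
    rw [horizontalProjector_cons, ← mul_assoc]
    by_cases h : k = j
    · subst h
      have : I k * (1 - θ k * I k) = 0 := by
        rw [mul_sub, mul_one, ← mul_assoc, hIθ1, sub_mul, one_mul, mul_assoc, hI, mul_zero,
          sub_zero, sub_self]
      rw [this, zero_mul]
    · have : I k * (1 - θ j * I j) = (1 - θ j * I j) * I k := by
        rw [mul_sub, mul_one, ← mul_assoc, hIθ k j h, sub_mul, one_mul, neg_mul, mul_assoc,
          hII k j, mul_assoc, mul_neg, neg_neg]
      rw [this, mul_assoc, ih ((List.mem_cons.1 hk).resolve_left h), mul_zero]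

/-- The horizontal projector annihilates the images of the operators `θₖ`. -/
theorem horizontalProjector_mul (hθθ : ∀ j k, θ j * θ k = -(θ k * θ j)) (hθ : ∀ k, θ k * θ k = 0)
    (hIθ : ∀ j k, j ≠ k → I j * θ k = -(θ k * I j)) (hIθ1 : ∀ k, I k * θ k = 1 - θ k * I k)
    {k : κ} {l : List κ} (hk : k ∈ l) : horizontalProjector θ I l * θ k = 0 := by
  have hcomm : ∀ j, j ≠ k → (1 - θ j * I j) * θ k = θ k * (1 - θ j * I j) := fun j h => by
    rw [sub_mul, one_mul, mul_assoc, hIθ j k h, mul_neg, ← mul_assoc, hθθ j k, mul_sub, mul_one,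
      ← mul_assoc, neg_mul, neg_neg]
  have hnot : ∀ l : List κ, k ∉ l →
      horizontalProjector θ I l * θ k = θ k * horizontalProjector θ I l := fun l => by
    induction l with
    | nil => simp [horizontalProjector]
    | cons j l ih =>
      intro h
      rw [List.mem_cons, not_or] at h
      rw [horizontalProjector_cons, mul_assoc, ih h.2, ← mul_assoc, hcomm j (Ne.symm h.1),
        mul_assoc]
  induction l with
  | nil => simp at hk
  | cons j l ih =>
    rw [horizontalProjector_cons, mul_assoc]
    by_cases h : k ∈ l
    · rw [ih h, mul_zero]
    · obtain rfl := (List.mem_cons.1 hk).resolve_right h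
      have : (1 - θ k * I k) * θ k = 0 := by
        rw [sub_mul, one_mul, mul_assoc, hIθ1, mul_sub, mul_one, ← mul_assoc, hθ, zero_mul,
          sub_zero, sub_self]
      rw [hnot l h, ← mul_assoc, this, zero_mul]

end CliffordRelations

/-! ### The Weil model -/

namespace LieOperation

variable {𝔤 A : Type*} [LieRing 𝔤] [LieAlgebra ℝ 𝔤] [Ring A] [Algebra ℝ A]
  (op : LieOperation 𝔤 A)

theorem hom_ext_deg {M : Type*} [AddCommGroup M] [Module ℝ M] {f g : A →ₗ[ℝ] M}
    (h : ∀ p, ∀ a ∈ op.deg p, f a = g a) : f = g := by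
  refine LinearMap.ext fun a => ?_
  induction a using op.induction_deg with
  | mem p b hb => exact h p b hb
  | zero => rw [map_zero, map_zero]
  | add b c hb hc => rw [map_add, map_add, hb, hc]

/-- The Euler operator of a graded algebra: multiplication by `p` in degree `p`. -/
def euler : A →ₗ[ℝ] A :=
  DirectSum.toModule ℝ ℤ A (fun p => (p : ℝ) • (op.deg p).subtype) ∘ₗ
    ((LinearEquiv.ofBijective (DirectSum.coeLinearMap op.deg) op.bijective_coeLinearMap).symm :
      A →ₗ[ℝ] DirectSum ℤ fun q => op.deg q)

theorem euler_of_mem {p : ℤ} {a : A} (ha : a ∈ op.deg p) : op.euler a = (p : ℝ) • a := by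
  have h : (LinearEquiv.ofBijective (DirectSum.coeLinearMap op.deg)
      op.bijective_coeLinearMap).symm a = DirectSum.lof ℝ ℤ (fun q => op.deg q) p ⟨a, ha⟩ := by
    rw [LinearEquiv.symm_apply_eq, LinearEquiv.ofBijective_apply, DirectSum.coeLinearMap_lof]
  simp only [euler, LinearMap.comp_apply, LinearEquiv.coe_coe, h, DirectSum.toModule_lof]
  rfl

/-- An operator of degree `k` raises the eigenvalues of the Euler operator by `k`. -/
theorem euler_comp_of_degree (T : A →ₗ[ℝ] A) (k : ℤ)
    (hT : ∀ p a, a ∈ op.deg p → T a ∈ op.deg (p + k)) (a : A) :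
    op.euler (T a) = T (op.euler a) + (k : ℝ) • T a := by
  have : op.euler ∘ₗ T = T ∘ₗ op.euler + (k : ℝ) • T := op.hom_ext_deg fun p a ha => by
    simp only [LinearMap.comp_apply, LinearMap.add_apply, LinearMap.smul_apply,
      op.euler_of_mem ha, op.euler_of_mem (hT p a ha), map_smul, ← add_smul]
    push_cast
    rfl
  exact DFunLike.congr_fun this a

section Weil

/-- The Euler operator of `W ⊗ A`: multiplication by `n` in degree `n`. -/
def weilEuler : WeilAlgebra 𝔤 ⊗[ℝ] A →ₗ[ℝ] WeilAlgebra 𝔤 ⊗[ℝ] A :=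
  TensorProduct.map (WeilAlgebra.euler 𝔤) LinearMap.id + TensorProduct.map LinearMap.id op.euler

theorem weilEuler_tmul (w : WeilAlgebra 𝔤) (a : A) :
    op.weilEuler (w ⊗ₜ a) = WeilAlgebra.euler 𝔤 w ⊗ₜ a + w ⊗ₜ op.euler a := rfl

theorem weilLie_tmul (X : 𝔤) (w : WeilAlgebra 𝔤) (a : A) :
    op.weilLie X (w ⊗ₜ a) = WeilAlgebra.lie X w ⊗ₜ a + w ⊗ₜ op.lie X a := rfl

theorem weilContr_tmul (X : 𝔤) (w : WeilAlgebra 𝔤) (a : A) : op.weilContr X (w ⊗ₜ a) =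
    WeilAlgebra.contr X w ⊗ₜ a + WeilAlgebra.parity 𝔤 w ⊗ₜ op.contr X a := rfl

theorem weilD_tmul [Module.Finite ℝ 𝔤] (w : WeilAlgebra 𝔤) (a : A) : op.weilD (w ⊗ₜ a) =
    WeilAlgebra.d 𝔤 w ⊗ₜ a + WeilAlgebra.parity 𝔤 w ⊗ₜ op.d a := rfl

/-- The degree in `W ⊗ A` is detected by the Euler operator, which commutes with the constructions
below and is easier to transport than the submodules `weilDeg`. -/
theorem mem_weilDeg_iff {n : ℤ} {x : WeilAlgebra 𝔤 ⊗[ℝ] A} :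
    x ∈ op.weilDeg n ↔ op.weilEuler x = (n : ℝ) • x := by
  refine eq_eigenspace_of_iSup_eq_top op.weilEuler op.weilDeg (fun n x hx => ?_) ?_
  · have : op.weilDeg n ≤ LinearMap.ker (op.weilEuler - (n : ℝ) • LinearMap.id) := by
      refine iSup_le fun p => iSup_le fun q => iSup_le fun h => Submodule.map₂_le.2 ?_
      intro w hw a ha
      rw [LinearMap.mem_ker, LinearMap.sub_apply, sub_eq_zero]
      change op.weilEuler (w ⊗ₜ a) = (n : ℝ) • (w ⊗ₜ a)
      rw [weilEuler_tmul, WeilAlgebra.euler_of_mem_deg hw, op.euler_of_mem ha,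
        TensorProduct.tmul_smul, ← TensorProduct.smul_tmul', ← add_smul, ← h]
      push_cast
      rfl
    have h := this hx
    rwa [LinearMap.mem_ker, LinearMap.sub_apply, sub_eq_zero] at h
  · rw [eq_top_iff, ← TensorProduct.map₂_mk_top_top_eq_top ℝ (WeilAlgebra 𝔤) A,
      ← WeilAlgebra.iSup_deg, ← op.isInternal.submodule_iSup_eq_top, Submodule.map₂_iSup_left]
    refine iSup_le fun p => ?_
    rw [Submodule.map₂_iSup_right]
    refine iSup_le fun q => le_iSup_of_le (p + q) ?_
    exact le_iSup_of_le p (le_iSup_of_le q (le_iSup_of_le rfl le_rfl))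

/-- The contraction on `W ⊗ A` as a linear map in the element of the Lie algebra. -/
def weilContrₗ : 𝔤 →ₗ[ℝ] Module.End ℝ (WeilAlgebra 𝔤 ⊗[ℝ] A) where
  toFun := op.weilContr
  map_add' X Y := TensorProduct.ext' fun w a => by
    have : WeilAlgebra.contr (X + Y) w = WeilAlgebra.contr X w + WeilAlgebra.contr Y w := by
      have : WeilAlgebra.contr (X + Y) = WeilAlgebra.contr X + WeilAlgebra.contr Y :=
        WeilAlgebra.hom_ext fun s l => by
          simp only [LinearMap.add_apply, WeilAlgebra.contr_tmul, map_add, WeilAlgebra.tmul_add]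
      exact DFunLike.congr_fun this w
    simp only [LinearMap.add_apply, weilContr_tmul, this, TensorProduct.add_tmul, map_add,
      TensorProduct.tmul_add]
    abel
  map_smul' c X := TensorProduct.ext' fun w a => by
    have : WeilAlgebra.contr (c • X) w = c • WeilAlgebra.contr X w := by
      have : WeilAlgebra.contr (c • X) = c • WeilAlgebra.contr X :=
        WeilAlgebra.hom_ext fun s l => by
          simp only [LinearMap.smul_apply, WeilAlgebra.contr_tmul, map_smul, WeilAlgebra.tmul_smul]
      exact DFunLike.congr_fun this w
    simp only [RingHom.id_apply, LinearMap.smul_apply, weilContr_tmul, this,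
      ← TensorProduct.smul_tmul', map_smul, TensorProduct.tmul_smul, smul_add]

theorem weilContr_weilContr (X Y : 𝔤) (x : WeilAlgebra 𝔤 ⊗[ℝ] A) :
    op.weilContr X (op.weilContr Y x) = -op.weilContr Y (op.weilContr X x) := by
  have : op.weilContr X ∘ₗ op.weilContr Y = -(op.weilContr Y ∘ₗ op.weilContr X) :=
    TensorProduct.ext' fun w a => by
      have h := eq_neg_of_add_eq_zero_left (op.contr_contr X Y a)
      simp only [LinearMap.comp_apply, LinearMap.neg_apply, weilContr_tmul, map_add,
        WeilAlgebra.contr_contr X Y, WeilAlgebra.parity_contr, WeilAlgebra.parity_parity, h,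
        TensorProduct.neg_tmul, TensorProduct.tmul_neg]
      abel
  exact DFunLike.congr_fun this x

theorem weilLie_weilContr (X Y : 𝔤) (x : WeilAlgebra 𝔤 ⊗[ℝ] A) :
    op.weilLie X (op.weilContr Y x) - op.weilContr Y (op.weilLie X x) =
      op.weilContr ⁅X, Y⁆ x := by
  have : op.weilLie X ∘ₗ op.weilContr Y - op.weilContr Y ∘ₗ op.weilLie X = op.weilContr ⁅X, Y⁆ :=
    TensorProduct.ext' fun w a => by
      simp only [LinearMap.comp_apply, LinearMap.sub_apply, weilContr_tmul, weilLie_tmul, map_add,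
        ← WeilAlgebra.lie_contr X Y, ← op.lie_contr X Y, WeilAlgebra.parity_lie,
        TensorProduct.sub_tmul, TensorProduct.tmul_sub]
      abel
  exact DFunLike.congr_fun this x

theorem weilEuler_weilContr (Y : 𝔤) (x : WeilAlgebra 𝔤 ⊗[ℝ] A) :
    op.weilEuler (op.weilContr Y x) = op.weilContr Y (op.weilEuler x) - op.weilContr Y x := by
  have : op.weilEuler ∘ₗ op.weilContr Y = op.weilContr Y ∘ₗ op.weilEuler - op.weilContr Y :=
    TensorProduct.ext' fun w a => by
      have h1 := op.euler_comp_of_degree (op.contr Y) (-1) (fun p a ha => op.contr_mem Y ha) a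
      have h2 := sub_eq_iff_eq_add.1 (WeilAlgebra.euler_contr Y w)
      simp only [LinearMap.comp_apply, LinearMap.sub_apply, weilContr_tmul, weilEuler_tmul, map_add,
        WeilAlgebra.parity_euler, h1, h2, TensorProduct.neg_tmul, TensorProduct.add_tmul,
        TensorProduct.tmul_add, Int.cast_neg, Int.cast_one, neg_smul, one_smul,
        TensorProduct.tmul_neg]
      abel
  exact DFunLike.congr_fun this x

theorem weilContr_weilD [Module.Finite ℝ 𝔤] (X : 𝔤) (x : WeilAlgebra 𝔤 ⊗[ℝ] A) :
    op.weilContr X (op.weilD x) + op.weilD (op.weilContr X x) = op.weilLie X x := by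
  have : op.weilContr X ∘ₗ op.weilD + op.weilD ∘ₗ op.weilContr X = op.weilLie X :=
    TensorProduct.ext' fun w a => by
      simp only [LinearMap.comp_apply, LinearMap.add_apply, weilContr_tmul, weilLie_tmul,
        weilD_tmul, map_add, ← WeilAlgebra.contr_d X, ← op.cartan X, WeilAlgebra.parity_d,
        WeilAlgebra.parity_contr, WeilAlgebra.parity_parity,
        TensorProduct.neg_tmul, TensorProduct.add_tmul, TensorProduct.tmul_add]
      abel
  exact DFunLike.congr_fun this x

/-- Left multiplication of `W ⊗ A` by a generator of degree `1` of `W`. -/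
def weilTheta (A : Type*) [Ring A] [Algebra ℝ A] (ξ : Module.Dual ℝ 𝔤) :
    WeilAlgebra 𝔤 ⊗[ℝ] A →ₗ[ℝ] WeilAlgebra 𝔤 ⊗[ℝ] A :=
  TensorProduct.map (WeilAlgebra.mulTheta ξ) LinearMap.id

theorem weilTheta_tmul (ξ : Module.Dual ℝ 𝔤) (w : WeilAlgebra 𝔤) (a : A) :
    weilTheta A ξ (w ⊗ₜ a) = WeilAlgebra.mulTheta ξ w ⊗ₜ a := rfl

theorem weilTheta_weilTheta (ξ η : Module.Dual ℝ 𝔤) (x : WeilAlgebra 𝔤 ⊗[ℝ] A) :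
    weilTheta A ξ (weilTheta A η x) = -weilTheta A η (weilTheta A ξ x) := by
  have : weilTheta A ξ ∘ₗ weilTheta A η = -(weilTheta A η ∘ₗ weilTheta A ξ) :=
    TensorProduct.ext' fun w a => by
      simp only [LinearMap.comp_apply, LinearMap.neg_apply, weilTheta_tmul,
        WeilAlgebra.mulTheta_mulTheta ξ η, TensorProduct.neg_tmul]
  exact DFunLike.congr_fun this x

theorem weilContr_weilTheta (X : 𝔤) (ξ : Module.Dual ℝ 𝔤) (x : WeilAlgebra 𝔤 ⊗[ℝ] A) :
    op.weilContr X (weilTheta A ξ x) = ξ X • x - weilTheta A ξ (op.weilContr X x) := by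
  have : op.weilContr X ∘ₗ weilTheta A ξ =
      ξ X • LinearMap.id - weilTheta A ξ ∘ₗ op.weilContr X :=
    TensorProduct.ext' fun w a => by
      simp only [LinearMap.comp_apply, LinearMap.sub_apply, LinearMap.smul_apply,
        LinearMap.id_apply, weilTheta_tmul, weilContr_tmul, WeilAlgebra.contr_mulTheta,
        WeilAlgebra.parity_mulTheta, map_add, TensorProduct.neg_tmul, TensorProduct.sub_tmul,
        ← TensorProduct.smul_tmul']
      abel
  exact DFunLike.congr_fun this x

/-- An element of `W ⊗ A` is horizontal if all contractions annihilate it. -/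
def IsHorizontal (x : WeilAlgebra 𝔤 ⊗[ℝ] A) : Prop := ∀ X, op.weilContr X x = 0

variable {op}

theorem IsHorizontal.weilD_of_basic [Module.Finite ℝ 𝔤] {x : WeilAlgebra 𝔤 ⊗[ℝ] A}
    (hx : op.IsHorizontal x) (hL : ∀ X, op.weilLie X x = 0) : op.IsHorizontal (op.weilD x) :=
  fun X => by
    have h := op.weilContr_weilD X x
    rwa [hx X, map_zero, add_zero, hL X] at h

theorem IsHorizontal.add {x y : WeilAlgebra 𝔤 ⊗[ℝ] A} (hx : op.IsHorizontal x)
    (hy : op.IsHorizontal y) : op.IsHorizontal (x + y) := fun X => by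
  rw [map_add, hx X, hy X, add_zero]

theorem IsHorizontal.weilLie {x : WeilAlgebra 𝔤 ⊗[ℝ] A} (hx : op.IsHorizontal x) (X : 𝔤) :
    op.IsHorizontal (op.weilLie X x) := fun Y => by
  have h := op.weilLie_weilContr X Y x
  rwa [hx Y, hx, map_zero, zero_sub, neg_eq_zero] at h

theorem IsHorizontal.weilEuler {x : WeilAlgebra 𝔤 ⊗[ℝ] A} (hx : op.IsHorizontal x) :
    op.IsHorizontal (op.weilEuler x) := fun Y => by
  have h := op.weilEuler_weilContr Y x
  rwa [hx Y, map_zero, sub_zero, eq_comm] at h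

theorem mem_weilBasic_iff {x : WeilAlgebra 𝔤 ⊗[ℝ] A} :
    x ∈ op.weilBasic ↔ (∀ X, op.weilLie X x = 0) ∧ op.IsHorizontal x := by
  simp [weilBasic, IsHorizontal, Submodule.mem_iInf]

variable (op)

end Weil

/-! ### The projection of the Weil model onto the Cartan model -/

section Cartan

/-- The Lie derivative `L_X ⊗ 1 + 1 ⊗ L_X` of `S𝔤* ⊗ A`. -/
def cartanLie (X : 𝔤) : SymmetricAlgebra ℝ (Module.Dual ℝ 𝔤) ⊗[ℝ] A →ₗ[ℝ]
    SymmetricAlgebra ℝ (Module.Dual ℝ 𝔤) ⊗[ℝ] A :=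
  TensorProduct.map (symDeriv (WeilAlgebra.coad X)) LinearMap.id +
    TensorProduct.map LinearMap.id (op.lie X)

/-- The Euler operator of `S𝔤* ⊗ A`, where `S¹𝔤*` has degree `2`. -/
def cartanEuler : SymmetricAlgebra ℝ (Module.Dual ℝ 𝔤) ⊗[ℝ] A →ₗ[ℝ]
    SymmetricAlgebra ℝ (Module.Dual ℝ 𝔤) ⊗[ℝ] A :=
  TensorProduct.map ((2 : ℝ) • symDeriv LinearMap.id) LinearMap.id +
    TensorProduct.map LinearMap.id op.euler

/-- The differential `1 ⊗ d - ∑ Ωᵏ ⊗ I_k` of the Cartan model. -/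
def cartanD [Module.Finite ℝ 𝔤] : SymmetricAlgebra ℝ (Module.Dual ℝ 𝔤) ⊗[ℝ] A →ₗ[ℝ]
    SymmetricAlgebra ℝ (Module.Dual ℝ 𝔤) ⊗[ℝ] A :=
  TensorProduct.map LinearMap.id op.d -
    ∑ k, TensorProduct.map
      (LinearMap.mulLeft ℝ (SymmetricAlgebra.ι ℝ _ ((Module.finBasis ℝ 𝔤).coord k)))
      (op.contr (Module.finBasis ℝ 𝔤 k))

theorem cartanLie_tmul (X : 𝔤) (s : SymmetricAlgebra ℝ (Module.Dual ℝ 𝔤)) (a : A) :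
    op.cartanLie X (s ⊗ₜ a) = symDeriv (WeilAlgebra.coad X) s ⊗ₜ a + s ⊗ₜ op.lie X a := rfl

theorem cartanEuler_tmul (s : SymmetricAlgebra ℝ (Module.Dual ℝ 𝔤)) (a : A) :
    op.cartanEuler (s ⊗ₜ a) = ((2 : ℝ) • symDeriv LinearMap.id s) ⊗ₜ a + s ⊗ₜ op.euler a := rfl

theorem cartanD_tmul [Module.Finite ℝ 𝔤] (s : SymmetricAlgebra ℝ (Module.Dual ℝ 𝔤)) (a : A) :
    op.cartanD (s ⊗ₜ a) = s ⊗ₜ op.d a -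
      ∑ k, (SymmetricAlgebra.ι ℝ _ ((Module.finBasis ℝ 𝔤).coord k) * s) ⊗ₜ
        op.contr (Module.finBasis ℝ 𝔤 k) a := by
  simp only [cartanD, LinearMap.sub_apply, LinearMap.sum_apply, TensorProduct.map_tmul,
    LinearMap.mulLeft_apply, LinearMap.id_apply]

/-- The projection `W ⊗ A → S𝔤* ⊗ A` that annihilates the generators of degree `1` of `W`. -/
def toCartan (𝔤 A : Type*) [AddCommGroup 𝔤] [Module ℝ 𝔤] [Ring A] [Algebra ℝ A] :
    WeilAlgebra 𝔤 ⊗[ℝ] A →ₗ[ℝ] SymmetricAlgebra ℝ (Module.Dual ℝ 𝔤) ⊗[ℝ] A :=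
  TensorProduct.map (WeilAlgebra.augment 𝔤) LinearMap.id

theorem toCartan_tmul (w : WeilAlgebra 𝔤) (a : A) :
    toCartan 𝔤 A (w ⊗ₜ a) = WeilAlgebra.augment 𝔤 w ⊗ₜ a := rfl

theorem toCartan_weilTheta (ξ : Module.Dual ℝ 𝔤) (x : WeilAlgebra 𝔤 ⊗[ℝ] A) :
    toCartan 𝔤 A (weilTheta A ξ x) = 0 := by
  have : toCartan 𝔤 A ∘ₗ weilTheta A ξ = 0 := TensorProduct.ext' fun w a => by
    simp only [LinearMap.comp_apply, weilTheta_tmul, toCartan_tmul, WeilAlgebra.augment_mulTheta,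
      TensorProduct.zero_tmul, LinearMap.zero_apply]
  exact DFunLike.congr_fun this x

theorem toCartan_weilLie (X : 𝔤) (x : WeilAlgebra 𝔤 ⊗[ℝ] A) :
    toCartan 𝔤 A (op.weilLie X x) = op.cartanLie X (toCartan 𝔤 A x) := by
  have : toCartan 𝔤 A ∘ₗ op.weilLie X = op.cartanLie X ∘ₗ toCartan 𝔤 A :=
    TensorProduct.ext' fun w a => by
      simp only [LinearMap.comp_apply, weilLie_tmul, toCartan_tmul, map_add, cartanLie_tmul,
        WeilAlgebra.augment_lie]
  exact DFunLike.congr_fun this x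

theorem toCartan_weilEuler (x : WeilAlgebra 𝔤 ⊗[ℝ] A) :
    toCartan 𝔤 A (op.weilEuler x) = op.cartanEuler (toCartan 𝔤 A x) := by
  have : toCartan 𝔤 A ∘ₗ op.weilEuler = op.cartanEuler ∘ₗ toCartan 𝔤 A :=
    TensorProduct.ext' fun w a => by
      simp only [LinearMap.comp_apply, weilEuler_tmul, toCartan_tmul, map_add, cartanEuler_tmul,
        WeilAlgebra.augment_euler]
  exact DFunLike.congr_fun this x

/-- The inclusion `S𝔤* ⊗ A → W ⊗ A`. -/
def ofCartan (𝔤 A : Type*) [AddCommGroup 𝔤] [Module ℝ 𝔤] [Ring A] [Algebra ℝ A] :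
    SymmetricAlgebra ℝ (Module.Dual ℝ 𝔤) ⊗[ℝ] A →ₗ[ℝ] WeilAlgebra 𝔤 ⊗[ℝ] A :=
  TensorProduct.map ((WeilAlgebra.tmulₗ 𝔤).flip 1) LinearMap.id

theorem ofCartan_tmul (s : SymmetricAlgebra ℝ (Module.Dual ℝ 𝔤)) (a : A) :
    ofCartan 𝔤 A (s ⊗ₜ a) = WeilAlgebra.tmul s 1 ⊗ₜ a := rfl

theorem toCartan_ofCartan (y : SymmetricAlgebra ℝ (Module.Dual ℝ 𝔤) ⊗[ℝ] A) :
    toCartan 𝔤 A (ofCartan 𝔤 A y) = y := by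
  have : toCartan 𝔤 A ∘ₗ ofCartan 𝔤 A = LinearMap.id := TensorProduct.ext' fun s a => by
    simp only [LinearMap.comp_apply, ofCartan_tmul, toCartan_tmul, WeilAlgebra.augment_tmul,
      map_one, one_smul, LinearMap.id_apply]
  exact DFunLike.congr_fun this y

theorem weilTheta_mul_self (ξ : Module.Dual ℝ 𝔤) (x : WeilAlgebra 𝔤 ⊗[ℝ] A) :
    weilTheta A ξ (weilTheta A ξ x) = 0 :=
  eq_zero_of_eq_neg (weilTheta_weilTheta ξ ξ x)

variable [Module.Finite ℝ 𝔤]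

/-- The projection onto the Cartan model intertwines the differentials up to a term that involves
the contractions, and hence vanishes on horizontal elements. -/
theorem toCartan_weilD_eq (x : WeilAlgebra 𝔤 ⊗[ℝ] A) :
    toCartan 𝔤 A (op.weilD x) = op.cartanD (toCartan 𝔤 A x) +
      ∑ k, TensorProduct.map
        (LinearMap.mulLeft ℝ (SymmetricAlgebra.ι ℝ _ ((Module.finBasis ℝ 𝔤).coord k)))
        LinearMap.id (toCartan 𝔤 A (op.weilContr (Module.finBasis ℝ 𝔤 k) x)) := by
  have : toCartan 𝔤 A ∘ₗ op.weilD = op.cartanD ∘ₗ toCartan 𝔤 A +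
      ∑ k, TensorProduct.map
        (LinearMap.mulLeft ℝ (SymmetricAlgebra.ι ℝ _ ((Module.finBasis ℝ 𝔤).coord k)))
        LinearMap.id ∘ₗ toCartan 𝔤 A ∘ₗ op.weilContr (Module.finBasis ℝ 𝔤 k) :=
    TensorProduct.ext' fun w a => by
      simp only [LinearMap.comp_apply, LinearMap.add_apply, LinearMap.sum_apply, weilD_tmul,
        toCartan_tmul, map_add, cartanD_tmul, WeilAlgebra.augment_d, weilContr_tmul,
        WeilAlgebra.augment_parity, TensorProduct.sum_tmul, TensorProduct.map_tmul,
        LinearMap.mulLeft_apply, LinearMap.id_apply, Finset.sum_add_distrib]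
      abel
  simpa [LinearMap.sum_apply] using DFunLike.congr_fun this x

theorem toCartan_weilD {x : WeilAlgebra 𝔤 ⊗[ℝ] A} (hx : op.IsHorizontal x) :
    toCartan 𝔤 A (op.weilD x) = op.cartanD (toCartan 𝔤 A x) := by
  rw [toCartan_weilD_eq, Finset.sum_eq_zero fun k _ => by rw [hx, map_zero, map_zero], add_zero]

/-- The projection of `W ⊗ A` onto its horizontal elements along the ideal that is spanned by the
generators of degree `1` of `W`. -/
def weilHor : Module.End ℝ (WeilAlgebra 𝔤 ⊗[ℝ] A) :=
  horizontalProjector (fun k => (weilTheta A ((Module.finBasis ℝ 𝔤).coord k) :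
      Module.End ℝ (WeilAlgebra 𝔤 ⊗[ℝ] A)))
    (fun k => op.weilContr (Module.finBasis ℝ 𝔤 k)) (List.finRange _)

theorem weilHor_weilTheta (k : Fin (Module.finrank ℝ 𝔤)) (x : WeilAlgebra 𝔤 ⊗[ℝ] A) :
    op.weilHor (weilTheta A ((Module.finBasis ℝ 𝔤).coord k) x) = 0 := by
  refine DFunLike.congr_fun (horizontalProjector_mul
    (R := Module.End ℝ (WeilAlgebra 𝔤 ⊗[ℝ] A)) (k := k) (l := List.finRange _) ?_ ?_ ?_ ?_
    (List.mem_finRange k)) x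
  · exact fun i j => LinearMap.ext fun x => weilTheta_weilTheta _ _ x
  · exact fun i => LinearMap.ext fun x => weilTheta_mul_self _ x
  · refine fun i j hij => LinearMap.ext fun x => (op.weilContr_weilTheta _ _ x).trans ?_
    simp [hij]
  · refine fun i => LinearMap.ext fun x => (op.weilContr_weilTheta _ _ x).trans ?_
    simp

theorem isHorizontal_weilHor (x : WeilAlgebra 𝔤 ⊗[ℝ] A) : op.IsHorizontal (op.weilHor x) := by
  have h : ∀ k, op.weilContr (Module.finBasis ℝ 𝔤 k) (op.weilHor x) = 0 := fun k => by
    refine DFunLike.congr_fun (mul_horizontalProjector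
      (R := Module.End ℝ (WeilAlgebra 𝔤 ⊗[ℝ] A))
      (θ := fun k => weilTheta A ((Module.finBasis ℝ 𝔤).coord k))
      (I := fun k => op.weilContr (Module.finBasis ℝ 𝔤 k)) (k := k) (l := List.finRange _)
      ?_ ?_ ?_ ?_ (List.mem_finRange k)) x
    · exact fun i j => LinearMap.ext fun x => op.weilContr_weilContr _ _ x
    · exact fun i => LinearMap.ext fun x => eq_zero_of_eq_neg (op.weilContr_weilContr _ _ x)
    · refine fun i j hij => LinearMap.ext fun x => (op.weilContr_weilTheta _ _ x).trans ?_
      simp [hij]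
    · refine fun i => LinearMap.ext fun x => (op.weilContr_weilTheta _ _ x).trans ?_
      simp
  intro X
  have := map_eq_sum_coord (Module.finBasis ℝ 𝔤)
    (LinearMap.applyₗ (op.weilHor x) ∘ₗ op.weilContrₗ) X
  refine this.trans (Finset.sum_eq_zero fun k _ => ?_)
  have hk : (LinearMap.applyₗ (op.weilHor x) ∘ₗ op.weilContrₗ) (Module.finBasis ℝ 𝔤 k) = 0 := h k
  rw [hk, smul_zero]

theorem toCartan_weilHor (x : WeilAlgebra 𝔤 ⊗[ℝ] A) :
    toCartan 𝔤 A (op.weilHor x) = toCartan 𝔤 A x := by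
  unfold weilHor
  induction List.finRange (Module.finrank ℝ 𝔤) with
  | nil => rfl
  | cons k l ih =>
    rw [horizontalProjector_cons, sub_mul, one_mul, LinearMap.sub_apply, map_sub, ih, mul_assoc,
      Module.End.mul_apply, toCartan_weilTheta, sub_zero]

theorem IsHorizontal.weilHor_eq {x : WeilAlgebra 𝔤 ⊗[ℝ] A} (hx : op.IsHorizontal x) :
    op.weilHor x = x := by
  unfold weilHor
  induction List.finRange (Module.finrank ℝ 𝔤) with
  | nil => rfl
  | cons k l ih =>
    rw [horizontalProjector_cons, Module.End.mul_apply, ih, LinearMap.sub_apply,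
      Module.End.mul_apply, hx, map_zero, sub_zero]
    rfl

/-- The horizontal projection only depends on the projection to the Cartan model, because it
annihilates the ideal spanned by the generators of degree `1` of `W`. -/
theorem weilHor_eq_toCartan (x : WeilAlgebra 𝔤 ⊗[ℝ] A) :
    op.weilHor x = op.weilHor (ofCartan 𝔤 A (toCartan 𝔤 A x)) := by
  induction x using TensorProduct.induction_on with
  | zero => simp only [map_zero]
  | add x y hx hy => simp only [map_add, hx, hy]
  | tmul w a =>
    have : op.weilHor ∘ₗ (TensorProduct.mk ℝ (WeilAlgebra 𝔤) A).flip a =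
        op.weilHor ∘ₗ ofCartan 𝔤 A ∘ₗ toCartan 𝔤 A ∘ₗ
          (TensorProduct.mk ℝ (WeilAlgebra 𝔤) A).flip a := WeilAlgebra.hom_ext fun s l => by
      simp only [LinearMap.comp_apply, LinearMap.flip_apply, TensorProduct.mk_apply, toCartan_tmul,
        WeilAlgebra.augment_tmul, ofCartan_tmul]
      obtain ⟨y, hy⟩ := ExteriorAlgebra.exists_eq_add_sum (Module.finBasis ℝ 𝔤).dualBasis l
      conv_lhs => rw [hy]
      rw [WeilAlgebra.tmul_add, WeilAlgebra.tmul_smul, WeilAlgebra.tmul_sum, TensorProduct.add_tmul,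
        map_add, TensorProduct.sum_tmul, map_sum, Finset.sum_eq_zero, add_zero,
        WeilAlgebra.smul_tmul]
      intro k _
      rw [← WeilAlgebra.mulTheta_tmul, ← weilTheta_tmul, Module.Basis.coe_dualBasis]
      exact op.weilHor_weilTheta k _
    exact DFunLike.congr_fun this w

variable {op} in
/-- The projection onto the Cartan model is injective on horizontal elements. -/
theorem IsHorizontal.ext {x y : WeilAlgebra 𝔤 ⊗[ℝ] A} (hx : op.IsHorizontal x)
    (hy : op.IsHorizontal y) (h : toCartan 𝔤 A x = toCartan 𝔤 A y) : x = y := by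
  rw [← hx.weilHor_eq, ← hy.weilHor_eq, op.weilHor_eq_toCartan x, op.weilHor_eq_toCartan y, h]

/-- Every invariant element of degree `n` of `S𝔤* ⊗ A` is the image of a basic element of degree
`n` of `W ⊗ A`, namely of the horizontal projection of `y` regarded as an element of `W ⊗ A`.
Invariance and degree need only be checked after projection to the Cartan model. -/
theorem exists_weilBasic {y : SymmetricAlgebra ℝ (Module.Dual ℝ 𝔤) ⊗[ℝ] A} {n : ℤ}
    (hy : ∀ X, op.cartanLie X y = 0) (hn : op.cartanEuler y = (n : ℝ) • y) :
    ∃ x ∈ op.weilBasic ⊓ op.weilDeg n, toCartan 𝔤 A x = y := by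
  have hx := op.isHorizontal_weilHor (ofCartan 𝔤 A y)
  have hxy : toCartan 𝔤 A (op.weilHor (ofCartan 𝔤 A y)) = y := by
    rw [toCartan_weilHor, toCartan_ofCartan]
  refine ⟨_, ⟨mem_weilBasic_iff.2 ⟨fun X => ?_, hx⟩, op.mem_weilDeg_iff.2 ?_⟩, hxy⟩
  · refine (hx.weilLie X).ext (fun Y => map_zero _) ?_
    rw [toCartan_weilLie, hxy, hy, map_zero]
  · refine hx.weilEuler.ext (fun Y => ?_) ?_
    · rw [map_smul, hx, smul_zero]
    · rw [toCartan_weilEuler, map_smul, hxy, hn]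

end Cartan

end LieOperation

/-! ### Eigenspaces of derivations -/

section Eigenspaces

variable {R : Type*} [Ring R] [Algebra ℝ R] (D : Module.End ℝ R) (M : Subalgebra ℝ R)

/-- The sum of a subalgebra and of the eigenspaces of an endomorphism for the eigenvalues
`-1, -2, -3, …`. -/
def addNegEigenspaces : Submodule ℝ R :=
  M.toSubmodule ⊔ ⨆ k : ℕ, D.eigenspace (-((k : ℝ) + 1))

variable {D M}

theorem mem_addNegEigenspaces_of_mem {x : R} (hx : x ∈ M) : x ∈ addNegEigenspaces D M :=
  Submodule.mem_sup_left hx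

theorem mem_addNegEigenspaces_of_eigen (k : ℕ) {x : R} (hx : D x = -((k : ℝ) + 1) • x) :
    x ∈ addNegEigenspaces D M :=
  Submodule.mem_sup_right (Submodule.mem_iSup_of_mem k (Module.End.mem_eigenspace_iff.2 hx))

/-- If `D` is a derivation that vanishes on `M`, then `addNegEigenspaces D M` is closed under
products, because eigenvalues add up. -/
theorem mul_mem_addNegEigenspaces (hD : ∀ x y, D (x * y) = D x * y + x * D y)
    (hM : ∀ x ∈ M, D x = 0) {x y : R} (hx : x ∈ addNegEigenspaces D M)
    (hy : y ∈ addNegEigenspaces D M) : x * y ∈ addNegEigenspaces D M := by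
  have h : addNegEigenspaces D M * addNegEigenspaces D M ≤ addNegEigenspaces D M := by
    unfold addNegEigenspaces
    rw [Submodule.sup_mul, Submodule.mul_sup, Submodule.mul_sup]
    refine sup_le (sup_le ?_ ?_) (sup_le ?_ ?_)
    · exact Submodule.mul_le.2 fun x hx y hy => mem_addNegEigenspaces_of_mem (M.mul_mem hx hy)
    · rw [Submodule.mul_iSup]
      refine iSup_le fun k => Submodule.mul_le.2 fun x hx y hy =>
        mem_addNegEigenspaces_of_eigen k ?_
      rw [hD, hM x hx, Module.End.mem_eigenspace_iff.1 hy, zero_mul, zero_add, mul_smul_comm]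
    · rw [Submodule.iSup_mul]
      refine iSup_le fun k => Submodule.mul_le.2 fun x hx y hy =>
        mem_addNegEigenspaces_of_eigen k ?_
      rw [hD, hM y hy, Module.End.mem_eigenspace_iff.1 hx, mul_zero, add_zero, smul_mul_assoc]
    · rw [Submodule.iSup_mul]
      refine iSup_le fun k => ?_
      rw [Submodule.mul_iSup]
      refine iSup_le fun l => Submodule.mul_le.2 fun x hx y hy =>
        mem_addNegEigenspaces_of_eigen (k + l + 1) ?_
      rw [hD, Module.End.mem_eigenspace_iff.1 hx, Module.End.mem_eigenspace_iff.1 hy,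
        smul_mul_assoc, mul_smul_comm, ← add_smul]
      congr 1
      push_cast
      ring
  exact h (Submodule.mul_mem_mul hx hy)

/-- For every `x` in the sum of the kernel and the eigenspaces for the eigenvalues `-1, -2, …`, the
projection of `x` to the kernel is of the form `x + D q(D) x` with a polynomial `q`.  No finiteness
is needed, since `q` may depend on `x`. -/
theorem exists_polynomial_of_mem_addNegEigenspaces (hM : ∀ x ∈ M, D x = 0) {x : R}
    (hx : x ∈ addNegEigenspaces D M) :
    ∃ q : Polynomial ℝ, x + D (Polynomial.aeval D q x) ∈ M := by
  have hexp : ∀ (q : Polynomial ℝ) (z : R), Polynomial.aeval D (1 + Polynomial.X * q) z =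
      z + D (Polynomial.aeval D q z) := fun q z => by
    simp
  obtain ⟨m, hm, y, hy, rfl⟩ := Submodule.mem_sup.1 hx
  -- The polynomials with constant term `1` are closed under products, so that annihilators of
  -- this form can be combined.
  have key : ∃ q : Polynomial ℝ, Polynomial.aeval D (1 + Polynomial.X * q) y = 0 := by
    clear hx
    induction hy using Submodule.iSup_induction' with
    | mem k y hy =>
      refine ⟨Polynomial.C ((k : ℝ) + 1)⁻¹, ?_⟩
      have hk : (k : ℝ) + 1 ≠ 0 := by positivity
      rw [hexp, Polynomial.aeval_C, Module.algebraMap_end_apply, map_smul,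
        Module.End.mem_eigenspace_iff.1 hy, smul_smul, mul_neg, inv_mul_cancel₀ hk, neg_one_smul,
        add_neg_cancel]
    | zero => exact ⟨0, map_zero _⟩
    | add y z _ _ hy hz =>
      obtain ⟨p, hp⟩ := hy
      obtain ⟨q, hq⟩ := hz
      refine ⟨p + q + Polynomial.X * p * q, ?_⟩
      have h1 : (1 + Polynomial.X * (p + q + Polynomial.X * p * q) : Polynomial ℝ) =
          (1 + Polynomial.X * q) * (1 + Polynomial.X * p) := by ring
      have h2 : (1 + Polynomial.X * (p + q + Polynomial.X * p * q) : Polynomial ℝ) =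
          (1 + Polynomial.X * p) * (1 + Polynomial.X * q) := by ring
      rw [map_add]
      conv_lhs => enter [1]; rw [h1, map_mul, Module.End.mul_apply, hp, map_zero]
      rw [h2, map_mul, Module.End.mul_apply, hq, map_zero, add_zero]
  obtain ⟨q, hq⟩ := key
  refine ⟨q, ?_⟩
  rw [hexp] at hq
  have hDm : D (Polynomial.aeval D q m) = 0 := by
    have : D (Polynomial.aeval D q m) = Polynomial.aeval D q (D m) := by
      rw [← Module.End.mul_apply, ← Module.End.mul_apply]
      congr 1
      simpa using congrArg (Polynomial.aeval D) (mul_comm Polynomial.X q)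
    rw [this, hM m hm, map_zero]
  have : m + y + D (Polynomial.aeval D q (m + y)) = m := by
    rw [map_add, map_add, hDm, zero_add, add_assoc, hq, add_zero]
  rw [this]
  exact hm

end Eigenspaces

namespace LieOperation

variable {𝔤 A : Type*} [LieRing 𝔤] [LieAlgebra ℝ 𝔤] [Ring A] [Algebra ℝ A]
  (op : LieOperation 𝔤 A)

/-! ### Derivations of operations -/

section Derivations

variable {op} in
theorem mul_comm_of_even {p : ℤ} (hp : Even p) {c : A} (hc : c ∈ op.deg p) (a : A) :
    c * a = a * c := by
  induction a using op.induction_deg with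
  | mem q b hb => rw [op.super_comm hc hb, (hp.mul_right q).neg_one_zpow, one_smul]
  | zero => simp
  | add b c hb hc => rw [mul_add, add_mul, hb, hc]

theorem neg_one_zpow_smul_smul {M : Type*} [AddCommGroup M] [Module ℝ M] (p : ℤ) (x : M) :
    (-1 : ℝ) ^ p • (-1 : ℝ) ^ p • x = x := by
  rw [smul_smul, ← zpow_add₀ (by norm_num), (Even.add_self p).neg_one_zpow, one_smul]

/-- The Lie derivatives are derivations, as graded commutators of two odd derivations. -/
theorem lie_mul (X : 𝔤) (a b : A) : op.lie X (a * b) = op.lie X a * b + a * op.lie X b := by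
  induction a using op.induction_deg with
  | mem p a ha =>
    rw [← op.cartan, ← op.cartan, ← op.cartan, op.d_mul ha, op.contr_mul X ha, map_add, map_add,
      op.contr_mul X (op.d_mem ha), op.d_mul (op.contr_mem X ha), map_smul, map_smul,
      op.contr_mul X ha, op.d_mul ha, zpow_add₀ (by norm_num), zpow_sub₀ (by norm_num), smul_add,
      smul_add, neg_one_zpow_smul_smul, neg_one_zpow_smul_smul, add_mul, mul_add]
    simp only [zpow_one, mul_neg, mul_one, div_neg, div_one, neg_smul]
    abel
  | zero => simp
  | add a c ha hc => rw [add_mul, map_add, ha, hc, map_add, add_mul, add_mul]; abel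

/-- The derivation `θ I_X` of degree `0`, for an element `θ` of degree `1`. -/
theorem mul_contr_mul {θ : A} (hθ : θ ∈ op.deg 1) (X : 𝔤) (a b : A) :
    θ * op.contr X (a * b) = θ * op.contr X a * b + a * (θ * op.contr X b) := by
  induction a using op.induction_deg with
  | mem p a ha =>
    have h := op.super_comm hθ ha
    rw [one_mul] at h
    rw [op.contr_mul X ha, mul_add, mul_smul_comm, ← mul_assoc θ a, h, smul_mul_assoc,
      neg_one_zpow_smul_smul, mul_assoc, mul_assoc]
  | zero => simp
  | add a c ha hc =>
    rw [add_mul, map_add, mul_add, ha, hc, map_add, mul_add, add_mul, add_mul]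
    abel

/-- The product of a derivation of `S` and a central element of `A` is a derivation of `S ⊗ A`. -/
theorem tensor_derivation {S : Type*} [CommRing S] [Algebra ℝ S] {δ : S →ₗ[ℝ] S}
    (hδ : ∀ x y, δ (x * y) = δ x * y + x * δ y) {c : A} (hc : ∀ a, c * a = a * c)
    (x y : S ⊗[ℝ] A) : TensorProduct.map δ (LinearMap.mulLeft ℝ c) (x * y) =
      TensorProduct.map δ (LinearMap.mulLeft ℝ c) x * y +
        x * TensorProduct.map δ (LinearMap.mulLeft ℝ c) y := by
  induction x using TensorProduct.induction_on with
  | zero => simp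
  | add x x' hx hx' => rw [add_mul, map_add, map_add, hx, hx', add_mul, add_mul]; abel
  | tmul s a =>
    induction y using TensorProduct.induction_on with
    | zero => simp
    | add y y' hy hy' => rw [mul_add, map_add, map_add, hy, hy', mul_add, mul_add]; abel
    | tmul t b =>
      simp only [Algebra.TensorProduct.tmul_mul_tmul, TensorProduct.map_tmul, hδ,
        LinearMap.mulLeft_apply, TensorProduct.add_tmul]
      rw [← mul_assoc a c b, ← hc a, mul_assoc]

/-- A derivation of `A` induces a derivation of `S ⊗ A`. -/
theorem tensor_derivation_right {S : Type*} [CommRing S] [Algebra ℝ S] {δ : A →ₗ[ℝ] A}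
    (hδ : ∀ x y, δ (x * y) = δ x * y + x * δ y) (x y : S ⊗[ℝ] A) :
    TensorProduct.map LinearMap.id δ (x * y) =
      TensorProduct.map LinearMap.id δ x * y + x * TensorProduct.map LinearMap.id δ y := by
  induction x using TensorProduct.induction_on with
  | zero => simp
  | add x x' hx hx' => rw [add_mul, map_add, map_add, hx, hx', add_mul, add_mul]; abel
  | tmul s a =>
    induction y using TensorProduct.induction_on with
    | zero => simp
    | add y y' hy hy' => rw [mul_add, map_add, map_add, hy, hy', mul_add, mul_add]; abel
    | tmul t b =>
      simp only [Algebra.TensorProduct.tmul_mul_tmul, TensorProduct.map_tmul, hδ,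
        LinearMap.id_apply, TensorProduct.tmul_add]

end Derivations

/-! ### The Cartan complex -/

section CartanComplex

variable [Module.Finite ℝ 𝔤]

theorem cartanEuler_cartanD (x : SymmetricAlgebra ℝ (Module.Dual ℝ 𝔤) ⊗[ℝ] A) :
    op.cartanEuler (op.cartanD x) = op.cartanD (op.cartanEuler x) + op.cartanD x := by
  have : op.cartanEuler ∘ₗ op.cartanD = op.cartanD ∘ₗ op.cartanEuler + op.cartanD :=
    TensorProduct.ext' fun s a => by
      have h1 := op.euler_comp_of_degree op.d 1 (fun p a ha => op.d_mem ha) a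
      have h2 := fun X => op.euler_comp_of_degree (op.contr X) (-1)
        (fun p a ha => op.contr_mem X ha) a
      simp only [LinearMap.comp_apply, LinearMap.add_apply, cartanD_tmul, cartanEuler_tmul,
        map_add, map_sub, map_sum, h1, h2, SymmetricAlgebra.symDeriv_mul,
        SymmetricAlgebra.symDeriv_ι, LinearMap.id_apply, Int.cast_neg, Int.cast_one, neg_smul,
        one_smul, smul_add, TensorProduct.add_tmul, TensorProduct.tmul_add,
        TensorProduct.tmul_neg, Finset.sum_add_distrib, Finset.sum_neg_distrib, two_smul]
      abel
  exact DFunLike.congr_fun this x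

theorem cartanLie_cartanD (X : 𝔤) (x : SymmetricAlgebra ℝ (Module.Dual ℝ 𝔤) ⊗[ℝ] A) :
    op.cartanLie X (op.cartanD x) = op.cartanD (op.cartanLie X x) := by
  have : op.cartanLie X ∘ₗ op.cartanD = op.cartanD ∘ₗ op.cartanLie X :=
    TensorProduct.ext' fun s a => by
      set e := Module.finBasis ℝ 𝔤 with he
      let B : 𝔤 →ₗ[ℝ] Module.Dual ℝ 𝔤 →ₗ[ℝ] SymmetricAlgebra ℝ (Module.Dual ℝ 𝔤) ⊗[ℝ] A :=
        LinearMap.mk₂ ℝ (fun Z ξ => (SymmetricAlgebra.ι ℝ _ ξ * s) ⊗ₜ[ℝ] op.contr Z a)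
          (by intros; simp [TensorProduct.tmul_add]) (by intros; simp)
          (by intros; simp [add_mul, TensorProduct.add_tmul])
          (by intros; simp [TensorProduct.smul_tmul'])
      have h := sum_basis_transpose e e (LieAlgebra.ad ℝ 𝔤 X) B
      have h1 : ∑ k, (SymmetricAlgebra.ι ℝ _ (e.coord k) * s) ⊗ₜ[ℝ] op.contr ⁅X, e k⁆ a =
          -∑ k, (SymmetricAlgebra.ι ℝ _ (WeilAlgebra.coad X (e.coord k)) * s) ⊗ₜ[ℝ]
            op.contr (e k) a := by
        refine h.trans ?_
        rw [← Finset.sum_neg_distrib]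
        refine Finset.sum_congr rfl fun k _ => ?_
        have : WeilAlgebra.coad X (e.coord k) = -(e.coord k ∘ₗ LieAlgebra.ad ℝ 𝔤 X) := rfl
        rw [this, map_neg, neg_mul, TensorProduct.neg_tmul, neg_neg]
        rfl
      simp only [LinearMap.comp_apply, cartanD_tmul, cartanLie_tmul, ← he,
        map_add, map_sub, map_sum, SymmetricAlgebra.symDeriv_mul, op.lie_d,
        SymmetricAlgebra.symDeriv_ι, TensorProduct.add_tmul,
        Finset.sum_add_distrib, fun k => sub_eq_iff_eq_add.1 (op.lie_contr X (e k) a),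
        TensorProduct.tmul_add, h1]
      abel
  exact DFunLike.congr_fun this x

/-- The coadjoint action along the tautological element: `∑ Ωᵏ L_k = 0` on `S𝔤*`. -/
theorem sum_ι_mul_symDeriv_coad (s : SymmetricAlgebra ℝ (Module.Dual ℝ 𝔤)) :
    ∑ k, SymmetricAlgebra.ι ℝ _ ((Module.finBasis ℝ 𝔤).coord k) *
      symDeriv (WeilAlgebra.coad (Module.finBasis ℝ 𝔤 k)) s = 0 := by
  set e := Module.finBasis ℝ 𝔤 with he
  have h : ∑ k, LinearMap.mulLeft ℝ (SymmetricAlgebra.ι ℝ _ (e.coord k)) ∘ₗ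
      symDeriv (WeilAlgebra.coad (e k)) = 0 := by
    refine SymmetricAlgebra.derivation_ext (fun x y => ?_) (by simp) fun ξ => ?_
    · simp only [LinearMap.sum_apply, LinearMap.comp_apply, LinearMap.mulLeft_apply,
        SymmetricAlgebra.symDeriv_mul, Finset.sum_mul, Finset.mul_sum, ← Finset.sum_add_distrib]
      refine Finset.sum_congr rfl fun k _ => ?_
      ring
    · simp only [LinearMap.sum_apply, LinearMap.comp_apply, LinearMap.mulLeft_apply,
        SymmetricAlgebra.symDeriv_ι, LinearMap.zero_apply]
      have h1 : ∀ k, WeilAlgebra.coad (e k) ξ = ∑ l, (-ξ ⁅e k, e l⁆) • e.coord l := fun k => by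
        refine e.ext fun i => ?_
        simp [LinearMap.sum_apply, WeilAlgebra.coad_apply, Finsupp.single_apply, -neg_lie, -lie_neg]
      have h2 : ∑ k, SymmetricAlgebra.ι ℝ _ (e.coord k) *
          SymmetricAlgebra.ι ℝ _ (WeilAlgebra.coad (e k) ξ) = ∑ k, ∑ l, (-ξ ⁅e k, e l⁆) •
            (SymmetricAlgebra.ι ℝ _ (e.coord k) * SymmetricAlgebra.ι ℝ _ (e.coord l)) := by
        refine Finset.sum_congr rfl fun k _ => ?_
        rw [h1, map_sum, Finset.mul_sum]
        refine Finset.sum_congr rfl fun l _ => ?_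
        rw [map_smul, mul_smul_comm]
      rw [h2]
      refine eq_zero_of_eq_neg ?_
      conv_lhs => rw [Finset.sum_comm]
      rw [← Finset.sum_neg_distrib]
      refine Finset.sum_congr rfl fun k _ => ?_
      rw [← Finset.sum_neg_distrib]
      refine Finset.sum_congr rfl fun l _ => ?_
      rw [← lie_skew (e l) (e k), map_neg, mul_comm, neg_smul]
  simpa [LinearMap.sum_apply] using DFunLike.congr_fun h s

/-- The square of the Cartan differential is `-∑ Ωᵏ L_k`. -/
theorem cartanD_cartanD (x : SymmetricAlgebra ℝ (Module.Dual ℝ 𝔤) ⊗[ℝ] A) :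
    op.cartanD (op.cartanD x) = -∑ k, TensorProduct.map
      (LinearMap.mulLeft ℝ (SymmetricAlgebra.ι ℝ _ ((Module.finBasis ℝ 𝔤).coord k)))
      LinearMap.id (op.cartanLie (Module.finBasis ℝ 𝔤 k) x) := by
  have : op.cartanD ∘ₗ op.cartanD = -∑ k, TensorProduct.map
      (LinearMap.mulLeft ℝ (SymmetricAlgebra.ι ℝ _ ((Module.finBasis ℝ 𝔤).coord k)))
      LinearMap.id ∘ₗ op.cartanLie (Module.finBasis ℝ 𝔤 k) := TensorProduct.ext' fun s a => by
    have h1 : ∑ k, ∑ l, (SymmetricAlgebra.ι ℝ _ ((Module.finBasis ℝ 𝔤).coord l) *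
        (SymmetricAlgebra.ι ℝ _ ((Module.finBasis ℝ 𝔤).coord k) * s)) ⊗ₜ[ℝ]
          op.contr (Module.finBasis ℝ 𝔤 l) (op.contr (Module.finBasis ℝ 𝔤 k) a) = 0 := by
      refine eq_zero_of_eq_neg ?_
      conv_lhs => rw [Finset.sum_comm]
      rw [← Finset.sum_neg_distrib]
      refine Finset.sum_congr rfl fun k _ => ?_
      rw [← Finset.sum_neg_distrib]
      refine Finset.sum_congr rfl fun l _ => ?_
      rw [eq_neg_of_add_eq_zero_left (op.contr_contr _ _ a), TensorProduct.tmul_neg,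
        mul_left_comm]
    have h2 : ∑ k, (SymmetricAlgebra.ι ℝ _ ((Module.finBasis ℝ 𝔤).coord k) *
        symDeriv (WeilAlgebra.coad (Module.finBasis ℝ 𝔤 k)) s) ⊗ₜ[ℝ] a = 0 := by
      rw [← TensorProduct.sum_tmul, sum_ι_mul_symDeriv_coad, TensorProduct.zero_tmul]
    simp only [LinearMap.comp_apply, LinearMap.neg_apply, LinearMap.sum_apply, cartanD_tmul,
      cartanLie_tmul, map_add, map_sub, map_sum, op.d_d, TensorProduct.tmul_zero,
      TensorProduct.map_tmul, LinearMap.mulLeft_apply, LinearMap.id_apply, Finset.sum_add_distrib,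
      Finset.sum_sub_distrib, h1, h2, ← op.cartan, TensorProduct.tmul_add]
    abel
  simpa [LinearMap.sum_apply] using DFunLike.congr_fun this x

variable {op} in
theorem cartanD_cartanD_of_invariant {x : SymmetricAlgebra ℝ (Module.Dual ℝ 𝔤) ⊗[ℝ] A}
    (hx : ∀ X, op.cartanLie X x = 0) : op.cartanD (op.cartanD x) = 0 := by
  rw [cartanD_cartanD, Finset.sum_eq_zero fun k _ => by rw [hx, map_zero], neg_zero]

end CartanComplex

end LieOperation

/-! ### Invariant connections and the homotopy operator -/

theorem dual_eq_sum_coord {V κ : Type*} [AddCommGroup V] [Module ℝ V] [Fintype κ]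
    (b : Module.Basis κ ℝ V) (ξ : Module.Dual ℝ V) : ξ = ∑ k, ξ (b k) • b.coord k :=
  LinearMap.ext fun X => (map_eq_sum_coord b ξ X).trans (by
    rw [LinearMap.sum_apply]
    exact Finset.sum_congr rfl fun k _ => mul_comm _ _)

namespace SymmetricAlgebra

/-- Polynomial functions pulled back along `f` are constant along the kernel of `f`. -/
theorem partialDeriv_map_eq_zero {V W : Type*} [AddCommGroup V] [Module ℝ V] [AddCommGroup W]
    [Module ℝ W] {f : V →ₗ[ℝ] W} {X : V} (hX : f X = 0)
    (s : SymmetricAlgebra ℝ (Module.Dual ℝ W)) : partialDeriv X (map f.dualMap s) = 0 := by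
  induction s using SymmetricAlgebra.induction with
  | algebraMap r =>
    rw [AlgHom.commutes, Algebra.algebraMap_eq_smul_one, map_smul,
      derivation_one (partialDeriv_mul X), smul_zero]
  | ι ξ =>
    rw [map_ι, partialDeriv_ι, LinearMap.dualMap_apply, hX, map_zero, map_zero]
  | mul x y hx hy => rw [map_mul, partialDeriv_mul, hx, hy, zero_mul, mul_zero, add_zero]
  | add x y hx hy => rw [map_add, map_add, hx, hy, add_zero]

end SymmetricAlgebra

namespace LieOperation

variable {𝔤 A : Type*} [LieRing 𝔤] [LieAlgebra ℝ 𝔤] [Ring A] [Algebra ℝ A]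
  (op : LieOperation 𝔤 A) (𝔫 : LieIdeal ℝ 𝔤)

/-- The restriction of `ad X` to an ideal. -/
def adIdeal (X : 𝔤) : 𝔫 →ₗ[ℝ] 𝔫 :=
  (LieAlgebra.ad ℝ 𝔤 X).restrict (p := 𝔫.toSubmodule) (q := 𝔫.toSubmodule)
    fun _ hY => 𝔫.lie_mem hY

theorem coe_adIdeal (X : 𝔤) (Y : 𝔫) : (adIdeal 𝔫 X Y : 𝔤) = ⁅X, (Y : 𝔤)⁆ := rfl

/-- An infinitesimal connection along an ideal `𝔫`, invariant under the whole Lie algebra `𝔤`: the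
connection form is given by its components `θ(ξ)`, `ξ ∈ 𝔫*`, and the curvature form by its
components `F(ξ)`.  The structure equation says that `dθ - F` is quadratic in `θ`. -/
structure InvariantConnection where
  form : Module.Dual ℝ 𝔫 →ₗ[ℝ] A
  curvature : Module.Dual ℝ 𝔫 →ₗ[ℝ] A
  form_mem : ∀ ξ, form ξ ∈ op.deg 1
  contr_form : ∀ (X : 𝔫) ξ, op.contr (X : 𝔤) (form ξ) = ξ X • 1
  contr_curvature : ∀ (X : 𝔫) ξ, op.contr (X : 𝔤) (curvature ξ) = 0
  d_form : ∀ ξ, op.d (form ξ) - curvature ξ ∈ LinearMap.range form * LinearMap.range form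
  lie_form : ∀ (X : 𝔤) ξ, op.lie X (form ξ) = -form (ξ ∘ₗ adIdeal 𝔫 X)

/-- The subalgebra of the elements that are annihilated by the contractions along an ideal. -/
def horizontalSubalgebra : Subalgebra ℝ A where
  carrier := {a | ∀ X ∈ 𝔫, op.contr X a = 0}
  mul_mem' ha hb X hX := op.contr_mul_eq_zero X (ha X hX) (hb X hX)
  add_mem' ha hb X hX := by rw [map_add, ha X hX, hb X hX, add_zero]
  algebraMap_mem' r X _ := by
    rw [Algebra.algebraMap_eq_smul_one, map_smul, op.contr_one, smul_zero]

/-- The image of `S(𝔤/𝔫)* ⊗ A_hor` in `S𝔤* ⊗ A`, where `A_hor` is the subalgebra annihilated by the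
contractions along `𝔫`. -/
def cartanReduced : Subalgebra ℝ (SymmetricAlgebra ℝ (Module.Dual ℝ 𝔤) ⊗[ℝ] A) :=
  (Algebra.TensorProduct.map
    (SymmetricAlgebra.map (𝔫.toSubmodule.mkQ : 𝔤 →ₗ[ℝ] 𝔤 ⧸ 𝔫.toSubmodule).dualMap)
    (op.horizontalSubalgebra 𝔫).val).range

variable {op 𝔫} in
theorem tmul_mem_cartanReduced {ξ : Module.Dual ℝ 𝔤} (hξ : ∀ X ∈ 𝔫, ξ X = 0) {a : A}
    (ha : a ∈ op.horizontalSubalgebra 𝔫) :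
    SymmetricAlgebra.ι ℝ _ ξ ⊗ₜ[ℝ] a ∈ op.cartanReduced 𝔫 := by
  refine ⟨SymmetricAlgebra.ι ℝ _ (𝔫.toSubmodule.liftQ ξ hξ) ⊗ₜ ⟨a, ha⟩, ?_⟩
  refine (Algebra.TensorProduct.map_tmul _ _ _ _).trans ?_
  rw [SymmetricAlgebra.map_ι]
  congr 2

variable {op 𝔫} in
theorem one_tmul_mem_cartanReduced {a : A} (ha : a ∈ op.horizontalSubalgebra 𝔫) :
    1 ⊗ₜ[ℝ] a ∈ op.cartanReduced 𝔫 :=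
  ⟨1 ⊗ₜ ⟨a, ha⟩, (Algebra.TensorProduct.map_tmul _ _ _ _).trans (by rw [map_one]; rfl)⟩

namespace InvariantConnection

variable {op 𝔫} (θ : op.InvariantConnection 𝔫)

theorem d_form_mul (ξ : Module.Dual ℝ 𝔫) (a : A) :
    op.d (θ.form ξ * a) = op.d (θ.form ξ) * a - θ.form ξ * op.d a := by
  rw [op.d_mul (θ.form_mem ξ), zpow_one, neg_one_smul, sub_eq_add_neg]

theorem contr_form_mul (X : 𝔤) (ξ : Module.Dual ℝ 𝔫) (a : A) :
    op.contr X (θ.form ξ * a) = op.contr X (θ.form ξ) * a - θ.form ξ * op.contr X a := by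
  rw [op.contr_mul X (θ.form_mem ξ), zpow_one, neg_one_smul, sub_eq_add_neg]

/-- The components of `I_X θ` are annihilated by the contractions along `𝔫`. -/
theorem contr_contr_form (X : 𝔤) {Y : 𝔤} (hY : Y ∈ 𝔫) (ξ : Module.Dual ℝ 𝔫) :
    op.contr Y (op.contr X (θ.form ξ)) = 0 := by
  have h := op.contr_contr Y X (θ.form ξ)
  rwa [θ.contr_form ⟨Y, hY⟩, map_smul, op.contr_one, smul_zero, add_zero] at h

variable [Module.Finite ℝ 𝔤]

/-- The homotopy operator `∑ ∂ᵢ ⊗ θⁱ` of the Cartan model, where `i` runs through a basis of `𝔫`. -/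
def homotopy : SymmetricAlgebra ℝ (Module.Dual ℝ 𝔤) ⊗[ℝ] A →ₗ[ℝ]
    SymmetricAlgebra ℝ (Module.Dual ℝ 𝔤) ⊗[ℝ] A :=
  ∑ i, TensorProduct.map (SymmetricAlgebra.partialDeriv (Module.finBasis ℝ 𝔫 i : 𝔤))
    (LinearMap.mulLeft ℝ (θ.form ((Module.finBasis ℝ 𝔫).coord i)))

/-- The anticommutator of the Cartan differential and the homotopy operator.  On invariant elements
it is chain homotopic to zero. -/
def laplacian : Module.End ℝ (SymmetricAlgebra ℝ (Module.Dual ℝ 𝔤) ⊗[ℝ] A) :=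
  op.cartanD ∘ₗ θ.homotopy + θ.homotopy ∘ₗ op.cartanD

theorem homotopy_tmul (s : SymmetricAlgebra ℝ (Module.Dual ℝ 𝔤)) (a : A) :
    θ.homotopy (s ⊗ₜ a) =
      ∑ i, SymmetricAlgebra.partialDeriv (Module.finBasis ℝ 𝔫 i : 𝔤) s ⊗ₜ
        (θ.form ((Module.finBasis ℝ 𝔫).coord i) * a) := by
  simp only [homotopy, LinearMap.sum_apply, TensorProduct.map_tmul, LinearMap.mulLeft_apply]

theorem laplacian_apply (x : SymmetricAlgebra ℝ (Module.Dual ℝ 𝔤) ⊗[ℝ] A) :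
    θ.laplacian x = op.cartanD (θ.homotopy x) + θ.homotopy (op.cartanD x) := rfl

theorem laplacian_tmul (s : SymmetricAlgebra ℝ (Module.Dual ℝ 𝔤)) (a : A) :
    θ.laplacian (s ⊗ₜ a) =
      ∑ i, (SymmetricAlgebra.partialDeriv (Module.finBasis ℝ 𝔫 i : 𝔤) s ⊗ₜ
          (op.d (θ.form ((Module.finBasis ℝ 𝔫).coord i)) * a) -
        (∑ k, (SymmetricAlgebra.ι ℝ _ ((Module.finBasis ℝ 𝔤).coord k) *
            SymmetricAlgebra.partialDeriv (Module.finBasis ℝ 𝔫 i : 𝔤) s) ⊗ₜ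
          (op.contr (Module.finBasis ℝ 𝔤 k) (θ.form ((Module.finBasis ℝ 𝔫).coord i)) * a)) -
        s ⊗ₜ (θ.form ((Module.finBasis ℝ 𝔫).coord i) *
          op.contr (Module.finBasis ℝ 𝔫 i : 𝔤) a)) := by
  have h : ∀ i, s ⊗ₜ[ℝ] (θ.form ((Module.finBasis ℝ 𝔫).coord i) *
      op.contr (Module.finBasis ℝ 𝔫 i : 𝔤) a) =
        ∑ k, (SymmetricAlgebra.partialDeriv (Module.finBasis ℝ 𝔫 i : 𝔤)
          (SymmetricAlgebra.ι ℝ _ ((Module.finBasis ℝ 𝔤).coord k)) * s) ⊗ₜ[ℝ]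
            (θ.form ((Module.finBasis ℝ 𝔫).coord i) * op.contr (Module.finBasis ℝ 𝔤 k) a) :=
    fun i => by
      have h1 := map_eq_sum_coord (Module.finBasis ℝ 𝔤) (LinearMap.applyₗ a ∘ₗ op.contr)
        (Module.finBasis ℝ 𝔫 i : 𝔤)
      simp only [LinearMap.comp_apply, LinearMap.applyₗ_apply_apply] at h1
      rw [h1, Finset.mul_sum, TensorProduct.tmul_sum]
      refine Finset.sum_congr rfl fun k _ => ?_
      rw [SymmetricAlgebra.partialDeriv_ι, ← Algebra.smul_def, mul_smul_comm,
        TensorProduct.tmul_smul, TensorProduct.smul_tmul']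
  simp only [laplacian_apply, homotopy_tmul, cartanD_tmul, map_sum, map_sub, d_form_mul,
    contr_form_mul, TensorProduct.tmul_sub, SymmetricAlgebra.partialDeriv_mul,
    TensorProduct.add_tmul, Finset.sum_add_distrib, Finset.sum_sub_distrib, h]
  rw [Finset.sum_comm (γ := Fin (Module.finrank ℝ 𝔤))]
  conv_lhs => enter [2, 2, 2]; rw [Finset.sum_comm]
  abel

theorem laplacian_eq_sum : θ.laplacian =
      ∑ i, (TensorProduct.map (SymmetricAlgebra.partialDeriv (Module.finBasis ℝ 𝔫 i : 𝔤))
          (LinearMap.mulLeft ℝ (op.d (θ.form ((Module.finBasis ℝ 𝔫).coord i)))) -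
        (∑ k, TensorProduct.map
          (LinearMap.mulLeft ℝ (SymmetricAlgebra.ι ℝ _ ((Module.finBasis ℝ 𝔤).coord k)) ∘ₗ
            SymmetricAlgebra.partialDeriv (Module.finBasis ℝ 𝔫 i : 𝔤))
          (LinearMap.mulLeft ℝ
            (op.contr (Module.finBasis ℝ 𝔤 k) (θ.form ((Module.finBasis ℝ 𝔫).coord i))))) -
        TensorProduct.map LinearMap.id
          (LinearMap.mulLeft ℝ (θ.form ((Module.finBasis ℝ 𝔫).coord i)) ∘ₗ
            op.contr (Module.finBasis ℝ 𝔫 i : 𝔤))) :=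
  TensorProduct.ext' fun s a => by
    simp only [laplacian_tmul, LinearMap.sum_apply, LinearMap.sub_apply, TensorProduct.map_tmul,
      LinearMap.mulLeft_apply, LinearMap.comp_apply, LinearMap.id_apply]

/-- The operator `θ.laplacian` is a derivation of the algebra `S𝔤* ⊗ A`. By `laplacian_eq_sum` it
is a sum of three kinds of terms: the first two multiply by the elements `dθⁱ` and `I_k θⁱ`,
which have even degree and so are central, and the third involves the even derivations `θⁱ Iᵢ` of
`A`. -/
theorem laplacian_mul (x y : SymmetricAlgebra ℝ (Module.Dual ℝ 𝔤) ⊗[ℝ] A) :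
    θ.laplacian (x * y) = θ.laplacian x * y + x * θ.laplacian y := by
  have h1 : ∀ i, ∀ a, op.d (θ.form ((Module.finBasis ℝ 𝔫).coord i)) * a =
      a * op.d (θ.form ((Module.finBasis ℝ 𝔫).coord i)) := fun i =>
    mul_comm_of_even (p := 1 + 1) (by decide) (op.d_mem (θ.form_mem _))
  have h2 : ∀ X i, ∀ a, op.contr X (θ.form ((Module.finBasis ℝ 𝔫).coord i)) * a =
      a * op.contr X (θ.form ((Module.finBasis ℝ 𝔫).coord i)) := fun X i =>
    mul_comm_of_even (p := 1 - 1) (by decide) (op.contr_mem X (θ.form_mem _))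
  simp only [laplacian_eq_sum, LinearMap.sum_apply, LinearMap.sub_apply, Finset.sum_mul,
    Finset.mul_sum, ← Finset.sum_add_distrib]
  refine Finset.sum_congr rfl fun i _ => ?_
  rw [tensor_derivation (SymmetricAlgebra.partialDeriv_mul _) (h1 i),
    tensor_derivation_right (fun a b => op.mul_contr_mul (θ.form_mem _) _ a b),
    Finset.sum_congr rfl fun k _ => tensor_derivation (δ := LinearMap.mulLeft ℝ
      (SymmetricAlgebra.ι ℝ _ ((Module.finBasis ℝ 𝔤).coord k)) ∘ₗ
        SymmetricAlgebra.partialDeriv (Module.finBasis ℝ 𝔫 i : 𝔤)) (fun s t => by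
      simp only [LinearMap.comp_apply, LinearMap.mulLeft_apply,
        SymmetricAlgebra.partialDeriv_mul]
      ring) (h2 _ i) x y]
  simp only [Finset.sum_add_distrib, sub_mul, mul_sub, Finset.sum_mul, Finset.mul_sum]
  abel

theorem laplacian_eq_zero {x : SymmetricAlgebra ℝ (Module.Dual ℝ 𝔤) ⊗[ℝ] A}
    (hx : x ∈ op.cartanReduced 𝔫) : θ.laplacian x = 0 := by
  obtain ⟨y, rfl⟩ := hx
  induction y using TensorProduct.induction_on with
  | zero => simp
  | add x y hx hy =>
    rw [map_add (Algebra.TensorProduct.map _ _ : _ →ₐ[ℝ] _).toRingHom, map_add, hx, hy, add_zero]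
  | tmul s a =>
    have h : ∀ i, op.contr (Module.finBasis ℝ 𝔫 i : 𝔤) (a : A) = 0 :=
      fun i => a.2 _ (Subtype.prop _)
    have h' : ∀ i, SymmetricAlgebra.partialDeriv (Module.finBasis ℝ 𝔫 i : 𝔤)
        (SymmetricAlgebra.map (𝔫.toSubmodule.mkQ : 𝔤 →ₗ[ℝ] 𝔤 ⧸ 𝔫.toSubmodule).dualMap s) = 0 :=
      fun i => SymmetricAlgebra.partialDeriv_map_eq_zero
        ((Submodule.Quotient.mk_eq_zero _).2 (Subtype.prop _)) s
    refine (θ.laplacian_tmul _ _).trans (Finset.sum_eq_zero fun i _ => ?_)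
    simp [h, h']

theorem laplacian_one_tmul (a : A) : θ.laplacian (1 ⊗ₜ a) =
    (-1 : ℝ) • (1 ⊗ₜ ∑ i, θ.form ((Module.finBasis ℝ 𝔫).coord i) *
      op.contr (Module.finBasis ℝ 𝔫 i : 𝔤) a) := by
  rw [laplacian_tmul, TensorProduct.tmul_sum, Finset.smul_sum]
  refine Finset.sum_congr rfl fun i _ => ?_
  simp [SymmetricAlgebra.derivation_one (SymmetricAlgebra.partialDeriv_mul _)]

theorem laplacian_one_tmul_form (ξ : Module.Dual ℝ 𝔫) :
    θ.laplacian (1 ⊗ₜ θ.form ξ) = (-1 : ℝ) • (1 ⊗ₜ θ.form ξ) := by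
  rw [laplacian_one_tmul]
  have : θ.form ξ = ∑ i, θ.form ((Module.finBasis ℝ 𝔫).coord i) *
      op.contr (Module.finBasis ℝ 𝔫 i : 𝔤) (θ.form ξ) := by
    simp only [contr_form, mul_smul_comm, mul_one]
    conv_lhs => rw [dual_eq_sum_coord (Module.finBasis ℝ 𝔫) ξ, map_sum]
    simp only [map_smul]
  rw [← this]

theorem mul_mem_addNegEigenspaces {x y : SymmetricAlgebra ℝ (Module.Dual ℝ 𝔤) ⊗[ℝ] A}
    (hx : x ∈ addNegEigenspaces θ.laplacian (op.cartanReduced 𝔫))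
    (hy : y ∈ addNegEigenspaces θ.laplacian (op.cartanReduced 𝔫)) :
    x * y ∈ addNegEigenspaces θ.laplacian (op.cartanReduced 𝔫) :=
  _root_.mul_mem_addNegEigenspaces θ.laplacian_mul (fun _ => θ.laplacian_eq_zero) hx hy

theorem one_tmul_form_mem (ξ : Module.Dual ℝ 𝔫) :
    (1 : SymmetricAlgebra ℝ (Module.Dual ℝ 𝔤)) ⊗ₜ[ℝ] θ.form ξ ∈
      addNegEigenspaces θ.laplacian (op.cartanReduced 𝔫) :=
  mem_addNegEigenspaces_of_eigen 0 (by rw [laplacian_one_tmul_form, Nat.cast_zero, zero_add])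

/-- The algebra `A` is generated by the components of the connection form and the elements
annihilated by the contractions along `𝔫`: in `a = (a - θᵏ I_k a) + θᵏ I_k a`, the elements
`a - θᵏ I_k a` and `I_k a` are annihilated by `I_k`, and also by every other contraction along a
basis element of `𝔫` that annihilates `a`. -/
theorem one_tmul_mem (a : A) : (1 : SymmetricAlgebra ℝ (Module.Dual ℝ 𝔤)) ⊗ₜ[ℝ] a ∈
    addNegEigenspaces θ.laplacian (op.cartanReduced 𝔫) := by
  set b := Module.finBasis ℝ 𝔫
  -- It suffices to consider elements annihilated by the contractions of a list of basis elements;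
  -- by induction on the list, one condition is imposed at a time.
  have key : ∀ l : List (Fin (Module.finrank ℝ 𝔫)),
      (∀ a : A, (∀ k ∈ l, op.contr (b k : 𝔤) a = 0) →
        (1 : SymmetricAlgebra ℝ (Module.Dual ℝ 𝔤)) ⊗ₜ[ℝ] a ∈
          addNegEigenspaces θ.laplacian (op.cartanReduced 𝔫)) → ∀ a : A,
      (1 : SymmetricAlgebra ℝ (Module.Dual ℝ 𝔤)) ⊗ₜ[ℝ] a ∈
        addNegEigenspaces θ.laplacian (op.cartanReduced 𝔫) := by
    intro l
    induction l with
    | nil => exact fun h a => h a fun k hk => absurd hk List.not_mem_nil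
    | cons k l ih =>
      refine fun H => ih fun a ha => ?_
      have hcc : ∀ j ∈ k :: l, op.contr (b j : 𝔤) (op.contr (b k : 𝔤) a) = 0 := fun j hj => by
        rcases List.mem_cons.1 hj with rfl | hj
        · exact eq_zero_of_eq_neg (eq_neg_of_add_eq_zero_left (op.contr_contr _ _ a))
        · rw [eq_neg_of_add_eq_zero_left (op.contr_contr _ _ a), ha j hj, map_zero, neg_zero]
      have h1 := H (op.contr (b k : 𝔤) a) hcc
      have h2 := H (a - θ.form (b.coord k) * op.contr (b k : 𝔤) a) fun j hj => by
        rw [map_sub, contr_form_mul, hcc j hj, mul_zero, sub_zero, contr_form, smul_one_mul]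
        by_cases hjk : j = k
        · subst hjk
          simp
        · rw [ha j ((List.mem_cons.1 hj).resolve_left hjk)]
          simp [hjk]
      have h3 := θ.mul_mem_addNegEigenspaces (θ.one_tmul_form_mem (b.coord k)) h1
      rw [Algebra.TensorProduct.tmul_mul_tmul, one_mul] at h3
      have h4 := add_mem h2 h3
      rwa [← TensorProduct.tmul_add, sub_add_cancel] at h4
  refine key (List.finRange _) (fun a ha => ?_) a
  refine mem_addNegEigenspaces_of_mem (one_tmul_mem_cartanReduced fun X hX => ?_)
  have h := map_eq_sum_coord b (LinearMap.applyₗ a ∘ₗ op.contr ∘ₗ 𝔫.toSubmodule.subtype) ⟨X, hX⟩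
  refine h.trans (Finset.sum_eq_zero fun k _ => ?_)
  have hk : (LinearMap.applyₗ a ∘ₗ op.contr ∘ₗ 𝔫.toSubmodule.subtype) (b k) = 0 :=
    ha k (List.mem_finRange k)
  rw [hk, smul_zero]

theorem laplacian_one_tmul_of_quadratic {ν : A}
    (hν : ν ∈ LinearMap.range θ.form * LinearMap.range θ.form) :
    θ.laplacian (1 ⊗ₜ ν) = (-2 : ℝ) • (1 ⊗ₜ ν) := by
  induction hν using Submodule.mul_induction_on' with
  | mem_mul_mem a ha b hb =>
    obtain ⟨ξ, rfl⟩ := ha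
    obtain ⟨η, rfl⟩ := hb
    have h : (1 : SymmetricAlgebra ℝ (Module.Dual ℝ 𝔤)) ⊗ₜ[ℝ] (θ.form ξ * θ.form η) =
        (1 ⊗ₜ θ.form ξ) * (1 ⊗ₜ θ.form η) := by
      rw [Algebra.TensorProduct.tmul_mul_tmul, one_mul]
    rw [h, laplacian_mul, laplacian_one_tmul_form, laplacian_one_tmul_form, smul_mul_assoc,
      mul_smul_comm, ← add_smul]
    congr 1
    norm_num
  | add a _ b _ ha hb => rw [TensorProduct.tmul_add, map_add, ha, hb, smul_add]

/-- For a form `η` on `𝔫` extended to `𝔤` by a retraction `p`, the generator `Ω^{η ∘ p}` is the sum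
of elements in the kernel and in eigenspaces for the eigenvalues `-1` and `-2`.  With the curvature
`F`, the quadratic part `ν = dθ - F` and `∑ Ωᵏ I_k θ = Ω + m`, one has `D Ω = F + ν - Ω - m`, where
`D F = D m = 0` and `D ν = -2 ν`.  Hence `D` acts on `Ω - (F - m) + ν` as `-1`. -/
theorem ι_retraction_tmul_mem (η : Module.Dual ℝ 𝔫) {p : 𝔤 →ₗ[ℝ] 𝔫} (hp : ∀ Y : 𝔫, p Y = Y) :
    SymmetricAlgebra.ι ℝ _ (η ∘ₗ p) ⊗ₜ[ℝ] (1 : A) ∈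
      addNegEigenspaces θ.laplacian (op.cartanReduced 𝔫) := by
  set b := Module.finBasis ℝ 𝔫 with hb
  set e := Module.finBasis ℝ 𝔤 with he
  let Ω := SymmetricAlgebra.ι ℝ (Module.Dual ℝ 𝔤)
  let T : 𝔤 →ₗ[ℝ] 𝔤 := LinearMap.id - 𝔫.toSubmodule.subtype ∘ₗ p
  set m := ∑ k, Ω (e.coord k ∘ₗ T) ⊗ₜ[ℝ] op.contr (e k) (θ.form η) with hm
  set ν := op.d (θ.form η) - θ.curvature η with hν
  have hη : η = ∑ i, η (b i) • b.coord i := dual_eq_sum_coord b η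
  have hsum : ∑ k, Ω (e.coord k) ⊗ₜ[ℝ] op.contr (e k) (θ.form η) =
      Ω (η ∘ₗ p) ⊗ₜ[ℝ] (1 : A) + m := by
    let B : 𝔤 →ₗ[ℝ] Module.Dual ℝ 𝔤 →ₗ[ℝ] SymmetricAlgebra ℝ (Module.Dual ℝ 𝔤) ⊗[ℝ] A :=
      LinearMap.mk₂ ℝ (fun Z ξ => Ω ξ ⊗ₜ[ℝ] op.contr Z (θ.form η))
        (by intros; simp [TensorProduct.tmul_add]) (by intros; simp)
        (by intros; simp [TensorProduct.add_tmul])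
        (by intros; simp [TensorProduct.smul_tmul'])
    have h1 : ∑ k, Ω (e.coord k) ⊗ₜ[ℝ] op.contr (T (e k)) (θ.form η) = m :=
      sum_basis_transpose e e T B
    have h2 : η ∘ₗ p = ∑ k, η (p (e k)) • e.coord k := dual_eq_sum_coord e (η ∘ₗ p)
    rw [← h1, h2, map_sum, TensorProduct.sum_tmul, ← Finset.sum_add_distrib]
    refine Finset.sum_congr rfl fun k _ => ?_
    have h3 : op.contr (T (e k)) (θ.form η) =
        op.contr (e k) (θ.form η) - η (p (e k)) • 1 := by
      rw [← θ.contr_form]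
      exact LinearMap.map_sub₂ op.contr _ _ _
    rw [h3, map_smul, ← TensorProduct.smul_tmul', TensorProduct.tmul_sub,
      TensorProduct.tmul_smul, add_sub_cancel]
  have hlap : θ.laplacian (Ω (η ∘ₗ p) ⊗ₜ[ℝ] (1 : A)) =
      1 ⊗ₜ op.d (θ.form η) - (Ω (η ∘ₗ p) ⊗ₜ[ℝ] (1 : A) + m) := by
    rw [← hsum, laplacian_tmul]
    conv_rhs => rw [hη]
    simp only [map_sum, map_smul, TensorProduct.tmul_sum, TensorProduct.tmul_smul]
    rw [Finset.sum_comm, ← Finset.sum_sub_distrib]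
    refine Finset.sum_congr rfl fun i _ => ?_
    simp only [Ω, SymmetricAlgebra.partialDeriv_ι, LinearMap.comp_apply, hp, mul_one, op.contr_one,
      mul_zero, TensorProduct.tmul_zero, sub_zero, Algebra.algebraMap_eq_smul_one,
      mul_smul_comm, ← TensorProduct.smul_tmul', ← hb, ← he]
  have hmM : m ∈ op.cartanReduced 𝔫 := sum_mem fun k _ =>
    tmul_mem_cartanReduced (fun X hX => by simp [T, hp ⟨X, hX⟩])
      fun Y hY => θ.contr_contr_form _ hY _
  have hFM : (1 : SymmetricAlgebra ℝ (Module.Dual ℝ 𝔤)) ⊗ₜ[ℝ] θ.curvature η ∈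
      op.cartanReduced 𝔫 :=
    one_tmul_mem_cartanReduced fun X hX => θ.contr_curvature ⟨X, hX⟩ η
  have hlν : θ.laplacian (1 ⊗ₜ ν) = (-2 : ℝ) • (1 ⊗ₜ ν) :=
    θ.laplacian_one_tmul_of_quadratic (θ.d_form η)
  have hd : op.d (θ.form η) = θ.curvature η + ν := by rw [hν]; abel
  have hv : Ω (η ∘ₗ p) ⊗ₜ[ℝ] (1 : A) - (1 ⊗ₜ θ.curvature η - m) + 1 ⊗ₜ ν ∈
      addNegEigenspaces θ.laplacian (op.cartanReduced 𝔫) := by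
    refine mem_addNegEigenspaces_of_eigen 0 ?_
    rw [map_add, map_sub, map_sub, θ.laplacian_eq_zero hmM, θ.laplacian_eq_zero hFM, hlap, hlν, hd,
      TensorProduct.tmul_add, Nat.cast_zero]
    module
  have hν' : (1 : SymmetricAlgebra ℝ (Module.Dual ℝ 𝔤)) ⊗ₜ[ℝ] ν ∈
      addNegEigenspaces θ.laplacian (op.cartanReduced 𝔫) :=
    mem_addNegEigenspaces_of_eigen 1 (by rw [hlν]; norm_num)
  have h := sub_mem (add_mem hv (sub_mem (mem_addNegEigenspaces_of_mem hFM)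
    (mem_addNegEigenspaces_of_mem hmM))) hν'
  rwa [add_right_comm, sub_add_cancel, add_sub_cancel_right] at h

theorem ι_tmul_one_mem (ξ : Module.Dual ℝ 𝔤) :
    SymmetricAlgebra.ι ℝ _ ξ ⊗ₜ[ℝ] (1 : A) ∈
      addNegEigenspaces θ.laplacian (op.cartanReduced 𝔫) := by
  obtain ⟨p, hp⟩ := 𝔫.toSubmodule.subtype.exists_leftInverse_of_injective
    (LinearMap.ker_eq_bot.2 Subtype.val_injective)
  have hp' : ∀ Y : 𝔫, p Y = Y := fun Y => DFunLike.congr_fun hp Y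
  have h1 := θ.ι_retraction_tmul_mem (ξ ∘ₗ 𝔫.toSubmodule.subtype) hp'
  have h2 : SymmetricAlgebra.ι ℝ _ (ξ - (ξ ∘ₗ 𝔫.toSubmodule.subtype) ∘ₗ p) ⊗ₜ[ℝ] (1 : A) ∈
      op.cartanReduced 𝔫 :=
    tmul_mem_cartanReduced (fun X hX => by
      have : p X = ⟨X, hX⟩ := hp' ⟨X, hX⟩
      simp [this]) fun X _ => op.contr_one X
  have h := add_mem (mem_addNegEigenspaces_of_mem (D := θ.laplacian) h2) h1
  rwa [← TensorProduct.add_tmul, ← map_add, sub_add_cancel] at h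

/-- The Cartan model is the sum of the eigenspaces of `θ.laplacian` for the eigenvalues
`0, -1, -2, …`, and the kernel is the image of `S(𝔤/𝔫)* ⊗ A_hor`. -/
theorem addNegEigenspaces_eq_top :
    addNegEigenspaces θ.laplacian (op.cartanReduced 𝔫) = ⊤ := by
  rw [eq_top_iff]
  rintro x -
  induction x using TensorProduct.induction_on with
  | zero => exact zero_mem _
  | add x y hx hy => exact add_mem hx hy
  | tmul s a =>
    have hs : s ⊗ₜ[ℝ] (1 : A) ∈ addNegEigenspaces θ.laplacian (op.cartanReduced 𝔫) := by
      induction s using SymmetricAlgebra.induction with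
      | algebraMap r =>
        rw [Algebra.algebraMap_eq_smul_one, ← TensorProduct.smul_tmul']
        exact Submodule.smul_mem _ r (θ.one_tmul_mem 1)
      | ι ξ => exact θ.ι_tmul_one_mem ξ
      | mul x y hx hy =>
        have h := θ.mul_mem_addNegEigenspaces hx hy
        rwa [Algebra.TensorProduct.tmul_mul_tmul, one_mul] at h
      | add x y hx hy =>
        rw [TensorProduct.add_tmul]
        exact add_mem hx hy
    have h := θ.mul_mem_addNegEigenspaces hs (θ.one_tmul_mem a)
    rwa [Algebra.TensorProduct.tmul_mul_tmul, one_mul, mul_one] at h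

end InvariantConnection

end LieOperation

/-! ### The homotopy operator on invariant elements -/

theorem Module.End.aeval_mem {V : Type*} [AddCommGroup V] [Module ℝ V] {D : Module.End ℝ V}
    {p : Submodule ℝ V} (hp : ∀ x ∈ p, D x ∈ p) (q : Polynomial ℝ) {x : V} (hx : x ∈ p) :
    Polynomial.aeval D q x ∈ p := by
  induction q using Polynomial.induction_on generalizing x with
  | C r =>
    rw [Polynomial.aeval_C, Module.algebraMap_end_apply]
    exact p.smul_mem r hx
  | add q r hq hr =>
    rw [map_add, LinearMap.add_apply]
    exact p.add_mem (hq hx) (hr hx)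
  | monomial k r ih =>
    rw [pow_succ, ← mul_assoc, map_mul, Polynomial.aeval_X, Module.End.mul_apply]
    exact ih (hp x hx)

namespace LieOperation

variable {𝔤 A : Type*} [LieRing 𝔤] [LieAlgebra ℝ 𝔤] [Ring A] [Algebra ℝ A]
  (op : LieOperation 𝔤 A)

/-- The degree `n` part of the Cartan complex: the invariant elements of degree `n` of `S𝔤* ⊗ A`. -/
def cartanInvariant (n : ℤ) : Submodule ℝ (SymmetricAlgebra ℝ (Module.Dual ℝ 𝔤) ⊗[ℝ] A) :=
  (⨅ X : 𝔤, LinearMap.ker (op.cartanLie X)) ⊓ Module.End.eigenspace op.cartanEuler (n : ℝ)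

variable {op}

theorem mem_cartanInvariant_iff {n : ℤ} {x : SymmetricAlgebra ℝ (Module.Dual ℝ 𝔤) ⊗[ℝ] A} :
    x ∈ op.cartanInvariant n ↔ (∀ X, op.cartanLie X x = 0) ∧ op.cartanEuler x = (n : ℝ) • x := by
  simp only [cartanInvariant, Submodule.mem_inf, Submodule.mem_iInf, LinearMap.mem_ker,
    Module.End.mem_eigenspace_iff]

theorem cartanD_mem_cartanInvariant [Module.Finite ℝ 𝔤] {n : ℤ}
    {x : SymmetricAlgebra ℝ (Module.Dual ℝ 𝔤) ⊗[ℝ] A} (hx : x ∈ op.cartanInvariant n) :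
    op.cartanD x ∈ op.cartanInvariant (n + 1) := by
  rw [mem_cartanInvariant_iff] at hx ⊢
  refine ⟨fun X => by rw [cartanLie_cartanD, hx.1, map_zero], ?_⟩
  rw [cartanEuler_cartanD, hx.2, map_smul, Int.cast_add, Int.cast_one, add_smul, one_smul]

variable {𝔫 : LieIdeal ℝ 𝔤} [Module.Finite ℝ 𝔤]

namespace InvariantConnection

variable (θ : op.InvariantConnection 𝔫)

theorem cartanLie_homotopy (X : 𝔤) (x : SymmetricAlgebra ℝ (Module.Dual ℝ 𝔤) ⊗[ℝ] A) :
    op.cartanLie X (θ.homotopy x) = θ.homotopy (op.cartanLie X x) := by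
  have : op.cartanLie X ∘ₗ θ.homotopy = θ.homotopy ∘ₗ op.cartanLie X :=
    TensorProduct.ext' fun s a => by
      set b := Module.finBasis ℝ 𝔫 with hb
      let B : 𝔫 →ₗ[ℝ] Module.Dual ℝ 𝔫 →ₗ[ℝ] SymmetricAlgebra ℝ (Module.Dual ℝ 𝔤) ⊗[ℝ] A :=
        LinearMap.mk₂ ℝ
          (fun Y ξ => SymmetricAlgebra.partialDerivₗ (Y : 𝔤) s ⊗ₜ[ℝ] (θ.form ξ * a))
          (by intros; simp [TensorProduct.add_tmul]) (by intros; simp [TensorProduct.smul_tmul'])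
          (by intros; simp [add_mul, TensorProduct.tmul_add]) (by intros; simp)
      have h : ∑ i, SymmetricAlgebra.partialDeriv ⁅X, (b i : 𝔤)⁆ s ⊗ₜ[ℝ]
          (θ.form (b.coord i) * a) = ∑ i, SymmetricAlgebra.partialDeriv (b i : 𝔤) s ⊗ₜ[ℝ]
          (θ.form (b.coord i ∘ₗ adIdeal 𝔫 X) * a) :=
        sum_basis_transpose b b (adIdeal 𝔫 X) B
      have h1 : ∀ i, symDeriv (WeilAlgebra.coad X) (SymmetricAlgebra.partialDeriv (b i : 𝔤) s) =
          SymmetricAlgebra.partialDeriv (b i : 𝔤) (symDeriv (WeilAlgebra.coad X) s) +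
            SymmetricAlgebra.partialDeriv ⁅X, (b i : 𝔤)⁆ s := fun i => by
        have h2 := SymmetricAlgebra.symDeriv_partialDeriv (-(LieAlgebra.ad ℝ 𝔤 X)) (b i : 𝔤) s
        have h3 : SymmetricAlgebra.partialDeriv ((-(LieAlgebra.ad ℝ 𝔤 X)) (b i : 𝔤)) s =
            -SymmetricAlgebra.partialDeriv ⁅X, (b i : 𝔤)⁆ s :=
          DFunLike.congr_fun (map_neg SymmetricAlgebra.partialDerivₗ ⁅X, (b i : 𝔤)⁆) s
        rw [← WeilAlgebra.coad_eq, h3, neg_neg, sub_eq_iff_eq_add'] at h2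
        exact h2
      simp only [LinearMap.comp_apply, cartanLie_tmul, homotopy_tmul, map_add, map_sum, ← hb, h1,
        op.lie_mul, θ.lie_form, TensorProduct.add_tmul, TensorProduct.tmul_add, neg_mul,
        TensorProduct.tmul_neg, Finset.sum_add_distrib, Finset.sum_neg_distrib, h]
      abel
  exact DFunLike.congr_fun this x

theorem cartanEuler_homotopy (x : SymmetricAlgebra ℝ (Module.Dual ℝ 𝔤) ⊗[ℝ] A) :
    op.cartanEuler (θ.homotopy x) = θ.homotopy (op.cartanEuler x) - θ.homotopy x := by
  have : op.cartanEuler ∘ₗ θ.homotopy = θ.homotopy ∘ₗ op.cartanEuler - θ.homotopy :=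
    TensorProduct.ext' fun s a => by
      have h1 : ∀ X, symDeriv LinearMap.id (SymmetricAlgebra.partialDeriv X s) =
          SymmetricAlgebra.partialDeriv X (symDeriv LinearMap.id s) -
            SymmetricAlgebra.partialDeriv X s := fun X => by
        have h := SymmetricAlgebra.symDeriv_partialDeriv (LinearMap.id : 𝔤 →ₗ[ℝ] 𝔤) X s
        rw [LinearMap.dualMap_id, LinearMap.id_apply, sub_eq_iff_eq_add'] at h
        rw [h, sub_eq_add_neg]
      have h2 : ∀ ξ, op.euler (θ.form ξ * a) = θ.form ξ * op.euler a + θ.form ξ * a := fun ξ => by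
        have h := op.euler_comp_of_degree (LinearMap.mulLeft ℝ (θ.form ξ)) 1
          (fun p a ha => by rw [add_comm]; exact op.mul_mem (θ.form_mem ξ) ha) a
        simpa using h
      simp only [LinearMap.comp_apply, LinearMap.sub_apply, cartanEuler_tmul, homotopy_tmul,
        map_add, map_sum, h1, h2, TensorProduct.sub_tmul, TensorProduct.add_tmul,
        TensorProduct.tmul_add, smul_sub, Finset.sum_add_distrib, Finset.sum_sub_distrib, two_smul]
      abel
  exact DFunLike.congr_fun this x

variable {n : ℤ} {x : SymmetricAlgebra ℝ (Module.Dual ℝ 𝔤) ⊗[ℝ] A}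

theorem homotopy_mem_cartanInvariant (hx : x ∈ op.cartanInvariant n) :
    θ.homotopy x ∈ op.cartanInvariant (n - 1) := by
  rw [mem_cartanInvariant_iff] at hx ⊢
  refine ⟨fun X => by rw [cartanLie_homotopy, hx.1, map_zero], ?_⟩
  rw [cartanEuler_homotopy, hx.2, map_smul, Int.cast_sub, Int.cast_one]
  module

theorem laplacian_mem_cartanInvariant (hx : x ∈ op.cartanInvariant n) :
    θ.laplacian x ∈ op.cartanInvariant n := by
  refine add_mem ?_ ?_
  · simpa using cartanD_mem_cartanInvariant (θ.homotopy_mem_cartanInvariant hx)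
  · simpa using θ.homotopy_mem_cartanInvariant (cartanD_mem_cartanInvariant hx)

theorem cartanD_laplacian (hx : x ∈ op.cartanInvariant n) :
    op.cartanD (θ.laplacian x) = θ.laplacian (op.cartanD x) := by
  rw [laplacian_apply, laplacian_apply, map_add,
    cartanD_cartanD_of_invariant (mem_cartanInvariant_iff.1 (θ.homotopy_mem_cartanInvariant hx)).1,
    cartanD_cartanD_of_invariant (mem_cartanInvariant_iff.1 hx).1, map_zero, zero_add, add_zero]

theorem aeval_laplacian_mem_cartanInvariant (q : Polynomial ℝ) (hx : x ∈ op.cartanInvariant n) :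
    Polynomial.aeval θ.laplacian q x ∈ op.cartanInvariant n :=
  Module.End.aeval_mem (fun _ => θ.laplacian_mem_cartanInvariant) q hx

/-- The Cartan differential commutes with polynomials in `θ.laplacian` on invariant elements, where
its square vanishes. -/
theorem cartanD_aeval_laplacian (q : Polynomial ℝ) (hx : x ∈ op.cartanInvariant n) :
    op.cartanD (Polynomial.aeval θ.laplacian q x) =
      Polynomial.aeval θ.laplacian q (op.cartanD x) := by
  induction q using Polynomial.induction_on generalizing x with
  | C r =>
    rw [Polynomial.aeval_C, Module.algebraMap_end_apply, Module.algebraMap_end_apply, map_smul]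
  | add q r hq hr =>
    rw [map_add, LinearMap.add_apply, LinearMap.add_apply, map_add, hq hx, hr hx]
  | monomial k r ih =>
    rw [pow_succ, ← mul_assoc, map_mul, Polynomial.aeval_X, Module.End.mul_apply,
      Module.End.mul_apply, ih (θ.laplacian_mem_cartanInvariant hx), cartanD_laplacian θ hx]

/-- An invariant element `x` of the Cartan model can be moved into the image of
`S(𝔤/𝔫)* ⊗ A_hor` by adding a coboundary and a term that vanishes if `x` is a cocycle; if `dx`
already lies in that image, then `dx` is not changed.  With `D = θ.laplacian`, the new element is
`x + D q(D) x`, where `q` is a polynomial that depends on `x`. -/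
theorem exists_mem_cartanReduced (θ : op.InvariantConnection 𝔫) (hx : x ∈ op.cartanInvariant n) :
    ∃ w ∈ op.cartanInvariant (n - 1), ∃ x₀ ∈ op.cartanInvariant n, x₀ ∈ op.cartanReduced 𝔫 ∧
      (op.cartanD x = 0 → x₀ = x + op.cartanD w) ∧
      (op.cartanD x ∈ op.cartanReduced 𝔫 → op.cartanD x₀ = op.cartanD x) := by
  obtain ⟨q, hq⟩ := exists_polynomial_of_mem_addNegEigenspaces (fun _ => θ.laplacian_eq_zero)
    (x := x) (by rw [θ.addNegEigenspaces_eq_top]; trivial)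
  have hqx := θ.aeval_laplacian_mem_cartanInvariant q hx
  refine ⟨_, θ.homotopy_mem_cartanInvariant hqx, _,
    add_mem hx (θ.laplacian_mem_cartanInvariant hqx), hq, fun h => ?_, fun h => ?_⟩
  · rw [laplacian_apply, θ.cartanD_aeval_laplacian q hx, h, map_zero, map_zero, add_zero]
  · have hc : θ.laplacian * Polynomial.aeval θ.laplacian q =
        Polynomial.aeval θ.laplacian q * θ.laplacian := by
      simpa using congrArg (Polynomial.aeval θ.laplacian) (mul_comm Polynomial.X q)
    have hc' := DFunLike.congr_fun hc (op.cartanD x)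
    rw [Module.End.mul_apply, Module.End.mul_apply] at hc'
    rw [map_add, cartanD_laplacian θ hqx, θ.cartanD_aeval_laplacian q hx, hc',
      θ.laplacian_eq_zero h, map_zero, add_zero]

end InvariantConnection

end LieOperation

/-! ### The derivative of the adjoint representation -/

section AdjointDerivative

open VectorField Filter Topology

variable {m : ℕ} {G : Type*} [TopologicalSpace G] [ChartedSpace (EuclideanSpace ℝ (Fin m)) G]
  [Group G] [LieGroup (𝓡 m) ∞ G]

variable (m G) in
/-- The preferred chart of a Lie group at the identity. -/
abbrev oneChart : PartialEquiv G (EuclideanSpace ℝ (Fin m)) := extChartAt (𝓡 m) (1 : G)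

variable (m G) in
/-- The multiplication of a Lie group in the chart at the identity. -/
def mulChart (p : EuclideanSpace ℝ (Fin m) × EuclideanSpace ℝ (Fin m)) :
    EuclideanSpace ℝ (Fin m) :=
  oneChart m G ((oneChart m G).symm p.1 * (oneChart m G).symm p.2)

variable (m G) in
/-- The conjugation `(g, h) ↦ g h g⁻¹` of a Lie group in the chart at the identity. -/
def conjChart (p : EuclideanSpace ℝ (Fin m) × EuclideanSpace ℝ (Fin m)) :
    EuclideanSpace ℝ (Fin m) :=
  oneChart m G ((oneChart m G).symm p.1 * (oneChart m G).symm p.2 * ((oneChart m G).symm p.1)⁻¹)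

variable (G) in
theorem oneChart_symm_one : (oneChart m G).symm (oneChart m G 1) = 1 := extChartAt_to_inv (1 : G)

variable (G) in
theorem contMDiffAt_oneChart_symm : ContMDiffAt 𝓘(ℝ, EuclideanSpace ℝ (Fin m)) (𝓡 m) ∞
    (oneChart m G).symm (oneChart m G 1) :=
  (contMDiffOn_extChartAt_symm (1 : G)).contMDiffAt (extChartAt_target_mem_nhds (1 : G))

theorem contDiffAt_oneChart_comp {E : Type*} [NormedAddCommGroup E] [NormedSpace ℝ E] {f : E → G}
    {x : E} (hf : ContMDiffAt 𝓘(ℝ, E) (𝓡 m) ∞ f x) (hx : f x = 1) :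
    ContDiffAt ℝ ∞ (fun y => oneChart m G (f y)) x := by
  have h : ContMDiffAt (𝓡 m) 𝓘(ℝ, EuclideanSpace ℝ (Fin m)) ∞ (oneChart m G) (f x) := by
    rw [hx]; exact contMDiffAt_extChartAt
  exact (h.comp x hf).contDiffAt

variable (G) in
theorem contDiffAt_mulChart :
    ContDiffAt ℝ ∞ (mulChart m G) (oneChart m G 1, oneChart m G 1) := by
  have h1 := (contMDiffAt_oneChart_symm (m := m) G).comp
    (oneChart m G 1, oneChart m G 1) (contDiff_fst.contMDiff.contMDiffAt (n := ∞))
  have h2 := (contMDiffAt_oneChart_symm (m := m) G).comp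
    (oneChart m G 1, oneChart m G 1) (contDiff_snd.contMDiff.contMDiffAt (n := ∞))
  exact contDiffAt_oneChart_comp (h1.mul h2) (by simp)

variable (G) in
theorem contDiffAt_conjChart :
    ContDiffAt ℝ ∞ (conjChart m G) (oneChart m G 1, oneChart m G 1) := by
  have h1 := (contMDiffAt_oneChart_symm (m := m) G).comp
    (oneChart m G 1, oneChart m G 1) (contDiff_fst.contMDiff.contMDiffAt (n := ∞))
  have h2 := (contMDiffAt_oneChart_symm (m := m) G).comp
    (oneChart m G 1, oneChart m G 1) (contDiff_snd.contMDiff.contMDiffAt (n := ∞))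
  exact contDiffAt_oneChart_comp ((h1.mul h2).mul h1.inv) (by simp)

/-- In the chart at the identity, the manifold derivative at `1` of a map that fixes `1` is the
derivative of its coordinate expression. -/
theorem hasFDerivAt_chart_of_hasMFDerivAt {f : G → G} (hf1 : f 1 = 1)
    {f' : EuclideanSpace ℝ (Fin m) →L[ℝ] EuclideanSpace ℝ (Fin m)}
    (hf : HasMFDerivAt (𝓡 m) (𝓡 m) f 1 f') :
    HasFDerivAt (fun y => oneChart m G (f ((oneChart m G).symm y))) f' (oneChart m G 1) := by
  have h : HasFDerivWithinAt (writtenInExtChartAt (𝓡 m) (𝓡 m) (1 : G) f) f' (Set.range (𝓡 m))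
    (oneChart m G 1) := hf.2
  rw [ModelWithCorners.range_eq_univ, hasFDerivWithinAt_univ] at h
  simpa only [writtenInExtChartAt, hf1, Function.comp_def] using h

theorem hasFDerivAt_comp_oneChart_symm {E : Type*} [NormedAddCommGroup E] [NormedSpace ℝ E]
    {f : G → E} {f' : EuclideanSpace ℝ (Fin m) →L[ℝ] E}
    (hf : HasMFDerivAt (𝓡 m) 𝓘(ℝ, E) f 1 f') :
    HasFDerivAt (fun y => f ((oneChart m G).symm y)) f' (oneChart m G 1) := by
  have h : HasFDerivWithinAt (writtenInExtChartAt (𝓡 m) 𝓘(ℝ, E) (1 : G) f) f' (Set.range (𝓡 m))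
    (oneChart m G 1) := hf.2
  rw [ModelWithCorners.range_eq_univ, hasFDerivWithinAt_univ] at h
  exact h

theorem hasDerivAt_oneChart_comp {γ : ℝ → G} (hγ : MDifferentiableAt 𝓘(ℝ, ℝ) (𝓡 m) γ 0)
    (hγ1 : γ 0 = 1) : HasDerivAt (fun t => oneChart m G (γ t))
      (velocity m γ : EuclideanSpace ℝ (Fin m)) 0 := by
  let γ' : ℝ →L[ℝ] EuclideanSpace ℝ (Fin m) := mfderiv 𝓘(ℝ, ℝ) (𝓡 m) γ 0
  have h : HasFDerivWithinAt (writtenInExtChartAt 𝓘(ℝ, ℝ) (𝓡 m) 0 γ) γ'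
    (Set.range 𝓘(ℝ, ℝ)) (0 : ℝ) := hγ.hasMFDerivAt.2
  rw [ModelWithCorners.range_eq_univ, hasFDerivWithinAt_univ] at h
  have h2 : HasFDerivAt (fun t => oneChart m G (γ t)) γ' 0 := by
    simpa only [writtenInExtChartAt, hγ1, Function.comp_def, extChartAt_model_space_eq_id,
      PartialEquiv.refl_symm, PartialEquiv.refl_coe, id_eq] using h
  exact h2.hasDerivAt

/-- The adjoint representation is a partial derivative of the conjugation in the chart. -/
theorem Ad_oneChart_symm {x : EuclideanSpace ℝ (Fin m)}
    (hx : DifferentiableAt ℝ (conjChart m G) (x, oneChart m G 1)) (Y : LieAlg m G) :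
    (Ad m ((oneChart m G).symm x) Y : EuclideanSpace ℝ (Fin m)) =
      fderiv ℝ (conjChart m G) (x, oneChart m G 1) (0, Y) := by
  set g := (oneChart m G).symm x with hg
  have h1 := hasFDerivAt_chart_of_hasMFDerivAt (m := m) (f := fun h : G => g * h * g⁻¹) (by simp)
    (((contMDiff_conj g).mdifferentiable (by simp) 1).hasMFDerivAt)
  have h2 := hx.hasFDerivAt.comp (oneChart m G 1)
    ((hasFDerivAt_const x (oneChart m G 1)).prodMk (hasFDerivAt_id (oneChart m G 1)))
  exact DFunLike.congr_fun (h1.unique h2) (Y : EuclideanSpace ℝ (Fin m))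

/-- The invariant vector field of `Y` in the chart at the identity. -/
theorem mpullback_mulInvariantVectorField_chart {x : EuclideanSpace ℝ (Fin m)}
    (hx : DifferentiableAt ℝ (mulChart m G) (x, oneChart m G 1))
    (hx' : x ∈ (oneChart m G).target) (Y : LieAlg m G) :
    (mpullbackWithin 𝓘(ℝ, EuclideanSpace ℝ (Fin m)) (𝓡 m) (oneChart m G).symm
      (mulInvariantVectorField Y) (Set.range (𝓡 m)) x : EuclideanSpace ℝ (Fin m)) =
      fderiv ℝ (mulChart m G) (x, oneChart m G 1) (0, Y) := by
  set g := (oneChart m G).symm x with hg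
  have hgs : g ∈ (oneChart m G).source := (oneChart m G).map_target hx'
  have hφ : ∀ h : G, h = g → MDifferentiableAt (𝓡 m) 𝓘(ℝ, EuclideanSpace ℝ (Fin m))
      (oneChart m G) h := by
    rintro _ rfl
    exact mdifferentiableAt_extChartAt (by rwa [← extChartAt_source (𝓡 m)])
  have h0 : HasMFDerivAt (𝓡 m) 𝓘(ℝ, EuclideanSpace ℝ (Fin m))
      (oneChart m G ∘ fun h => g * h) 1
      ((mfderiv (𝓡 m) 𝓘(ℝ, EuclideanSpace ℝ (Fin m)) (oneChart m G) (g * 1)) ∘L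
        (mfderiv (𝓡 m) (𝓡 m) (fun h => g * h) (1 : G))) :=
    HasMFDerivAt.comp 1 (hφ _ (mul_one g)).hasMFDerivAt
      (((contMDiff_mul_left (I := 𝓡 m) (n := ∞)).mdifferentiable (by simp) _).hasMFDerivAt)
  have h1 := hasFDerivAt_comp_oneChart_symm h0
  have h2 := hx.hasFDerivAt.comp (oneChart m G 1)
    ((hasFDerivAt_const x (oneChart m G 1)).prodMk (hasFDerivAt_id (oneChart m G 1)))
  have h3 : (mfderiv (𝓡 m) 𝓘(ℝ, EuclideanSpace ℝ (Fin m)) (oneChart m G) (g * 1)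
      (mulInvariantVectorField Y g : EuclideanSpace ℝ (Fin m)) : EuclideanSpace ℝ (Fin m)) =
      fderiv ℝ (mulChart m G) (x, oneChart m G 1) (0, Y) :=
    DFunLike.congr_fun (h1.unique h2) (Y : EuclideanSpace ℝ (Fin m))
  have h4 : ∀ (h : G) (_ : h = g) (v : EuclideanSpace ℝ (Fin m)),
      (mfderiv (𝓡 m) 𝓘(ℝ, EuclideanSpace ℝ (Fin m)) (oneChart m G) h v :
        EuclideanSpace ℝ (Fin m)) =
      (mfderiv (𝓡 m) 𝓘(ℝ, EuclideanSpace ℝ (Fin m)) (oneChart m G) g v :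
        EuclideanSpace ℝ (Fin m)) := by
    rintro _ rfl _; rfl
  have h5 := DFunLike.congr_fun (mfderivWithin_extChartAt_symm_comp_mfderiv_extChartAt
    (I := 𝓡 m) hx') (mulInvariantVectorField Y g)
  refine ((isInvertible_mfderivWithin_extChartAt_symm hx').inverse_apply_eq).2 ?_
  refine h5.symm.trans ?_
  exact congrArg (fun v : EuclideanSpace ℝ (Fin m) =>
    mfderivWithin 𝓘(ℝ, EuclideanSpace ℝ (Fin m)) (𝓡 m) (oneChart m G).symm
      (Set.range (𝓡 m)) x v) ((h4 _ (mul_one g) _).symm.trans h3)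

variable (G) in
/-- The second derivative of the multiplication in the chart at the identity, in the directions
`X` of the first factor and `Y` of the second factor. -/
def mulSecondDeriv (X Y : EuclideanSpace ℝ (Fin m)) : EuclideanSpace ℝ (Fin m) :=
  fderiv ℝ (fderiv ℝ (mulChart m G)) (oneChart m G 1, oneChart m G 1) (X, 0) (0, Y)

variable (G) in
theorem differentiableAt_fderiv_mulChart :
    DifferentiableAt ℝ (fderiv ℝ (mulChart m G)) (oneChart m G 1, oneChart m G 1) :=
  ((contDiffAt_mulChart G).fderiv_right (m := 1) (by norm_cast)).differentiableAt (by simp)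

variable (G) in
theorem differentiableAt_fderiv_conjChart :
    DifferentiableAt ℝ (fderiv ℝ (conjChart m G)) (oneChart m G 1, oneChart m G 1) :=
  ((contDiffAt_conjChart G).fderiv_right (m := 1) (by norm_cast)).differentiableAt (by simp)

variable (G) in
theorem eventually_differentiableAt_mulChart :
    ∀ᶠ p in 𝓝 (oneChart m G 1, oneChart m G 1), DifferentiableAt ℝ (mulChart m G) p := by
  have h := ((contDiffAt_mulChart (m := m) G).of_le (m := 1) (by norm_cast)).eventually (by simp)
  filter_upwards [h] with p hp using hp.differentiableAt (by simp)

variable (G) in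
theorem eventually_differentiableAt_conjChart :
    ∀ᶠ p in 𝓝 (oneChart m G 1, oneChart m G 1), DifferentiableAt ℝ (conjChart m G) p := by
  have h := ((contDiffAt_conjChart (m := m) G).of_le (m := 1) (by norm_cast)).eventually (by simp)
  filter_upwards [h] with p hp using hp.differentiableAt (by simp)

theorem fderiv_mulChart_snd (Y : EuclideanSpace ℝ (Fin m)) :
    fderiv ℝ (mulChart m G) (oneChart m G 1, oneChart m G 1) (0, Y) = Y := by
  have h2 := (eventually_differentiableAt_mulChart (m := m) G).self_of_nhds.hasFDerivAt.comp
    (oneChart m G 1) (hasFDerivAt_prodMk_right (oneChart m G 1) (oneChart m G 1))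
  have h3 : HasFDerivAt (mulChart m G ∘ fun y => (oneChart m G 1, y))
      (ContinuousLinearMap.id ℝ (EuclideanSpace ℝ (Fin m))) (oneChart m G 1) := by
    refine (hasFDerivAt_id _).congr_of_eventuallyEq ?_
    filter_upwards [extChartAt_target_mem_nhds (I := 𝓡 m) (1 : G)] with y hy
    simp only [mulChart, Function.comp_apply, oneChart_symm_one, one_mul]
    exact (oneChart m G).right_inv hy
  exact DFunLike.congr_fun (h2.unique h3) Y

theorem fderiv_mulChart_fst (Y : EuclideanSpace ℝ (Fin m)) :
    fderiv ℝ (mulChart m G) (oneChart m G 1, oneChart m G 1) (Y, 0) = Y := by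
  have h2 := (eventually_differentiableAt_mulChart (m := m) G).self_of_nhds.hasFDerivAt.comp
    (f := fun y => (y, oneChart m G 1)) (oneChart m G 1)
    (hasFDerivAt_prodMk_left (oneChart m G 1) (oneChart m G 1))
  have h3 : HasFDerivAt (mulChart m G ∘ fun y => (y, oneChart m G 1))
      (ContinuousLinearMap.id ℝ (EuclideanSpace ℝ (Fin m))) (oneChart m G 1) := by
    refine (hasFDerivAt_id _).congr_of_eventuallyEq ?_
    filter_upwards [extChartAt_target_mem_nhds (I := 𝓡 m) (1 : G)] with y hy
    simp only [mulChart, Function.comp_apply, oneChart_symm_one, mul_one]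
    exact (oneChart m G).right_inv hy
  exact DFunLike.congr_fun (h2.unique h3) Y

theorem hasFDerivAt_fderiv_mulChart_snd (Y : EuclideanSpace ℝ (Fin m)) :
    HasFDerivAt (fun x => fderiv ℝ (mulChart m G) (x, oneChart m G 1) (0, Y))
      ((ContinuousLinearMap.apply ℝ (EuclideanSpace ℝ (Fin m))
        (0, Y)).comp
        ((fderiv ℝ (fderiv ℝ (mulChart m G)) (oneChart m G 1, oneChart m G 1)).comp
          (ContinuousLinearMap.inl ℝ _ _))) (oneChart m G 1) := by
  have h := (differentiableAt_fderiv_mulChart (m := m) G).hasFDerivAt.comp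
    (f := fun y => (y, oneChart m G 1)) (oneChart m G 1)
    (hasFDerivAt_prodMk_left (oneChart m G 1) (oneChart m G 1))
  exact (ContinuousLinearMap.apply ℝ (EuclideanSpace ℝ (Fin m))
    (0, Y)).hasFDerivAt.comp _ h

theorem inverse_mfderiv_oneChart (v : EuclideanSpace ℝ (Fin m)) :
    ((mfderiv (𝓡 m) 𝓘(ℝ, EuclideanSpace ℝ (Fin m)) (oneChart m G) (1 : G)).inverse v :
      EuclideanSpace ℝ (Fin m)) = v := by
  refine ((isInvertible_mfderiv_extChartAt (mem_extChartAt_source (1 : G))).inverse_apply_eq).2 ?_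
  have h1 := hasFDerivAt_comp_oneChart_symm (mdifferentiableAt_extChartAt
    (I := 𝓡 m) (mem_chart_source _ (1 : G))).hasMFDerivAt
  have h2 : HasFDerivAt (fun y => oneChart m G ((oneChart m G).symm y))
      (ContinuousLinearMap.id ℝ (EuclideanSpace ℝ (Fin m))) (oneChart m G 1) := by
    refine (hasFDerivAt_id _).congr_of_eventuallyEq ?_
    filter_upwards [extChartAt_target_mem_nhds (I := 𝓡 m) (1 : G)] with y hy
    exact (oneChart m G).right_inv hy
  exact (DFunLike.congr_fun (h1.unique h2) v).symm

theorem mpullback_mulInvariantVectorField_eventuallyEq (Y : LieAlg m G) :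
    (mpullbackWithin 𝓘(ℝ, EuclideanSpace ℝ (Fin m)) (𝓡 m) (oneChart m G).symm
      (mulInvariantVectorField Y) (Set.range (𝓡 m)) :
        EuclideanSpace ℝ (Fin m) → EuclideanSpace ℝ (Fin m)) =ᶠ[𝓝 (oneChart m G 1)]
      fun x => fderiv ℝ (mulChart m G) (x, oneChart m G 1) (0, Y) := by
  have hc : Tendsto (fun x : EuclideanSpace ℝ (Fin m) => (x, oneChart m G 1))
      (𝓝 (oneChart m G 1)) (𝓝 (oneChart m G 1, oneChart m G 1)) :=
    (Continuous.prodMk_left (oneChart m G 1)).tendsto _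
  filter_upwards [hc.eventually (eventually_differentiableAt_mulChart (m := m) G),
    extChartAt_target_mem_nhds (I := 𝓡 m) (1 : G)] with x hx hx'
  exact mpullback_mulInvariantVectorField_chart hx hx' Y

theorem lieBracketWithin_univ_eq {E : Type*} [NormedAddCommGroup E] [NormedSpace ℝ E]
    {V W V' W' : E → E} {s : Set E} {x : E} (hs : s = Set.univ) (hV : V =ᶠ[𝓝 x] V')
    (hW : W =ᶠ[𝓝 x] W') :
    lieBracketWithin ℝ V W s x = fderiv ℝ W' x (V' x) - fderiv ℝ V' x (W' x) := by
  rw [hs, lieBracketWithin_univ, lieBracket, hV.fderiv_eq, hW.fderiv_eq, hV.eq_of_nhds,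
    hW.eq_of_nhds]

theorem fderiv_fderiv_mulChart_sub (X Y : EuclideanSpace ℝ (Fin m)) :
    fderiv ℝ (fun x => fderiv ℝ (mulChart m G) (x, oneChart m G 1) (0, Y)) (oneChart m G 1)
        (fderiv ℝ (mulChart m G) (oneChart m G 1, oneChart m G 1) (0, X)) -
      fderiv ℝ (fun x => fderiv ℝ (mulChart m G) (x, oneChart m G 1) (0, X)) (oneChart m G 1)
        (fderiv ℝ (mulChart m G) (oneChart m G 1, oneChart m G 1) (0, Y)) =
    mulSecondDeriv G X Y - mulSecondDeriv G Y X := by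
  rw [(hasFDerivAt_fderiv_mulChart_snd X).fderiv, (hasFDerivAt_fderiv_mulChart_snd Y).fderiv,
    fderiv_mulChart_snd, fderiv_mulChart_snd]
  rfl

/-- The Lie bracket is the antisymmetrized second derivative of the multiplication. -/
theorem lie_eq_mulSecondDeriv_sub (X Y : LieAlg m G) :
    (⁅X, Y⁆ : LieAlg m G) = mulSecondDeriv G X Y - mulSecondDeriv G Y X := by
  have hX := mpullback_mulInvariantVectorField_eventuallyEq X
  have hY := mpullback_mulInvariantVectorField_eventuallyEq Y
  have key : lieBracketWithin ℝ
      (mpullbackWithin 𝓘(ℝ, EuclideanSpace ℝ (Fin m)) (𝓡 m) (oneChart m G).symm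
        (mulInvariantVectorField X) (Set.range (𝓡 m)) :
          EuclideanSpace ℝ (Fin m) → EuclideanSpace ℝ (Fin m))
      (mpullbackWithin 𝓘(ℝ, EuclideanSpace ℝ (Fin m)) (𝓡 m) (oneChart m G).symm
        (mulInvariantVectorField Y) (Set.range (𝓡 m)) :
          EuclideanSpace ℝ (Fin m) → EuclideanSpace ℝ (Fin m))
      ((oneChart m G).symm ⁻¹' Set.univ ∩ Set.range (𝓡 m)) (oneChart m G 1) =
        mulSecondDeriv G X Y - mulSecondDeriv G Y X := by
    refine (lieBracketWithin_univ_eq (by rw [ModelWithCorners.range_eq_univ, Set.preimage_univ,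
      Set.univ_inter]) hX hY).trans ?_
    exact fderiv_fderiv_mulChart_sub _ _
  rw [GroupLieAlgebra.bracket_def, ← mlieBracketWithin_univ, mlieBracketWithin_apply]
  exact (congrArg _ key).trans (inverse_mfderiv_oneChart _)

theorem conjChart_one (x : EuclideanSpace ℝ (Fin m)) :
    conjChart m G (x, oneChart m G 1) = oneChart m G 1 := by
  simp [conjChart]

variable (G) in
theorem eventually_mulChart_conjChart :
    ∀ᶠ p in 𝓝 (oneChart m G 1, oneChart m G 1),
      mulChart m G (conjChart m G p, p.1) = mulChart m G p := by
  have h1 := (contMDiffAt_oneChart_symm (m := m) G).comp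
    (oneChart m G 1, oneChart m G 1) (contDiff_fst.contMDiff.contMDiffAt (n := ∞))
  have h2 := (contMDiffAt_oneChart_symm (m := m) G).comp
    (oneChart m G 1, oneChart m G 1) (contDiff_snd.contMDiff.contMDiffAt (n := ∞))
  have h3 := ((h1.mul h2).mul h1.inv).continuousAt
  have h4 := h3.eventually_mem (s := (oneChart m G).source) (by
    simpa using extChartAt_source_mem_nhds (I := 𝓡 m) (1 : G))
  filter_upwards [h4] with p hp
  simp only [mulChart, conjChart]
  have hp' := (oneChart m G).left_inv hp
  simp only [Pi.mul_apply, Function.comp_apply] at hp'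
  rw [hp', inv_mul_cancel_right]

/-- The linearization in the second factor of the identity `(g h g⁻¹) g = g h`. -/
theorem eventually_fderiv_mulChart_fderiv_conjChart (Y : EuclideanSpace ℝ (Fin m)) :
    ∀ᶠ x in 𝓝 (oneChart m G 1),
      fderiv ℝ (mulChart m G) (oneChart m G 1, x)
        (fderiv ℝ (conjChart m G) (x, oneChart m G 1) (0, Y), 0) =
      fderiv ℝ (mulChart m G) (x, oneChart m G 1) (0, Y) := by
  have hc : Tendsto (fun x : EuclideanSpace ℝ (Fin m) => (x, oneChart m G 1))
      (𝓝 (oneChart m G 1)) (𝓝 (oneChart m G 1, oneChart m G 1)) :=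
    (Continuous.prodMk_left (oneChart m G 1)).tendsto _
  have hc' : Tendsto (fun x : EuclideanSpace ℝ (Fin m) => (oneChart m G 1, x))
      (𝓝 (oneChart m G 1)) (𝓝 (oneChart m G 1, oneChart m G 1)) :=
    (Continuous.prodMk_right (oneChart m G 1)).tendsto _
  filter_upwards [hc.eventually (eventually_differentiableAt_conjChart (m := m) G),
    hc.eventually (eventually_differentiableAt_mulChart (m := m) G),
    hc'.eventually (eventually_differentiableAt_mulChart (m := m) G),
    hc.eventually (eventually_mulChart_conjChart (m := m) G).eventually_nhds] with x h1 h2 h3 h4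
  rw [← conjChart_one x] at h3
  have h5 := h3.hasFDerivAt.comp (f := fun p => (conjChart m G p, p.1)) (x, oneChart m G 1)
    (h1.hasFDerivAt.prodMk hasFDerivAt_fst)
  have h6 := h5.unique (h2.hasFDerivAt.congr_of_eventuallyEq h4)
  have h7 := DFunLike.congr_fun h6 ((0, Y) : EuclideanSpace ℝ (Fin m) × EuclideanSpace ℝ (Fin m))
  rw [conjChart_one] at h7
  exact h7

/-- The derivative of `g ↦ Ad g Y` in the chart is the antisymmetrized second derivative of the
multiplication: differentiate the identity `D₁μ(1, x)(Ad x Y) = D₂μ(x, 1)(Y)` with respect to `x` at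
`1`, and use the symmetry of the second derivative of `μ`. -/
theorem hasFDerivAt_fderiv_conjChart (Y : EuclideanSpace ℝ (Fin m)) :
    ∃ c : EuclideanSpace ℝ (Fin m) →L[ℝ] EuclideanSpace ℝ (Fin m),
      HasFDerivAt (fun x => fderiv ℝ (conjChart m G) (x, oneChart m G 1) (0, Y)) c
        (oneChart m G 1) ∧ ∀ X, c X = mulSecondDeriv G X Y - mulSecondDeriv G Y X := by
  have h0 := (differentiableAt_fderiv_conjChart (m := m) G).hasFDerivAt.comp
    (f := fun y => (y, oneChart m G 1)) (oneChart m G 1)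
    (hasFDerivAt_prodMk_left (oneChart m G 1) (oneChart m G 1))
  have h1 := (ContinuousLinearMap.apply ℝ (EuclideanSpace ℝ (Fin m))
    ((0, Y) : EuclideanSpace ℝ (Fin m) × EuclideanSpace ℝ (Fin m))).hasFDerivAt.comp
      (oneChart m G 1) h0
  refine ⟨_, h1, fun X => ?_⟩
  set c := (ContinuousLinearMap.apply ℝ (EuclideanSpace ℝ (Fin m))
    ((0, Y) : EuclideanSpace ℝ (Fin m) × EuclideanSpace ℝ (Fin m))).comp
    ((fderiv ℝ (fderiv ℝ (conjChart m G)) (oneChart m G 1, oneChart m G 1)).comp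
      (ContinuousLinearMap.inl ℝ _ _))
  have h2 := (differentiableAt_fderiv_mulChart (m := m) G).hasFDerivAt.comp
    (f := fun y => (oneChart m G 1, y)) (oneChart m G 1)
    (hasFDerivAt_prodMk_right (oneChart m G 1) (oneChart m G 1))
  have h3 := h2.clm_apply (h1.prodMk (hasFDerivAt_const (0 : EuclideanSpace ℝ (Fin m))
    (oneChart m G 1)))
  have hev := eventually_fderiv_mulChart_fderiv_conjChart (G := G) Y
  have h4 := h3.unique ((hasFDerivAt_fderiv_mulChart_snd Y).congr_of_eventuallyEq hev)
  have h5 := DFunLike.congr_fun h4 X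
  have h6 : fderiv ℝ (conjChart m G) (oneChart m G 1, oneChart m G 1) (0, Y) = Y := by
    have h := hev.self_of_nhds
    rwa [fderiv_mulChart_fst, fderiv_mulChart_snd] at h
  have hsymm := ((contDiffAt_mulChart (m := m) G).isSymmSndFDerivAt (by
    rw [minSmoothness_of_isRCLikeNormedField]; norm_cast)).eq (0, X) (Y, 0)
  have h7 : fderiv ℝ (mulChart m G) (oneChart m G 1, oneChart m G 1) (c X, 0) +
      fderiv ℝ (fderiv ℝ (mulChart m G)) (oneChart m G 1, oneChart m G 1) (0, X)
        (fderiv ℝ (conjChart m G) (oneChart m G 1, oneChart m G 1) (0, Y), 0) =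
      mulSecondDeriv G X Y := h5
  rw [fderiv_mulChart_fst, h6, hsymm] at h7
  exact eq_sub_of_add_eq h7

/-- The derivative at the identity of the adjoint representation is the Lie bracket. -/
theorem hasDerivAt_Ad {γ : ℝ → G} (hγ : MDifferentiableAt 𝓘(ℝ, ℝ) (𝓡 m) γ 0) (hγ1 : γ 0 = 1)
    (Y : LieAlg m G) : HasDerivAt (fun t => (Ad m (γ t) Y : EuclideanSpace ℝ (Fin m)))
      (⁅velocity m γ, Y⁆ : LieAlg m G) 0 := by
  obtain ⟨c, hc, hc'⟩ := hasFDerivAt_fderiv_conjChart (G := G) (Y : EuclideanSpace ℝ (Fin m))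
  have h1 := hasDerivAt_oneChart_comp hγ hγ1
  have h2 := (hc.comp_hasDerivAt_of_eq (0 : ℝ) h1 (by rw [hγ1])).congr_deriv
    ((hc' _).trans (lie_eq_mulSecondDeriv_sub (velocity m γ) Y).symm)
  refine h2.congr_of_eventuallyEq ?_
  have hct : Tendsto γ (𝓝 0) (𝓝 1) := hγ1 ▸ hγ.continuousAt
  have hct' : Tendsto (fun t => (oneChart m G (γ t), oneChart m G 1))
      (𝓝 0) (𝓝 (oneChart m G 1, oneChart m G 1)) :=
    (((continuousAt_extChartAt (I := 𝓡 m) (1 : G)).tendsto.comp hct).prodMk_nhds tendsto_const_nhds)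
  filter_upwards [hct.eventually (extChartAt_source_mem_nhds (I := 𝓡 m) (1 : G)),
    hct'.eventually (eventually_differentiableAt_conjChart (m := m) G)] with t ht ht'
  have h := Ad_oneChart_symm ht' Y
  rw [(oneChart m G).left_inv ht] at h
  exact h

end AdjointDerivative

/-! ### Functions on connected Lie groups -/

section ConnectedGroup

open Filter Topology

variable {m : ℕ} {G : Type*} [TopologicalSpace G] [ChartedSpace (EuclideanSpace ℝ (Fin m)) G]
  [Group G] [LieGroup (𝓡 m) ∞ G]

/-- A function on a connected Lie group is constant if its derivatives along all left translates of
smooth curves through the identity vanish. -/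
theorem eq_of_hasDerivAt_curve_zero [ConnectedSpace G] {f : G → ℝ}
    (hf : ∀ (h : G) (γ : ℝ → G), ContMDiffAt 𝓘(ℝ, ℝ) (𝓡 m) ∞ γ 0 → γ 0 = 1 →
      HasDerivAt (fun t => f (h * γ t)) 0 0) (g h : G) : f g = f h := by
  refine IsLocallyConstant.apply_eq_of_preconnectedSpace
    ((IsLocallyConstant.iff_eventually_eq f).2 fun x => ?_) g h
  set φ := extChartAt (𝓡 m) x
  obtain ⟨r, hr, hball⟩ := Metric.mem_nhds_iff.1 (extChartAt_target_mem_nhds (I := 𝓡 m) x)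
  have hcont : ∀ᶠ y in 𝓝 x, φ y ∈ Metric.ball (φ x) r :=
    (continuousAt_extChartAt (I := 𝓡 m) x).eventually_mem (Metric.ball_mem_nhds _ hr)
  filter_upwards [hcont, extChartAt_source_mem_nhds (I := 𝓡 m) x] with y hy hys
  -- Points of a ball in a chart are joined by segments.
  let l : ℝ → EuclideanSpace ℝ (Fin m) := fun t => φ x + t • (φ y - φ x)
  have hl : ContDiff ℝ ∞ l := by fun_prop
  have hderiv : ∀ t ∈ Set.Icc (0 : ℝ) 1, HasDerivAt (fun s => f (φ.symm (l s))) 0 t := by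
    intro t ht
    have hlt : l t ∈ Metric.ball (φ x) r := by
      have h := (convex_ball (φ x) r).add_smul_sub_mem (Metric.mem_ball_self hr) hy ht
      exact h
    have hsm : ContMDiffAt 𝓘(ℝ, EuclideanSpace ℝ (Fin m)) (𝓡 m) ∞ φ.symm (l (t + 0)) := by
      rw [add_zero]
      exact (contMDiffOn_extChartAt_symm x).contMDiffAt
        (mem_of_superset (Metric.isOpen_ball.mem_nhds hlt) hball)
    have hlt' : ContDiff ℝ ∞ fun s => l (t + s) := by fun_prop
    have hγ : ContMDiffAt 𝓘(ℝ, ℝ) (𝓡 m) ∞ (fun s => (φ.symm (l t))⁻¹ * φ.symm (l (t + s))) 0 :=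
      ContMDiffAt.comp (0 : ℝ)
        ((contMDiff_mul_left (I := 𝓡 m) (n := ∞) (a := (φ.symm (l t))⁻¹)) _)
        (ContMDiffAt.comp (0 : ℝ) hsm hlt'.contMDiff.contMDiffAt)
    have h1 := hf (φ.symm (l t)) _ hγ (by simp)
    simp only [mul_inv_cancel_left] at h1
    rw [← sub_self t] at h1
    simpa using h1.comp_sub_const t t
  have h := constant_of_has_deriv_right_zero
    (fun t ht => (hderiv t ht).continuousAt.continuousWithinAt)
    (fun t ht => (hderiv t (Set.Ico_subset_Icc_self ht)).hasDerivWithinAt) 1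
    (Set.right_mem_Icc.2 zero_le_one)
  simp only [l, one_smul, zero_smul, add_zero, add_sub_cancel] at h
  rwa [φ.left_inv hys, φ.left_inv (mem_extChartAt_source x)] at h

theorem Ad_one (X : LieAlg m G) : Ad m (1 : G) X = X := by
  have e : (fun h : G => 1 * h * 1⁻¹) = id := by ext; simp
  exact (congrArg (fun f : G → G => (mfderiv (𝓡 m) (𝓡 m) f 1 X : EuclideanSpace ℝ (Fin m)))
    e).trans (by rw [mfderiv_id]; rfl)

theorem Ad_mul (g h : G) (X : LieAlg m G) : Ad m (g * h) X = Ad m g (Ad m h X) := by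
  obtain ⟨γ, h1, hs, rfl⟩ := exists_curve X
  have hd : MDifferentiableAt 𝓘(ℝ, ℝ) (𝓡 m) γ 0 := hs.mdifferentiableAt (by simp)
  have hcs : ContMDiffAt 𝓘(ℝ, ℝ) (𝓡 m) ∞ (fun t => h * γ t * h⁻¹) 0 :=
    ContMDiffAt.comp 0 ((contMDiff_conj h) _) hs
  rw [← velocity_conj h hd h1, ← velocity_conj g (hcs.mdifferentiableAt (by simp)) (by simp [h1]),
    ← velocity_conj (g * h) hd h1]
  congr 1
  ext t
  group

theorem hasDerivAt_Ad_inv {γ : ℝ → G} (hγ : ContMDiffAt 𝓘(ℝ, ℝ) (𝓡 m) ∞ γ 0) (hγ1 : γ 0 = 1)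
    (Y : LieAlg m G) : HasDerivAt (fun t => (Ad m (γ t)⁻¹ Y : EuclideanSpace ℝ (Fin m)))
      (-⁅velocity m γ, Y⁆ : LieAlg m G) 0 := by
  have h := hasDerivAt_Ad (γ := fun t => (γ t)⁻¹) (hγ.inv.mdifferentiableAt (by simp))
    (by simp [hγ1]) Y
  rw [velocity_inv (hγ.mdifferentiableAt (by simp)) hγ1, neg_lie] at h
  exact h

theorem hasDerivAt_dual_Ad_inv {γ : ℝ → G} (hγ : ContMDiffAt 𝓘(ℝ, ℝ) (𝓡 m) ∞ γ 0)
    (hγ1 : γ 0 = 1) (ξ : Module.Dual ℝ (LieAlg m G)) (Y : LieAlg m G) :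
    HasDerivAt (fun t => ξ (Ad m (γ t)⁻¹ Y)) (-ξ ⁅velocity m γ, Y⁆) 0 := by
  let ξ' : EuclideanSpace ℝ (Fin m) →L[ℝ] ℝ :=
    LinearMap.toContinuousLinearMap (E := EuclideanSpace ℝ (Fin m)) ξ
  have h := ξ'.hasFDerivAt.comp_hasDerivAt (0 : ℝ) (hasDerivAt_Ad_inv hγ hγ1 Y)
  exact h.congr_deriv (map_neg ξ _)

end ConnectedGroup

/-! ### Elements of the Cartan model as polynomial maps -/

section Evaluation

variable {V A : Type*} [AddCommGroup V] [Module ℝ V] [Ring A] [Algebra ℝ A]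

namespace SymmetricAlgebra

/-- The value at a point of a polynomial function on `V`. -/
def evalAt (Y : V) : SymmetricAlgebra ℝ (Module.Dual ℝ V) →ₐ[ℝ] ℝ :=
  SymmetricAlgebra.lift (Module.Dual.eval ℝ V Y)

theorem evalAt_ι (Y : V) (ξ : Module.Dual ℝ V) : evalAt Y (ι ℝ _ ξ) = ξ Y := by
  simp [evalAt]

theorem evalAt_map {W : Type*} [AddCommGroup W] [Module ℝ W] (f : V →ₗ[ℝ] W) (Y : V)
    (s : SymmetricAlgebra ℝ (Module.Dual ℝ W)) : evalAt Y (map f.dualMap s) = evalAt (f Y) s := by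
  have : (evalAt Y).comp (map f.dualMap) = evalAt (f Y) := by
    ext ξ
    simp [evalAt_ι, map_ι]
  exact DFunLike.congr_fun this s

/-- A polynomial function on a finite-dimensional real vector space that vanishes everywhere is
zero. -/
theorem eq_zero_of_evalAt [Module.Finite ℝ V] {s : SymmetricAlgebra ℝ (Module.Dual ℝ V)}
    (hs : ∀ Y, evalAt Y s = 0) : s = 0 := by
  let b := Module.finBasis ℝ V
  let e := equivMvPolynomial b.dualBasis
  refine e.injective ((MvPolynomial.funext fun c => ?_).trans (map_zero e).symm)
  have : (MvPolynomial.aeval c).comp e.toAlgHom = evalAt (∑ i, c i • b i) := by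
    refine SymmetricAlgebra.algHom_ext (b.dualBasis.ext fun i => ?_)
    refine (congrArg (MvPolynomial.aeval c) (equivMvPolynomial_ι_apply b.dualBasis i)).trans ?_
    simp [evalAt_ι, Finsupp.single_apply]
  rw [map_zero, ← hs (∑ i, c i • b i), ← this]
  rfl

end SymmetricAlgebra

variable (A) in
/-- The value at a point of a polynomial function on `V` with values in `A`. -/
def cartanEval (Y : V) : SymmetricAlgebra ℝ (Module.Dual ℝ V) ⊗[ℝ] A →ₗ[ℝ] A :=
  TensorProduct.lift (LinearMap.toSpanSingleton ℝ (Module.End ℝ A) LinearMap.id ∘ₗ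
    (SymmetricAlgebra.evalAt Y).toLinearMap)

theorem cartanEval_tmul (Y : V) (s : SymmetricAlgebra ℝ (Module.Dual ℝ V)) (a : A) :
    cartanEval A Y (s ⊗ₜ a) = SymmetricAlgebra.evalAt Y s • a := by
  simp [cartanEval]

/-- An element of `S V* ⊗ A` is determined by the polynomial map `V → A` that it defines. -/
theorem eq_zero_of_cartanEval [Module.Finite ℝ V]
    {x : SymmetricAlgebra ℝ (Module.Dual ℝ V) ⊗[ℝ] A} (hx : ∀ Y, cartanEval A Y x = 0) :
    x = 0 := by
  let b := Module.Basis.ofVectorSpace ℝ A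
  obtain ⟨c, rfl⟩ := TensorProduct.eq_repr_basis_right b x
  have hc : c = 0 := by
    ext i
    refine SymmetricAlgebra.eq_zero_of_evalAt fun Y => ?_
    have h := hx Y
    simp only [Finsupp.sum, map_sum, cartanEval_tmul] at h
    by_cases hi : i ∈ c.support
    · exact linearIndependent_iff'.1 b.linearIndependent c.support _ h i hi
    · rw [Finsupp.notMem_support_iff.1 hi, map_zero]
  rw [hc, Finsupp.sum_zero_index]

end Evaluation

/-! ### Invariant elements over a connected group -/

namespace GOperation

variable {m : ℕ} {G A : Type*} [TopologicalSpace G] [ChartedSpace (EuclideanSpace ℝ (Fin m)) G]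
  [Group G] [LieGroup (𝓡 m) ∞ G] [Ring A] [Algebra ℝ A] [TopologicalSpace A] [FrechetAlgebra A]
  (op : GOperation m G A)

/-- The composition of a continuous linear functional with the action of a group element. -/
def compAct (φ : A →L[ℝ] ℝ) (g : G) : A →L[ℝ] ℝ :=
  ⟨φ.toLinearMap ∘ₗ (op.act g).toLinearMap,
    φ.continuous.comp (op.act_continuous.comp (Continuous.prodMk_right g))⟩

theorem compAct_apply (φ : A →L[ℝ] ℝ) (g : G) (a : A) : op.compAct φ g a = φ (op.act g a) := rfl

theorem hasDerivAt_act {γ : ℝ → G} (hγ : ContMDiffAt 𝓘(ℝ, ℝ) (𝓡 m) ∞ γ 0) (hγ1 : γ 0 = 1) (a : A)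
    (φ : A →L[ℝ] ℝ) :
    HasDerivAt (fun t => φ (op.act (γ t) a)) (φ (op.lie (velocity m γ) a)) 0 := by
  have hd := hγ.mdifferentiableAt (by simp)
  have hf : MDifferentiableAt (𝓡 m) 𝓘(ℝ, ℝ) (fun g : G => φ (op.act g a)) 1 :=
    (op.act_smooth a φ).mdifferentiable (by simp) 1
  have h1 := velocity_comp hd hγ1 hf
  have h2 : MDifferentiableAt 𝓘(ℝ, ℝ) 𝓘(ℝ, ℝ) ((fun g : G => φ (op.act g a)) ∘ γ) 0 :=
    MDifferentiableAt.comp (I' := 𝓡 m) (0 : ℝ) (hγ1.symm ▸ hf) hd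
  have h3 := h2.differentiableAt.hasDerivAt
  refine h3.congr_deriv ?_
  rw [op.lie_eq]
  refine Eq.trans ?_ h1
  rw [mfderiv_eq_fderiv]
  rfl

/-- The derivative of `g ↦ s(Ad(g⁻¹) Y)` for a polynomial function `s` on the Lie algebra. -/
theorem hasDerivAt_evalAt_Ad_inv {γ : ℝ → G} (hγ : ContMDiffAt 𝓘(ℝ, ℝ) (𝓡 m) ∞ γ 0)
    (hγ1 : γ 0 = 1) (s : SymmetricAlgebra ℝ (Module.Dual ℝ (LieAlg m G))) (Y : LieAlg m G) :
    HasDerivAt (fun t => SymmetricAlgebra.evalAt (Ad m (γ t)⁻¹ Y) s)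
      (SymmetricAlgebra.evalAt Y (symDeriv (WeilAlgebra.coad (velocity m γ)) s)) 0 := by
  induction s using SymmetricAlgebra.induction with
  | algebraMap r =>
    have h : symDeriv (WeilAlgebra.coad (velocity m γ)) (algebraMap ℝ _ r) = 0 := by
      rw [Algebra.algebraMap_eq_smul_one, map_smul,
        SymmetricAlgebra.derivation_one (SymmetricAlgebra.symDeriv_mul _), smul_zero]
    simp only [AlgHom.commutes, h, map_zero]
    exact hasDerivAt_const _ _
  | ι ξ =>
    simp only [SymmetricAlgebra.symDeriv_ι, SymmetricAlgebra.evalAt_ι, WeilAlgebra.coad_apply]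
    exact hasDerivAt_dual_Ad_inv hγ hγ1 ξ Y
  | mul s t hs ht =>
    simp only [SymmetricAlgebra.symDeriv_mul, map_add, map_mul]
    have h := hs.mul ht
    simp only [hγ1, inv_one, Ad_one] at h
    exact h
  | add s t hs ht =>
    simp only [map_add]
    exact hs.add ht

/-- The Lie derivative of the Cartan model is the infinitesimal action of the group on polynomial
maps from its Lie algebra to `A`, tested against continuous functionals. -/
theorem hasDerivAt_cartanEval {γ : ℝ → G} (hγ : ContMDiffAt 𝓘(ℝ, ℝ) (𝓡 m) ∞ γ 0)
    (hγ1 : γ 0 = 1) (φ : A →L[ℝ] ℝ)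
    (x : SymmetricAlgebra ℝ (Module.Dual ℝ (LieAlg m G)) ⊗[ℝ] A) (Y : LieAlg m G) :
    HasDerivAt (fun t => φ (op.act (γ t) (cartanEval A (Ad m (γ t)⁻¹ Y) x)))
      (φ (cartanEval A Y (op.cartanLie (velocity m γ) x))) 0 := by
  induction x using TensorProduct.induction_on with
  | zero => simpa using hasDerivAt_const (0 : ℝ) (0 : ℝ)
  | add x y hx hy =>
    simp only [map_add]
    exact hx.add hy
  | tmul s a =>
    simp only [cartanEval_tmul, LieOperation.cartanLie_tmul, map_add, map_smul, smul_eq_mul]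
    have h := (hasDerivAt_evalAt_Ad_inv hγ hγ1 s Y).mul (op.hasDerivAt_act hγ hγ1 a φ)
    simp only [hγ1, inv_one, Ad_one, map_one, AlgEquiv.one_apply] at h
    exact h

/-- Over a connected group, the elements of the Cartan model that are invariant under the Lie
algebra are equivariant polynomial maps. -/
theorem act_cartanEval [ConnectedSpace G]
    {x : SymmetricAlgebra ℝ (Module.Dual ℝ (LieAlg m G)) ⊗[ℝ] A}
    (hx : ∀ X, op.cartanLie X x = 0) (g : G) (Y : LieAlg m G) :
    op.act g (cartanEval A (Ad m g⁻¹ Y) x) = cartanEval A Y x := by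
  refine (SeparatingDual.eq_iff_forall_dual_eq (R := ℝ)).2 fun φ => ?_
  have h := eq_of_hasDerivAt_curve_zero (m := m)
    (f := fun h : G => φ (op.act h (cartanEval A (Ad m h⁻¹ Y) x))) (fun h γ hγ hγ1 => ?_) g 1
  · simpa only [inv_one, Ad_one, map_one, AlgEquiv.one_apply] using h
  · have h1 := op.hasDerivAt_cartanEval hγ hγ1 (op.compAct φ h) x (Ad m h⁻¹ Y)
    rw [hx, map_zero, map_zero] at h1
    simpa only [compAct_apply, mul_inv_rev, Ad_mul, map_mul, AlgEquiv.mul_apply] using h1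

end GOperation

/-! ### The invariant connection of an equivariant connection -/

theorem ExteriorAlgebra.contract_ι {V : Type*} [AddCommGroup V] [Module ℝ V]
    (φ : Module.Dual ℝ V) (v : V) :
    ExteriorAlgebra.contract φ (ExteriorAlgebra.ι ℝ v) = φ v • 1 :=
  (CliffordAlgebra.contractLeft_ι _ _ _).trans (Algebra.algebraMap_eq_smul_one _)

namespace WeilAlgebra

variable {𝔤 : Type*} [LieRing 𝔤] [LieAlgebra ℝ 𝔤]

theorem tmul_ι_mem_deg (ξ : Module.Dual ℝ 𝔤) : tmul 1 (ExteriorAlgebra.ι ℝ ξ) ∈ deg 𝔤 1 := by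
  refine Submodule.mem_iSup_of_mem 0 (Submodule.mem_iSup_of_mem 1
    (Submodule.mem_iSup_of_mem (by norm_num) ?_))
  refine Submodule.apply_mem_map₂ _ ?_ ?_
  · rw [pow_zero]
    exact Submodule.one_le.1 le_rfl
  · rw [pow_one]
    exact LinearMap.mem_range_self _ ξ

theorem contr_tmul_ι (X : 𝔤) (ξ : Module.Dual ℝ 𝔤) :
    contr X (tmul 1 (ExteriorAlgebra.ι ℝ ξ)) = ξ X • 1 := by
  rw [contr_tmul, ExteriorAlgebra.contract_ι, tmul_smul, one_eq_tmul]
  rfl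

theorem contr_tmul_one (X : 𝔤) (s : SymmetricAlgebra ℝ (Module.Dual ℝ 𝔤)) :
    contr X (tmul s 1) = 0 := by
  rw [contr_tmul, ExteriorAlgebra.contract_one]
  exact map_zero (tmulₗ 𝔤 s)

/-- The structure equation `dθ = Ω + quadratic` in the Weil algebra. -/
theorem d_tmul_ι [Module.Finite ℝ 𝔤] (ξ : Module.Dual ℝ 𝔤) :
    d 𝔤 (tmul 1 (ExteriorAlgebra.ι ℝ ξ)) = ∑ k, (1 / 2 : ℝ) •
      (tmul 1 (ExteriorAlgebra.ι ℝ ((Module.finBasis ℝ 𝔤).coord k)) *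
        tmul 1 (ExteriorAlgebra.ι ℝ (coad (Module.finBasis ℝ 𝔤 k) ξ))) +
      tmul (SymmetricAlgebra.ι ℝ _ ξ) 1 := by
  have h1 : ∀ k, tmul (SymmetricAlgebra.ι ℝ _ ((Module.finBasis ℝ 𝔤).coord k) * 1)
      (ExteriorAlgebra.contract (Module.Dual.eval ℝ 𝔤 (Module.finBasis ℝ 𝔤 k))
        (ExteriorAlgebra.ι ℝ ξ)) =
      ξ (Module.finBasis ℝ 𝔤 k) •
        tmul (SymmetricAlgebra.ι ℝ _ ((Module.finBasis ℝ 𝔤).coord k)) 1 := fun k => by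
    rw [mul_one, ExteriorAlgebra.contract_ι, tmul_smul]
    rfl
  have h2 : tmul (SymmetricAlgebra.ι ℝ _ ξ) (1 : ExteriorAlgebra ℝ (Module.Dual ℝ 𝔤)) =
      ∑ k, ξ (Module.finBasis ℝ 𝔤 k) •
        tmul (SymmetricAlgebra.ι ℝ _ ((Module.finBasis ℝ 𝔤).coord k)) 1 := by
    have h := congrArg ((tmulₗ 𝔤).flip 1 ∘ₗ SymmetricAlgebra.ι ℝ _)
      (dual_eq_sum_coord (Module.finBasis ℝ 𝔤) ξ)
    rw [map_sum] at h
    simp only [map_smul] at h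
    exact h
  rw [d_tmul, h2, ← Finset.sum_add_distrib]
  refine Finset.sum_congr rfl fun k _ => ?_
  rw [h1, SymmetricAlgebra.derivation_one (SymmetricAlgebra.symDeriv_mul _),
    ExteriorAlgebra.extEvenDeriv_ι, tmul_mul_tmul, one_mul]
  congr 1
  exact (congrArg₂ _ rfl ((LinearMap.map_zero₂ (tmulₗ 𝔤) _))).trans (add_zero _)

end WeilAlgebra

namespace EquivariantConnection

variable {m : ℕ} {G A : Type*} [TopologicalSpace G] [ChartedSpace (EuclideanSpace ℝ (Fin m)) G]
  [Group G] [LieGroup (𝓡 m) ∞ G] [Ring A] [Algebra ℝ A] [TopologicalSpace A] [FrechetAlgebra A]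
  {op : GOperation m G A} {N : Subgroup G} [N.Normal] (θ : EquivariantConnection op N)

/-- The connection form of an equivariant connection. -/
def form : Module.Dual ℝ (lieIdeal m N) →ₗ[ℝ] A :=
  θ.toAlgHom.toLinearMap ∘ₗ WeilAlgebra.tmulₗ _ 1 ∘ₗ ExteriorAlgebra.ι ℝ

/-- The curvature form of an equivariant connection. -/
def curvature : Module.Dual ℝ (lieIdeal m N) →ₗ[ℝ] A :=
  θ.toAlgHom.toLinearMap ∘ₗ (WeilAlgebra.tmulₗ _).flip 1 ∘ₗ SymmetricAlgebra.ι ℝ _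

theorem form_apply (ξ : Module.Dual ℝ (lieIdeal m N)) :
    θ.form ξ = θ.toAlgHom (WeilAlgebra.tmul 1 (ExteriorAlgebra.ι ℝ ξ)) := rfl

theorem curvature_apply (ξ : Module.Dual ℝ (lieIdeal m N)) :
    θ.curvature ξ = θ.toAlgHom (WeilAlgebra.tmul (SymmetricAlgebra.ι ℝ _ ξ) 1) := rfl

theorem act_form (g : G) (ξ : Module.Dual ℝ (lieIdeal m N)) :
    op.act g (θ.form ξ) = θ.form (ξ ∘ₗ (Ad m g⁻¹).restrict (p := (lieIdeal m N).toSubmodule)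
      (q := (lieIdeal m N).toSubmodule) fun _ hX => Ad_mem_lieIdeal g⁻¹ hX) := by
  rw [form_apply, ← θ.equivariant, coadjointAction, WeilAlgebra.pullback_tmul, map_one]
  refine congrArg (fun l => θ.toAlgHom (WeilAlgebra.tmul 1 l)) ?_
  exact ExteriorAlgebra.map_apply_ι _ _

/-- The infinitesimal form of the equivariance of a connection. -/
theorem lie_form (X : LieAlg m G) (ξ : Module.Dual ℝ (lieIdeal m N)) :
    op.lie X (θ.form ξ) = -θ.form (ξ ∘ₗ LieOperation.adIdeal (lieIdeal m N) X) := by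
  refine (SeparatingDual.eq_iff_forall_dual_eq (R := ℝ)).2 fun φ => ?_
  obtain ⟨γ, hγ1, hγ, rfl⟩ := exists_curve X
  obtain ⟨ξ', hξ'⟩ := LinearMap.exists_extend (p := (lieIdeal m N).toSubmodule) ξ
  have hξ : ∀ Y : lieIdeal m N, ξ Y = ξ' (Y : LieAlg m G) := fun Y =>
    (DFunLike.congr_fun hξ' Y).symm
  let b := Module.finBasis ℝ (lieIdeal m N)
  have hexp : ∀ η : Module.Dual ℝ (lieIdeal m N),
      φ (θ.form η) = ∑ i, η (b i) * φ (θ.form (b.coord i)) := fun η => by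
    conv_lhs => rw [dual_eq_sum_coord b η, map_sum, map_sum]
    simp only [map_smul, smul_eq_mul]
  have h1 := op.hasDerivAt_act hγ hγ1 (θ.form ξ) φ
  have h2 : HasDerivAt (fun t => φ (op.act (γ t) (θ.form ξ)))
      (∑ i, -ξ' ⁅velocity m γ, (b i : LieAlg m G)⁆ * φ (θ.form (b.coord i))) 0 := by
    have h3 : ∀ i, HasDerivAt
        (fun t => ξ' (Ad m (γ t)⁻¹ (b i : LieAlg m G)) * φ (θ.form (b.coord i)))
        (-ξ' ⁅velocity m γ, (b i : LieAlg m G)⁆ * φ (θ.form (b.coord i))) 0 := fun i =>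
      (hasDerivAt_dual_Ad_inv hγ hγ1 ξ' _).mul_const _
    refine (HasDerivAt.fun_sum fun i _ => h3 i).congr_of_eventuallyEq
      (Filter.Eventually.of_forall fun t => ?_)
    refine (congrArg φ (θ.act_form (γ t) ξ)).trans ((hexp _).trans ?_)
    refine Finset.sum_congr rfl fun i _ => ?_
    rw [LinearMap.comp_apply, hξ]
    rfl
  rw [h1.unique h2, map_neg, hexp, ← Finset.sum_neg_distrib]
  refine Finset.sum_congr rfl fun i _ => ?_
  rw [LinearMap.comp_apply, hξ, LieOperation.coe_adIdeal, neg_mul]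

/-- The infinitesimal invariant connection given by an equivariant connection. -/
def toInvariantConnection : op.toLieOperation.InvariantConnection (lieIdeal m N) where
  form := θ.form
  curvature := θ.curvature
  form_mem ξ := θ.map_deg (WeilAlgebra.tmul_ι_mem_deg ξ)
  contr_form X ξ := by
    have h := θ.map_contr X (WeilAlgebra.tmul 1 (ExteriorAlgebra.ι ℝ ξ))
    rw [WeilAlgebra.contr_tmul_ι, map_smul, map_one] at h
    exact h.symm
  contr_curvature X ξ := by
    have h := θ.map_contr X (WeilAlgebra.tmul (SymmetricAlgebra.ι ℝ _ ξ) 1)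
    rw [WeilAlgebra.contr_tmul_one, map_zero] at h
    exact h.symm
  d_form ξ := by
    have h := θ.map_d (WeilAlgebra.tmul 1 (ExteriorAlgebra.ι ℝ ξ))
    rw [WeilAlgebra.d_tmul_ι, map_add, ← curvature_apply, ← form_apply] at h
    rw [← h, add_sub_cancel_right, map_sum]
    refine sum_mem fun k _ => ?_
    rw [map_smul, map_mul, ← form_apply, ← form_apply]
    exact Submodule.smul_mem _ _ (Submodule.mul_mem_mul (LinearMap.mem_range_self _ _)
      (LinearMap.mem_range_self _ _))
  lie_form := θ.lie_form

end EquivariantConnection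

/-! ### Reduction of the Weil and Cartan models -/

/-- Pulling back along `f` and applying `e` to the coefficients amounts to composing polynomial maps
with `f` and `e`. -/
theorem cartanEval_map {V W A B : Type*} [AddCommGroup V] [Module ℝ V] [AddCommGroup W]
    [Module ℝ W] [Ring A] [Algebra ℝ A] [Ring B] [Algebra ℝ B] (f : V →ₗ[ℝ] W) (e : B →ₗ[ℝ] A)
    (Y : V) (x : SymmetricAlgebra ℝ (Module.Dual ℝ W) ⊗[ℝ] B) :
    cartanEval A Y (TensorProduct.map (SymmetricAlgebra.map f.dualMap).toLinearMap e x) =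
      e (cartanEval B (f Y) x) := by
  have : cartanEval A Y ∘ₗ TensorProduct.map (SymmetricAlgebra.map f.dualMap).toLinearMap e =
      e ∘ₗ cartanEval B (f Y) :=
    TensorProduct.ext' fun s a => by
      simp only [LinearMap.comp_apply, TensorProduct.map_tmul, cartanEval_tmul,
        AlgHom.toLinearMap_apply, SymmetricAlgebra.evalAt_map, map_smul]
  exact DFunLike.congr_fun this x

theorem cartanEval_lTensor {V A B : Type*} [AddCommGroup V] [Module ℝ V]
    [Ring A] [Algebra ℝ A] [Ring B] [Algebra ℝ B] (e : B →ₗ[ℝ] A)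
    (Y : V) (x : SymmetricAlgebra ℝ (Module.Dual ℝ V) ⊗[ℝ] B) :
    cartanEval A Y (e.lTensor _ x) = e (cartanEval B Y x) := by
  have : cartanEval A Y ∘ₗ e.lTensor _ = e ∘ₗ cartanEval B Y :=
    TensorProduct.ext' fun s a => by
      simp only [LinearMap.comp_apply, LinearMap.lTensor_tmul, cartanEval_tmul, map_smul]
  exact DFunLike.congr_fun this x

/-- Linear maps that agree on the values of a tensor in `S V* ⊗ B`, regarded as a polynomial map
`V → B`, agree on its coefficients. -/
theorem eq_on_coeff_of_cartanEval {V A B ι : Type*} [AddCommGroup V] [Module ℝ V]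
    [Module.Finite ℝ V] [Ring A] [Algebra ℝ A] [Ring B] [Algebra ℝ B]
    (b : Module.Basis ι ℝ (SymmetricAlgebra ℝ (Module.Dual ℝ V))) (c : ι →₀ B) {e e' : B →ₗ[ℝ] A}
    (h : ∀ Y, e (cartanEval B Y (c.sum fun i a => b i ⊗ₜ[ℝ] a)) =
      e' (cartanEval B Y (c.sum fun i a => b i ⊗ₜ[ℝ] a))) (i : ι) : e (c i) = e' (c i) := by
  have h0 : (e - e').lTensor _ (c.sum fun i a => b i ⊗ₜ[ℝ] a) = 0 :=
    eq_zero_of_cartanEval fun Y => by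
      rw [cartanEval_lTensor, LinearMap.sub_apply, h, sub_self]
  have h1 : (c.mapRange (e - e') (map_zero _)).sum (fun i a => b i ⊗ₜ[ℝ] a) = 0 := by
    rw [Finsupp.sum_mapRange_index fun i => TensorProduct.tmul_zero _ _]
    simpa only [Finsupp.sum, map_sum, LinearMap.lTensor_tmul] using h0
  have h2 := DFunLike.congr_fun (TensorProduct.sum_tmul_basis_left_eq_zero b _ h1) i
  exact sub_eq_zero.1 h2

namespace GOperation

variable {m : ℕ} {G A : Type*} [TopologicalSpace G] [ChartedSpace (EuclideanSpace ℝ (Fin m)) G]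
  [Group G] [LieGroup (𝓡 m) ∞ G] [Ring A] [Algebra ℝ A] [TopologicalSpace A] [FrechetAlgebra A]
  (op : GOperation m G A) (N : Subgroup G) [N.Normal]

variable (m) in
/-- The projection of the Lie algebra of `G` onto its quotient by the Lie algebra of `N`. -/
abbrev lieQuot : LieAlg m G →ₗ[ℝ] LieAlg m G ⧸ lieIdeal m N := (lieIdeal m N).toSubmodule.mkQ

theorem lieQuot_lie (X Y : LieAlg m G) :
    lieQuot m N ⁅X, Y⁆ = ⁅lieQuot m N X, lieQuot m N Y⁆ := rfl

theorem lieQuot_surjective : Function.Surjective (lieQuot m N) :=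
  (lieIdeal m N).toSubmodule.mkQ_surjective

theorem reduction_lie (X : LieAlg m G) (b : op.basicSubalgebra N) :
    ((op.reduction N).lie (lieQuot m N X) b : A) = op.lie X b := rfl

theorem reduction_contr (X : LieAlg m G) (b : op.basicSubalgebra N) :
    ((op.reduction N).contr (lieQuot m N X) b : A) = op.contr X b := rfl

theorem reduction_d (b : op.basicSubalgebra N) : ((op.reduction N).d b : A) = op.d b := rfl

theorem reduction_euler (b : op.basicSubalgebra N) :
    ((op.reduction N).euler b : A) = op.euler b := by
  have : (op.basicSubalgebra N).val.toLinearMap ∘ₗ (op.reduction N).euler =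
      op.euler ∘ₗ (op.basicSubalgebra N).val.toLinearMap :=
    (op.reduction N).hom_ext_deg fun p a ha => by
      have h : op.euler (a : A) = (p : ℝ) • (a : A) := op.euler_of_mem ha
      rw [LinearMap.comp_apply, LinearMap.comp_apply, (op.reduction N).euler_of_mem ha]
      exact h.symm
  exact DFunLike.congr_fun this b

theorem inclusion_tmul (w : WeilAlgebra (LieAlg m G ⧸ lieIdeal m N)) (b : op.basicSubalgebra N) :
    op.inclusion N (w ⊗ₜ b) = WeilAlgebra.pullback (lieQuot m N) w ⊗ₜ (b : A) := rfl

theorem inclusion_weilD (x : WeilAlgebra (LieAlg m G ⧸ lieIdeal m N) ⊗[ℝ] op.basicSubalgebra N) :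
    op.inclusion N ((op.reduction N).weilD x) = op.weilD (op.inclusion N x) := by
  have : op.inclusion N ∘ₗ (op.reduction N).weilD = op.weilD ∘ₗ op.inclusion N :=
    TensorProduct.ext' fun w b => by
      have hd := WeilAlgebra.pullback_d (f := lieQuot m N) (lieQuot_lie N) w
      simp only [LinearMap.comp_apply, LieOperation.weilD_tmul, map_add, inclusion_tmul,
        hd, WeilAlgebra.pullback_parity, reduction_d]
  exact DFunLike.congr_fun this x

theorem inclusion_weilLie (X : LieAlg m G)
    (x : WeilAlgebra (LieAlg m G ⧸ lieIdeal m N) ⊗[ℝ] op.basicSubalgebra N) :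
    op.inclusion N ((op.reduction N).weilLie (lieQuot m N X) x) =
      op.weilLie X (op.inclusion N x) := by
  have : op.inclusion N ∘ₗ (op.reduction N).weilLie (lieQuot m N X) =
      op.weilLie X ∘ₗ op.inclusion N :=
    TensorProduct.ext' fun w b => by
      have hl := WeilAlgebra.pullback_lie (f := lieQuot m N) (lieQuot_lie N) X w
      simp only [LinearMap.comp_apply, LieOperation.weilLie_tmul, map_add, inclusion_tmul,
        hl, reduction_lie]
  exact DFunLike.congr_fun this x

theorem inclusion_weilContr (X : LieAlg m G)
    (x : WeilAlgebra (LieAlg m G ⧸ lieIdeal m N) ⊗[ℝ] op.basicSubalgebra N) :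
    op.inclusion N ((op.reduction N).weilContr (lieQuot m N X) x) =
      op.weilContr X (op.inclusion N x) := by
  have : op.inclusion N ∘ₗ (op.reduction N).weilContr (lieQuot m N X) =
      op.weilContr X ∘ₗ op.inclusion N :=
    TensorProduct.ext' fun w b => by
      simp only [LinearMap.comp_apply, LieOperation.weilContr_tmul, map_add, inclusion_tmul,
        WeilAlgebra.pullback_contr, WeilAlgebra.pullback_parity, reduction_contr]
  exact DFunLike.congr_fun this x

theorem inclusion_weilEuler
    (x : WeilAlgebra (LieAlg m G ⧸ lieIdeal m N) ⊗[ℝ] op.basicSubalgebra N) :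
    op.inclusion N ((op.reduction N).weilEuler x) = op.weilEuler (op.inclusion N x) := by
  have : op.inclusion N ∘ₗ (op.reduction N).weilEuler = op.weilEuler ∘ₗ op.inclusion N :=
    TensorProduct.ext' fun w b => by
      simp only [LinearMap.comp_apply, LieOperation.weilEuler_tmul, map_add, inclusion_tmul,
        WeilAlgebra.pullback_euler, reduction_euler]
  exact DFunLike.congr_fun this x

theorem inclusion_mem_weilBasic
    {x : WeilAlgebra (LieAlg m G ⧸ lieIdeal m N) ⊗[ℝ] op.basicSubalgebra N}
    (hx : x ∈ (op.reduction N).weilBasic) : op.inclusion N x ∈ op.weilBasic := by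
  rw [LieOperation.mem_weilBasic_iff] at hx ⊢
  exact ⟨fun X => by rw [← inclusion_weilLie, hx.1, map_zero],
    fun X => by rw [← inclusion_weilContr, hx.2, map_zero]⟩

theorem inclusion_mem_weilDeg {n : ℤ}
    {x : WeilAlgebra (LieAlg m G ⧸ lieIdeal m N) ⊗[ℝ] op.basicSubalgebra N}
    (hx : x ∈ (op.reduction N).weilDeg n) : op.inclusion N x ∈ op.weilDeg n := by
  rw [LieOperation.mem_weilDeg_iff] at hx ⊢
  rw [← inclusion_weilEuler, hx, map_smul]

theorem inclusion_mem_weilCocycles {n : ℤ}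
    {x : WeilAlgebra (LieAlg m G ⧸ lieIdeal m N) ⊗[ℝ] op.basicSubalgebra N}
    (hx : x ∈ (op.reduction N).weilCocycles n) : op.inclusion N x ∈ op.weilCocycles n := by
  refine ⟨⟨op.inclusion_mem_weilBasic N hx.1.1, op.inclusion_mem_weilDeg N hx.1.2⟩, ?_⟩
  exact LinearMap.mem_ker.2 (by rw [← inclusion_weilD, LinearMap.mem_ker.1 hx.2, map_zero])

/-- The inclusion `S𝔮* ⊗ A_{N,bas} → S𝔤* ⊗ A` of Cartan models. -/
def cartanInclusion : SymmetricAlgebra ℝ (Module.Dual ℝ (LieAlg m G ⧸ lieIdeal m N)) ⊗[ℝ]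
    op.basicSubalgebra N →ₗ[ℝ] SymmetricAlgebra ℝ (Module.Dual ℝ (LieAlg m G)) ⊗[ℝ] A :=
  TensorProduct.map (SymmetricAlgebra.map (lieQuot m N).dualMap).toLinearMap
    (op.basicSubalgebra N).val.toLinearMap

theorem cartanInclusion_tmul
    (s : SymmetricAlgebra ℝ (Module.Dual ℝ (LieAlg m G ⧸ lieIdeal m N)))
    (b : op.basicSubalgebra N) :
    op.cartanInclusion N (s ⊗ₜ b) = SymmetricAlgebra.map (lieQuot m N).dualMap s ⊗ₜ (b : A) := rfl

theorem cartanInclusion_injective : Function.Injective (op.cartanInclusion N) :=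
  TensorProduct.map_injective_of_flat_flat _ _
    (SymmetricAlgebra.map_injective
      (LinearMap.dualMap_injective_of_surjective (lieQuot_surjective N)))
    Subtype.val_injective

theorem toCartan_inclusion
    (x : WeilAlgebra (LieAlg m G ⧸ lieIdeal m N) ⊗[ℝ] op.basicSubalgebra N) :
    LieOperation.toCartan _ A (op.inclusion N x) =
      op.cartanInclusion N (LieOperation.toCartan _ (op.basicSubalgebra N) x) := by
  have : LieOperation.toCartan _ A ∘ₗ op.inclusion N =
      op.cartanInclusion N ∘ₗ LieOperation.toCartan _ (op.basicSubalgebra N) :=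
    TensorProduct.ext' fun w b => by
      simp only [LinearMap.comp_apply, LieOperation.toCartan_tmul, inclusion_tmul,
        cartanInclusion_tmul, WeilAlgebra.augment_pullback]
  exact DFunLike.congr_fun this x

theorem cartanInclusion_cartanLie (X : LieAlg m G)
    (y : SymmetricAlgebra ℝ (Module.Dual ℝ (LieAlg m G ⧸ lieIdeal m N)) ⊗[ℝ]
      op.basicSubalgebra N) :
    op.cartanInclusion N ((op.reduction N).cartanLie (lieQuot m N X) y) =
      op.cartanLie X (op.cartanInclusion N y) := by
  have : op.cartanInclusion N ∘ₗ (op.reduction N).cartanLie (lieQuot m N X) =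
      op.cartanLie X ∘ₗ op.cartanInclusion N :=
    TensorProduct.ext' fun s b => by
      simp only [LinearMap.comp_apply, LieOperation.cartanLie_tmul, map_add,
        cartanInclusion_tmul, SymmetricAlgebra.map_symDeriv
          (WeilAlgebra.dualMap_coad (lieQuot_lie N) X), reduction_lie]
  exact DFunLike.congr_fun this y

theorem cartanInclusion_cartanEuler
    (y : SymmetricAlgebra ℝ (Module.Dual ℝ (LieAlg m G ⧸ lieIdeal m N)) ⊗[ℝ]
      op.basicSubalgebra N) :
    op.cartanInclusion N ((op.reduction N).cartanEuler y) =
      op.cartanEuler (op.cartanInclusion N y) := by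
  have : op.cartanInclusion N ∘ₗ (op.reduction N).cartanEuler =
      op.cartanEuler ∘ₗ op.cartanInclusion N :=
    TensorProduct.ext' fun s b => by
      simp only [LinearMap.comp_apply, LieOperation.cartanEuler_tmul, map_add,
        cartanInclusion_tmul, map_smul, SymmetricAlgebra.map_symDeriv (s := LinearMap.id)
          (t := LinearMap.id) (f := (lieQuot m N).dualMap) rfl, reduction_euler]
  exact DFunLike.congr_fun this y

theorem cartanInclusion_mem_cartanReduced
    (y : SymmetricAlgebra ℝ (Module.Dual ℝ (LieAlg m G ⧸ lieIdeal m N)) ⊗[ℝ]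
      op.basicSubalgebra N) :
    op.cartanInclusion N y ∈ op.toLieOperation.cartanReduced (lieIdeal m N) := by
  induction y using TensorProduct.induction_on with
  | zero => rw [map_zero]; exact zero_mem _
  | add x y hx hy => rw [map_add]; exact add_mem hx hy
  | tmul s b => exact ⟨s ⊗ₜ ⟨b, b.2.2⟩, rfl⟩

theorem lieQuot_Ad {g : G} (hg : g ∈ N) (X : LieAlg m G) :
    lieQuot m N (Ad m g X) = lieQuot m N X :=
  (Submodule.Quotient.eq _).2 (Ad_mul_inv_sub_mem hg X)

/-- The values of an invariant element of `S(𝔤/𝔫)* ⊗ A_hor` are `N`-invariant, because `N` acts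
trivially on `𝔤/𝔫`. -/
theorem act_cartanEval_of_mem [ConnectedSpace G]
    {y : SymmetricAlgebra ℝ (Module.Dual ℝ (LieAlg m G ⧸ lieIdeal m N)) ⊗[ℝ]
      op.toLieOperation.horizontalSubalgebra (lieIdeal m N)}
    (hy : ∀ X, op.cartanLie X (TensorProduct.map
      (SymmetricAlgebra.map (lieQuot m N).dualMap).toLinearMap
      (op.toLieOperation.horizontalSubalgebra (lieIdeal m N)).val.toLinearMap y) = 0)
    {g : G} (hg : g ∈ N) (Y : LieAlg m G ⧸ lieIdeal m N) :
    op.act g (cartanEval _ Y y : op.toLieOperation.horizontalSubalgebra (lieIdeal m N)) =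
      (cartanEval _ Y y : op.toLieOperation.horizontalSubalgebra (lieIdeal m N)) := by
  obtain ⟨Y, rfl⟩ := lieQuot_surjective N Y
  have h := op.act_cartanEval hy g Y
  rw [cartanEval_map, cartanEval_map, lieQuot_Ad N (N.inv_mem hg)] at h
  exact h

/-- Over a connected group, the invariant elements in the image of `S(𝔤/𝔫)* ⊗ A_hor` come from
`S(𝔤/𝔫)* ⊗ A_{N,bas}`: their coefficients are not only annihilated by the contractions along `𝔫` but
also `N`-invariant.  (`N` itself need not be connected.) -/
theorem mem_range_cartanInclusion [ConnectedSpace G]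
    {x : SymmetricAlgebra ℝ (Module.Dual ℝ (LieAlg m G)) ⊗[ℝ] A}
    (hx : ∀ X, op.cartanLie X x = 0)
    (hx' : x ∈ op.toLieOperation.cartanReduced (lieIdeal m N)) :
    ∃ y, op.cartanInclusion N y = x := by
  obtain ⟨y, rfl⟩ := hx'
  let b := Module.Basis.ofVectorSpace ℝ
    (SymmetricAlgebra ℝ (Module.Dual ℝ (LieAlg m G ⧸ lieIdeal m N)))
  obtain ⟨c, rfl⟩ := TensorProduct.eq_repr_basis_left b y
  let e : op.toLieOperation.horizontalSubalgebra (lieIdeal m N) →ₗ[ℝ] A :=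
    (op.toLieOperation.horizontalSubalgebra (lieIdeal m N)).val.toLinearMap
  -- The values of `y` are `N`-invariant, hence so are its coefficients.
  have hinv : ∀ i, ∀ g ∈ N, op.act g (c i : A) = c i := fun i g hg =>
    eq_on_coeff_of_cartanEval b c (e := (op.act g).toLinearMap ∘ₗ e) (e' := e)
      (fun Y => op.act_cartanEval_of_mem N hx hg Y) i
  refine ⟨∑ i ∈ c.support, b i ⊗ₜ[ℝ] ⟨c i, hinv i, (c i).2⟩, ?_⟩
  simp only [Finsupp.sum, map_sum]
  rfl

end GOperation

/-! ### Comparison of the cohomologies -/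

/-- A linear map induces an isomorphism of subquotients if it respects the subspaces, reflects the
smaller one, and hits every class. -/
theorem Submodule.exists_subquotientEquiv {V W : Type*} [AddCommGroup V] [Module ℝ V]
    [AddCommGroup W] [Module ℝ W] (j : V →ₗ[ℝ] W) {Z B : Submodule ℝ V} {Z' B' : Submodule ℝ W}
    (hZ : ∀ z ∈ Z, j z ∈ Z') (hB : ∀ z ∈ B, j z ∈ B') (hinj : ∀ z ∈ Z, j z ∈ B' → z ∈ B)
    (hsurj : ∀ z' ∈ Z', ∃ z ∈ Z, j z - z' ∈ B') :
    ∃ Φ : (Z ⧸ B.submoduleOf Z) ≃ₗ[ℝ] (Z' ⧸ B'.submoduleOf Z'),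
      ∀ z : Z, Φ ((B.submoduleOf Z).mkQ z) = (B'.submoduleOf Z').mkQ ⟨j z, hZ z z.2⟩ := by
  let Ψ := (B.submoduleOf Z).mapQ (B'.submoduleOf Z') (j.restrict hZ) fun z hz => hB z hz
  have h1 : Function.Injective Ψ := by
    rw [← LinearMap.ker_eq_bot, LinearMap.ker_eq_bot']
    intro q hq
    obtain ⟨z, rfl⟩ := (B.submoduleOf Z).mkQ_surjective q
    rw [Submodule.mkQ_apply] at hq
    replace hq := (Submodule.Quotient.mk_eq_zero _).1 hq
    rw [Submodule.mkQ_apply, Submodule.Quotient.mk_eq_zero]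
    exact hinj z z.2 hq
  have h2 : Function.Surjective Ψ := by
    intro q
    obtain ⟨z', rfl⟩ := (B'.submoduleOf Z').mkQ_surjective q
    obtain ⟨z, hz, h⟩ := hsurj z' z'.2
    refine ⟨(B.submoduleOf Z).mkQ ⟨z, hz⟩, ?_⟩
    exact (Submodule.Quotient.eq _).2 h
  exact ⟨LinearEquiv.ofBijective Ψ ⟨h1, h2⟩, fun z => rfl⟩

namespace GOperation

variable {m : ℕ} {G A : Type*} [TopologicalSpace G] [ChartedSpace (EuclideanSpace ℝ (Fin m)) G]
  [Group G] [LieGroup (𝓡 m) ∞ G] [Ring A] [Algebra ℝ A] [TopologicalSpace A] [FrechetAlgebra A]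
  (op : GOperation m G A) (N : Subgroup G) [N.Normal]

theorem mem_cartanInvariant_of_cartanInclusion {n : ℤ}
    {y : SymmetricAlgebra ℝ (Module.Dual ℝ (LieAlg m G ⧸ lieIdeal m N)) ⊗[ℝ]
      op.basicSubalgebra N}
    (hy : op.cartanInclusion N y ∈ op.toLieOperation.cartanInvariant n) :
    y ∈ (op.reduction N).cartanInvariant n := by
  rw [LieOperation.mem_cartanInvariant_iff] at hy ⊢
  refine ⟨fun X => ?_, ?_⟩
  · obtain ⟨X, rfl⟩ := lieQuot_surjective N X
    refine op.cartanInclusion_injective N ?_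
    rw [cartanInclusion_cartanLie, hy.1, map_zero]
  · refine op.cartanInclusion_injective N ?_
    rw [cartanInclusion_cartanEuler, hy.2]
    exact ((op.cartanInclusion N).map_smul _ _).symm

/-- Every invariant element of `S(𝔤/𝔫)* ⊗ A_hor` of degree `n` is the Cartan image of a basic
element of `W_Q ⊗ A_{N,bas}` of degree `n`. -/
theorem exists_weilBasic_reduction [ConnectedSpace G] {n : ℤ}
    {y : SymmetricAlgebra ℝ (Module.Dual ℝ (LieAlg m G)) ⊗[ℝ] A}
    (hy : y ∈ op.toLieOperation.cartanInvariant n)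
    (hy' : y ∈ op.toLieOperation.cartanReduced (lieIdeal m N)) :
    ∃ x ∈ (op.reduction N).weilBasic ⊓ (op.reduction N).weilDeg n,
      LieOperation.toCartan _ A (op.inclusion N x) = y := by
  obtain ⟨y, rfl⟩ := op.mem_range_cartanInclusion N
    (LieOperation.mem_cartanInvariant_iff.1 hy).1 hy'
  have hi := LieOperation.mem_cartanInvariant_iff.1
    (op.mem_cartanInvariant_of_cartanInclusion N hy)
  obtain ⟨x, hx, hxy⟩ := (op.reduction N).exists_weilBasic hi.1 hi.2
  exact ⟨x, hx, (op.toCartan_inclusion N x).trans (congrArg (op.cartanInclusion N) hxy)⟩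

variable {op N}

/-- The projection to the Cartan model sends basic elements to invariant ones. -/
theorem toCartan_mem_cartanInvariant {n : ℤ} {x : WeilAlgebra (LieAlg m G) ⊗[ℝ] A}
    (hx : x ∈ op.weilBasic ⊓ op.weilDeg n) :
    LieOperation.toCartan _ A x ∈ op.toLieOperation.cartanInvariant n := by
  rw [LieOperation.mem_cartanInvariant_iff]
  refine ⟨fun X => ?_, ?_⟩
  · rw [← LieOperation.toCartan_weilLie, (LieOperation.mem_weilBasic_iff.1 hx.1).1, map_zero]
  · rw [← LieOperation.toCartan_weilEuler, op.mem_weilDeg_iff.1 hx.2, map_smul]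

theorem inclusion_isHorizontal
    {x : WeilAlgebra (LieAlg m G ⧸ lieIdeal m N) ⊗[ℝ] op.basicSubalgebra N}
    (hx : (op.reduction N).IsHorizontal x) : op.toLieOperation.IsHorizontal (op.inclusion N x) :=
  fun X => by rw [← inclusion_weilContr, hx, map_zero]

/-- The inclusion of Weil models is injective on horizontal elements. -/
theorem eq_of_toCartan_inclusion_eq
    {x y : WeilAlgebra (LieAlg m G ⧸ lieIdeal m N) ⊗[ℝ] op.basicSubalgebra N}
    (hx : (op.reduction N).IsHorizontal x) (hy : (op.reduction N).IsHorizontal y)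
    (h : LieOperation.toCartan _ A (op.inclusion N x) =
      LieOperation.toCartan _ A (op.inclusion N y)) : x = y := by
  rw [toCartan_inclusion, toCartan_inclusion] at h
  exact hx.ext hy (op.cartanInclusion_injective N h)

theorem weilD_isHorizontal {𝔤 B : Type*} [LieRing 𝔤] [LieAlgebra ℝ 𝔤] [Module.Finite ℝ 𝔤] [Ring B]
    [Algebra ℝ B] {op : LieOperation 𝔤 B} {x : WeilAlgebra 𝔤 ⊗[ℝ] B} (hx : x ∈ op.weilBasic) :
    op.IsHorizontal (op.weilD x) :=
  (LieOperation.mem_weilBasic_iff.1 hx).2.weilD_of_basic (LieOperation.mem_weilBasic_iff.1 hx).1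

/-- Every basic cocycle is cohomologous to one in the image of the reduction. -/
theorem exists_inclusion_eq_add_weilD [ConnectedSpace G] (θ : EquivariantConnection op N) {n : ℤ}
    {z : WeilAlgebra (LieAlg m G) ⊗[ℝ] A} (hz : z ∈ op.weilCocycles n) :
    ∃ x ∈ (op.reduction N).weilCocycles n, ∃ v ∈ op.weilBasic ⊓ op.weilDeg (n - 1),
      op.inclusion N x = z + op.weilD v := by
  have hzh := (LieOperation.mem_weilBasic_iff.1 hz.1.1).2
  have hdz : op.cartanD (LieOperation.toCartan _ A z) = 0 := by
    rw [← op.toLieOperation.toCartan_weilD hzh, LinearMap.mem_ker.1 hz.2, map_zero]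
  obtain ⟨w, hw, y, hy, hyr, h1, h2⟩ :=
    θ.toInvariantConnection.exists_mem_cartanReduced (toCartan_mem_cartanInvariant hz.1)
  have hy1 := h1 hdz
  have hy2 : op.cartanD y = 0 := (h2 (by rw [hdz]; exact zero_mem _)).trans hdz
  obtain ⟨x, hx, rfl⟩ := op.exists_weilBasic_reduction N hy hyr
  rw [LieOperation.mem_cartanInvariant_iff] at hw
  obtain ⟨v, hv, rfl⟩ := op.exists_weilBasic hw.1 hw.2
  have hxh := (LieOperation.mem_weilBasic_iff.1 hx.1).2
  have hvh := (LieOperation.mem_weilBasic_iff.1 hv.1).2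
  refine ⟨x, ⟨hx, LinearMap.mem_ker.2 ?_⟩, v, hv, ?_⟩
  · refine eq_of_toCartan_inclusion_eq (weilD_isHorizontal hx.1) (fun X => map_zero _) ?_
    rw [inclusion_weilD, op.toLieOperation.toCartan_weilD (inclusion_isHorizontal hxh), hy2,
      map_zero, map_zero]
  · refine (inclusion_isHorizontal hxh).ext (hzh.add (weilD_isHorizontal hv.1)) ?_
    rw [hy1, map_add, op.toLieOperation.toCartan_weilD hvh]

/-- A basic element of the reduction that becomes a coboundary in `W_G ⊗ A` is a coboundary. -/
theorem mem_weilCoboundaries_of_inclusion [ConnectedSpace G] (θ : EquivariantConnection op N)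
    {n : ℤ} {z : WeilAlgebra (LieAlg m G ⧸ lieIdeal m N) ⊗[ℝ] op.basicSubalgebra N}
    (hz : z ∈ (op.reduction N).weilBasic) (h : op.inclusion N z ∈ op.weilCoboundaries n) :
    z ∈ (op.reduction N).weilCoboundaries n := by
  obtain ⟨v, hv, hvz⟩ := h
  have hvh := (LieOperation.mem_weilBasic_iff.1 hv.1).2
  have hd : op.cartanD (LieOperation.toCartan _ A v) =
      LieOperation.toCartan _ A (op.inclusion N z) := by
    rw [← op.toLieOperation.toCartan_weilD hvh, hvz]
  obtain ⟨w, hw, y, hy, hyr, h1, h2⟩ :=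
    θ.toInvariantConnection.exists_mem_cartanReduced (toCartan_mem_cartanInvariant hv)
  have hy2 := (h2 (by
    rw [hd, toCartan_inclusion]; exact op.cartanInclusion_mem_cartanReduced N _)).trans hd
  obtain ⟨x, hx, rfl⟩ := op.exists_weilBasic_reduction N hy hyr
  refine ⟨x, hx, eq_of_toCartan_inclusion_eq (weilD_isHorizontal hx.1)
    (LieOperation.mem_weilBasic_iff.1 hz).2 ?_⟩
  rw [inclusion_weilD, op.toLieOperation.toCartan_weilD
    (inclusion_isHorizontal (LieOperation.mem_weilBasic_iff.1 hx.1).2), hy2]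

end GOperation

theorem theorem5p1 {m : ℕ} {G : Type*} [TopologicalSpace G]
    [ChartedSpace (EuclideanSpace ℝ (Fin m)) G] [Group G] [LieGroup (𝓡 m) ∞ G] [ConnectedSpace G]
    (N : Subgroup G) [N.Normal] (hN : IsClosed (N : Set G))
    {A : Type*} [Ring A] [Algebra ℝ A] [TopologicalSpace A] [FrechetAlgebra A]
    (op : GOperation m G A) (θ : EquivariantConnection op N) :
    (∀ x, op.inclusion N ((op.reduction N).weilD x) = op.weilD (op.inclusion N x)) ∧
    (∀ x ∈ (op.reduction N).weilBasic, op.inclusion N x ∈ op.weilBasic) ∧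
    ∀ n : ℤ, ∃ (hj : ∀ z ∈ (op.reduction N).weilCocycles n, op.inclusion N z ∈ op.weilCocycles n)
      (Φ : (op.reduction N).WeilCohomology n ≃ₗ[ℝ] op.WeilCohomology n),
      ∀ z : (op.reduction N).weilCocycles n,
        Φ ((op.reduction N).weilClass n z) = op.weilClass n ⟨op.inclusion N z, hj z z.2⟩ := by
  refine ⟨op.inclusion_weilD N, fun x hx => op.inclusion_mem_weilBasic N hx, fun n => ?_⟩
  have hj : ∀ z ∈ (op.reduction N).weilCocycles n, op.inclusion N z ∈ op.weilCocycles n :=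
    fun z hz => op.inclusion_mem_weilCocycles N hz
  refine ⟨hj, Submodule.exists_subquotientEquiv (op.inclusion N) hj ?_
    (fun z hz => GOperation.mem_weilCoboundaries_of_inclusion θ hz.1.1) fun z hz => ?_⟩
  · rintro _ ⟨v, hv, rfl⟩
    exact ⟨op.inclusion N v,
      ⟨op.inclusion_mem_weilBasic N hv.1, op.inclusion_mem_weilDeg N hv.2⟩,
      (op.inclusion_weilD N v).symm⟩
  · obtain ⟨x, hx, v, hv, h⟩ := GOperation.exists_inclusion_eq_add_weilD θ hz
    exact ⟨x, hx, v, hv, (sub_eq_of_eq_add' h).symm⟩
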